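/- **Setting.** Let $\mathfrak g$ be a complex Kac–Moody Lie algebra of a generalized Cartan matrix, with Cartan subalgebra $\mathfrak h$, simple roots and coroots, Chevalley generators $e_i,f_i$; let $N^+$ be the subalgebra generated by the $e_i$, $\mathfrak g'=[\mathfrak g,\mathfrak g]$, $\mathfrak h'=\mathfrak h\cap\mathfrak g'$, and $\mathfrak h=\mathfrak h'\oplus\mathfrak h''$. Let $A=\mathbb C[t_1^{\pm1},\dots,t_n^{\pm1}]$, and let $\mathfrak g_A=\mathfrak g'\otimes A\oplus\mathfrak h''\supseteq\mathfrak g$ and $\mathfrak h_A=\mathfrak h'\otimes A\oplus\mathfrak h''\supseteq\mathfrak h$, with bracket $[X\otimes p,Y\otimes q]=[X,Y]\otimes pq$ (elements of $\mathfrak h''$ being regarded as $h\otimes 1$). For $\Psi\in\mathfrak h_A^*$ let $M(\Psi)=U(\mathfrak g_A)/J_\Psi$, where $J_\Psi$ is the left ideal generated by $N^+\otimes A$ and all $h-\Psi(h)$, $h\in\mathfrak h_A$, and let $V(\Psi)$ be the quotient of $M(\Psi)$ by the sum of its proper submodules (its irreducible quotient). The character of $V(\Psi)$ is the formal sum $\operatorname{ch}V(\Psi)=\sum_{\mu\in\mathfrak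 h^*}\dim V(\Psi)_\mu\,e^\mu$ over the $\mathfrak h$-weight spaces. A function $f:\mathbb Z^n\to\mathbb C$ is *exp-polynomial* (with exponents in $B\subseteq(\mathbb C^*)^n$) if it is a finite sum $f(m)=\sum_{\lambda}p_\lambda(m)\,\lambda_1^{m_1}\cdots\lambda_n^{m_n}$ with polynomials $p_\lambda$ and $\lambda\in(\mathbb C^*)^n$ (resp. $\lambda\in B$). Let $\psi\in\mathfrak h_A^*$ be such that $m\mapsto\psi(h\otimes t^m)$ is exp-polynomial for every $h\in\mathfrak h'$. Assume that the subalgebra $A_\psi\subseteq A$ generated by all $\psi(h\otimes t^m)t^m$ ($h\in\mathfrak h'$, $m\in\mathbb Z^n$) equals $\mathbb C[t_1^{\pm r_1},\dots,t_n^{\pm r_n}]$ with positive integers $r_i$; put $R=r_1\cdots r_n$ and $\overline\Gamma=\bigoplus_i\mathbb Z/r_i\mathbb Z$. Let $\xi_i$ be a primitive $r_i$-th root of unity, let $\overline\Gamma$ act on $(\mathbb C^*)^n$ by $k\cdot\lambda=(\xi_1^{k_1}\lambda_1,\dots,\xi_n^{k_n}\lambda_n)$, and let $B$ be a set of representatives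 of the orbits. For $k\in\overline\Gamma$ let $\sigma_k$ be the automorphism of $\mathfrak g_A$ with $\sigma_k(X\otimes t^m)=\xi_1^{k_1m_1}\cdots\xi_n^{k_nm_n}X\otimes t^m$ for $X\in\mathfrak g'$ and $\sigma_k=\mathrm{id}$ on $\mathfrak h''$, and for $\Phi\in\mathfrak h_A^*$ put $\xi^k\Phi=\Phi\circ\sigma_k|_{\mathfrak h_A}$. **Proposition.** There is $\Phi\in\mathfrak h_A^*$ such that $m\mapsto\Phi(h\otimes t^m)$ is exp-polynomial with exponents in $B$ for every $h\in\mathfrak h'$, and $$\psi=\sum_{k\in\overline\Gamma}\xi^k\Phi .$$ For every such $\Phi$: 1. $V(\psi)$ and $V(\Phi)$ are sums of their $\mathfrak h$-weight spaces, which are finite-dimensional; each coefficient of the $R$-th power of $\operatorname{ch}V(\Phi)$ is a finite sum; and $$\operatorname{ch}V(\psi)=(\operatorname{ch}V(\Phi))^R .$$ 2. For every $k\in\overline\Gamma$ the automorphism $\sigma_k$ is the identity on $\mathfrak g$, and there is a linear isomorphism $E:V(\xi^k\Phi)\to V(\Phi)$ with $E(xv)=\sigma_k(x)E(v)$ for all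 $x\in\mathfrak g_A$; in particular $V(\xi^k\Phi)\cong V(\Phi)$ as $\mathfrak g$-modules. -/

import Mathlib

open scoped TensorProduct

noncomputable section

namespace LoopKM

/-! ### Kac-Moody algebras -/

/-- Generalized Cartan matrices. -/
structure IsGCM {ι : Type*} (C : Matrix ι ι ℤ) : Prop where
  diag : ∀ i, C i i = 2
  nonpos : ∀ i j, i ≠ j → C i j ≤ 0
  zero_symm : ∀ i j, C i j = 0 → C j i = 0

/-- The data and laws saying that `g` is the Kac-Moody algebra `g(C)`: a realization
`(𝔥, roots, coroots)` of `C` inside `g` together with Chevalley generators, such that `g` is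
generated by `𝔥`, the `e i` and the `f i` and has no nonzero ideal meeting `𝔥` trivially.
This determines `(g, 𝔥, roots, coroots)` up to isomorphism. -/
structure KacMoody {ι : Type*} [Fintype ι] [DecidableEq ι] (C : Matrix ι ι ℤ)
    (g : Type*) [LieRing g] [LieAlgebra ℂ g] where
  /-- the Cartan subalgebra -/
  cartan : Submodule ℂ g
  /-- the simple roots -/
  root : ι → Module.Dual ℂ cartan
  /-- the simple coroots -/
  coroot : ι → cartan
  /-- the positive Chevalley generators -/
  e : ι → g
  /-- the negative Chevalley generators -/
  f : ι → g
  finite_cartan : FiniteDimensional ℂ cartan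
  finrank_cartan :
    Module.finrank ℂ cartan + (C.map (Int.cast : ℤ → ℂ)).rank = 2 * Fintype.card ι
  root_indep : LinearIndependent ℂ root
  coroot_indep : LinearIndependent ℂ coroot
  root_coroot : ∀ i j, root j (coroot i) = (C i j : ℂ)
  lie_cartan : ∀ x y : cartan, ⁅(x : g), (y : g)⁆ = 0
  lie_e_f : ∀ i j, ⁅e i, f j⁆ = if i = j then (coroot i : g) else 0
  lie_cartan_e : ∀ (x : cartan) (i : ι), ⁅(x : g), e i⁆ = root i x • e i
  lie_cartan_f : ∀ (x : cartan) (i : ι), ⁅(x : g), f i⁆ = -(root i x • f i)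
  generate :
    LieSubalgebra.lieSpan ℂ g ((cartan : Set g) ∪ Set.range e ∪ Set.range f) = ⊤
  no_ideal : ∀ I : LieIdeal ℂ g, (∀ x ∈ I, x ∈ cartan → x = 0) → I = ⊥

/-! ### Laurent polynomials and the loop Kac-Moody algebra -/

/-- `A = ℂ[t₁^{±1}, …, tₙ^{±1}]`. -/
abbrev Laurent (n : ℕ) : Type := AddMonoidAlgebra ℂ (Fin n → ℤ)

/-- The monomial `t^m`. -/
def mono {n : ℕ} (m : Fin n → ℤ) : Laurent n := AddMonoidAlgebra.single m 1

/-- The character `m ↦ a₁^{m₁} ⋯ aₙ^{mₙ}` of `ℤⁿ` attached to `a ∈ (ℂ^*)ⁿ`. -/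
def expo {n : ℕ} (a : Fin n → ℂˣ) (m : Fin n → ℤ) : ℂˣ := ∏ i, a i ^ m i

/-- The algebra endomorphism `t^m ↦ a₁^{m₁} ⋯ aₙ^{mₙ} t^m` of `A`. -/
def scale {n : ℕ} (a : Fin n → ℂˣ) : Laurent n →ₐ[ℂ] Laurent n :=
  AddMonoidAlgebra.lift ℂ (Laurent n) (Fin n → ℤ)
    { toFun := fun m => (expo a m.toAdd : ℂ) • mono m.toAdd
      map_one' := by simp [expo, mono, AddMonoidAlgebra.one_def]
      map_mul' := fun x y => by
        simp [expo, mono, zpow_add, Finset.prod_mul_distrib,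
          AddMonoidAlgebra.single_mul_single] }

theorem scale_mono {n : ℕ} (a : Fin n → ℂˣ) (m : Fin n → ℤ) :
    scale a (mono m) = (expo a m : ℂ) • mono m := by
  simp [scale, mono]

theorem scale_comp_inv {n : ℕ} (a b : Fin n → ℂˣ) (h : a * b = 1) :
    (scale a).comp (scale b) = AlgHom.id ℂ (Laurent n) := by
  refine AddMonoidAlgebra.algHom_ext (fun m => ?_) (Subsingleton.elim _ _)
  have h1 : expo b m * expo a m = 1 := by
    unfold expo
    rw [← Finset.prod_mul_distrib]
    refine Finset.prod_eq_one fun i _ => ?_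
    rw [← mul_zpow, mul_comm, show a i * b i = 1 from congrFun h i, one_zpow]
  change scale a (scale b (mono m)) = mono m
  rw [scale_mono, map_smul, scale_mono, smul_smul, ← Units.val_mul, h1]
  simp

section

variable {g : Type*} [LieRing g] [LieAlgebra ℂ g]

/-- The derived algebra `g' = [g, g]`. -/
def derived (g : Type*) [LieRing g] [LieAlgebra ℂ g] : LieIdeal ℂ g := ⁅(⊤ : LieIdeal ℂ g), ⊤⁆

/-- For a subspace `W ⊆ g`, the subspace `W ⊗ A` (written `A ⊗ W`). -/
def loops (n : ℕ) (W : Submodule ℂ g) : Submodule ℂ (Laurent n ⊗[ℂ] g) :=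
  LinearMap.range (LinearMap.lTensor (Laurent n) W.subtype)

/-- For a subspace `W ⊆ g`, the subspace `W ⊗ 1`. -/
def consts (n : ℕ) (W : Submodule ℂ g) : Submodule ℂ (Laurent n ⊗[ℂ] g) :=
  W.map (TensorProduct.mk ℂ (Laurent n) g 1)

theorem tmul_mem_loops {n : ℕ} {W : Submodule ℂ g} (p : Laurent n) {x : g} (hx : x ∈ W) :
    p ⊗ₜ[ℂ] x ∈ loops n W := ⟨p ⊗ₜ ⟨x, hx⟩, by simp⟩

theorem one_tmul_mem_consts {n : ℕ} {W : Submodule ℂ g} {x : g} (hx : x ∈ W) :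
    (1 : Laurent n) ⊗ₜ[ℂ] x ∈ consts n W := ⟨x, hx, rfl⟩

theorem loops_le {n : ℕ} {W : Submodule ℂ g} {P : Submodule ℂ (Laurent n ⊗[ℂ] g)}
    (h : ∀ (p : Laurent n), ∀ x ∈ W, p ⊗ₜ[ℂ] x ∈ P) : loops n W ≤ P := by
  rintro _ ⟨z, rfl⟩
  induction z with
  | zero => simp
  | tmul p x => exact h p x x.2
  | add a b ha hb => rw [map_add]; exact P.add_mem ha hb

theorem loops_mono {n : ℕ} {W W' : Submodule ℂ g} (h : W ≤ W') : loops n W ≤ loops n W' :=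
  loops_le fun p _ hx => tmul_mem_loops p (h hx)

theorem lie_mem_loops {n : ℕ} (x y : Laurent n ⊗[ℂ] g) :
    ⁅x, y⁆ ∈ loops n (derived g).toSubmodule := by
  induction x with
  | zero =>
    rw [show ⁅(0 : Laurent n ⊗[ℂ] g), y⁆ = 0 from zero_lie y]
    exact Submodule.zero_mem _
  | add a b ha hb =>
    rw [show ⁅a + b, y⁆ = ⁅a, y⁆ + ⁅b, y⁆ from LieRing.add_lie a b y]
    exact Submodule.add_mem _ ha hb
  | tmul p u =>
    induction y with
    | zero =>
      rw [show ⁅p ⊗ₜ[ℂ] u, (0 : Laurent n ⊗[ℂ] g)⁆ = 0 from lie_zero (p ⊗ₜ[ℂ] u)]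
      exact Submodule.zero_mem _
    | add a b ha hb =>
      rw [show ⁅p ⊗ₜ[ℂ] u, a + b⁆ = ⁅p ⊗ₜ[ℂ] u, a⁆ + ⁅p ⊗ₜ[ℂ] u, b⁆ from
        LieRing.lie_add (p ⊗ₜ[ℂ] u) a b]
      exact Submodule.add_mem _ ha hb
    | tmul q w =>
      rw [LieAlgebra.ExtendScalars.bracket_tmul]
      exact tmul_mem_loops _ (LieSubmodule.lie_mem_lie (by simp) (by simp))

variable (n : ℕ) (g) in
/-- The loop Kac-Moody algebra `g_A = g' ⊗ A ⊕ 𝔥''`, realized as the subalgebra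
`g' ⊗ A + g ⊗ 1` of `g ⊗ A` with bracket `[X ⊗ p, Y ⊗ q] = [X, Y] ⊗ pq`. (As `g = g' ⊕ 𝔥''` for
any complement `𝔥''` of `𝔥'` in `𝔥`, this is `g' ⊗ A ⊕ 𝔥'' ⊗ 1`.) -/
def loopAlg : LieSubalgebra ℂ (Laurent n ⊗[ℂ] g) where
  toSubmodule := loops n (derived g).toSubmodule ⊔ consts n ⊤
  lie_mem' := fun {x y} _ _ => Submodule.mem_sup_left (lie_mem_loops x y)

variable (g) in
/-- The automorphism `X ⊗ t^m ↦ a₁^{m₁} ⋯ aₙ^{mₙ} X ⊗ t^m` of `g ⊗ A`. -/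
def scaleLie {n : ℕ} (a : Fin n → ℂˣ) : Laurent n ⊗[ℂ] g →ₗ⁅ℂ⁆ Laurent n ⊗[ℂ] g :=
  LieAlgebra.ExtendScalars.map (scale a) (LieHom.id : g →ₗ⁅ℂ⁆ g)

theorem scale_mem_loops {n : ℕ} (a : Fin n → ℂˣ) (W : Submodule ℂ g) {x : Laurent n ⊗[ℂ] g}
    (hx : x ∈ loops n W) :
    scaleLie g a x ∈ loops n W := by
  have : loops n W ≤ (loops n W).comap
      (scaleLie g a :
        Laurent n ⊗[ℂ] g →ₗ[ℂ] Laurent n ⊗[ℂ] g) :=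
    loops_le fun p y hy => by
      change (scale a p) ⊗ₜ[ℂ] y ∈ loops n W
      exact tmul_mem_loops _ hy
  exact this hx

theorem scale_mem_sup {n : ℕ} (a : Fin n → ℂˣ) (W W' : Submodule ℂ g) {x : Laurent n ⊗[ℂ] g}
    (hx : x ∈ loops n W ⊔ consts n W') :
    scaleLie g a x ∈
      loops n W ⊔ consts n W' := by
  obtain ⟨y, hy, _, ⟨z, hz, rfl⟩, rfl⟩ := Submodule.mem_sup.mp hx
  rw [map_add]
  refine Submodule.add_mem_sup (scale_mem_loops a W hy) ?_
  change (scale a 1) ⊗ₜ[ℂ] z ∈ consts n W'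
  rw [map_one]
  exact one_tmul_mem_consts hz

theorem scale_scale {n : ℕ} (a b : Fin n → ℂˣ) (h : a * b = 1) (x : Laurent n ⊗[ℂ] g) :
    scaleLie g a
      (scaleLie g b x) = x := by
  induction x with
  | zero => simp
  | add u v hu hv => rw [map_add, map_add, hu, hv]
  | tmul p y =>
    change (scale a (scale b p)) ⊗ₜ[ℂ] y = _
    exact congrArg (· ⊗ₜ[ℂ] y) (DFunLike.congr_fun (scale_comp_inv a b h) p)

/-- The automorphism `X ⊗ t^m ↦ a₁^{m₁} ⋯ aₙ^{mₙ} X ⊗ t^m` of `g_A`; it is the identity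
on `g = g ⊗ 1`. -/
def twist {n : ℕ} (a : Fin n → ℂˣ) : loopAlg g n ≃ₗ⁅ℂ⁆ loopAlg g n where
  toFun x := ⟨scaleLie g a x,
    scale_mem_sup a _ _ x.2⟩
  map_add' x y := Subtype.ext (by simp)
  map_smul' c x := Subtype.ext (by simp)
  map_lie' {x y} := Subtype.ext (by simp)
  invFun x := ⟨scaleLie g a⁻¹ x,
    scale_mem_sup a⁻¹ _ _ x.2⟩
  left_inv x := Subtype.ext (scale_scale _ _ (by simp) _)
  right_inv x := Subtype.ext (scale_scale _ _ (by simp) _)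

/-- The element `1 ⊗ x` of `g_A`, for `x ∈ g`: the embedding `g ⊆ g_A`. -/
def const (n : ℕ) (x : g) : loopAlg g n :=
  ⟨1 ⊗ₜ x, Submodule.mem_sup_right (one_tmul_mem_consts Submodule.mem_top)⟩

variable {ι : Type*} [Fintype ι] [DecidableEq ι] {C : Matrix ι ι ℤ}

namespace KacMoody

variable (K : KacMoody C g) (n : ℕ)

/-- `𝔥' = 𝔥 ∩ g'`. -/
def cartan' : Submodule ℂ g := K.cartan ⊓ (derived g).toSubmodule

/-- `N⁺`, the subalgebra generated by the `e i`. -/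
def npos : LieSubalgebra ℂ g := LieSubalgebra.lieSpan ℂ g (Set.range K.e)

/-- `𝔥_A = 𝔥' ⊗ A ⊕ 𝔥''`, that is `𝔥' ⊗ A + 𝔥 ⊗ 1`. -/
def loopCartan : Submodule ℂ (Laurent n ⊗[ℂ] g) := loops n K.cartan' ⊔ consts n K.cartan

theorem loopCartan_le : K.loopCartan n ≤ (loopAlg g n).toSubmodule :=
  sup_le_sup (loops_mono inf_le_right) (Submodule.map_mono le_top)

variable {n}

/-- The inclusion `𝔥_A ⊆ g_A`. -/
def inclCartan (x : K.loopCartan n) : loopAlg g n := ⟨x, K.loopCartan_le n x.2⟩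

/-- The element `x ⊗ t^m` of `𝔥_A`, for `x ∈ 𝔥'`. -/
def cartanMono (x : K.cartan') (m : Fin n → ℤ) : K.loopCartan n :=
  ⟨mono m ⊗ₜ (x : g), Submodule.mem_sup_left (tmul_mem_loops _ x.2)⟩

/-- The functional `aΨ` on `𝔥_A`: `(aΨ)(x ⊗ t^m) = a₁^{m₁} ⋯ aₙ^{mₙ} Ψ(x ⊗ t^m)` for `x ∈ 𝔥'`,
and `aΨ = Ψ` on `𝔥 = 𝔥 ⊗ 1`; it is `Ψ` composed with the restriction of `twist a` to `𝔥_A`. -/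
def twistFun (a : Fin n → ℂˣ) (Ψ : Module.Dual ℂ (K.loopCartan n)) :
    Module.Dual ℂ (K.loopCartan n) :=
  Ψ ∘ₗ LinearMap.restrict
    (scaleLie g a :
      Laurent n ⊗[ℂ] g →ₗ[ℂ] Laurent n ⊗[ℂ] g)
    (p := K.loopCartan n) (q := K.loopCartan n) (fun _ hx => scale_mem_sup a _ _ hx)

/-! ### The modules `M(Ψ)` and `V(Ψ)` -/

/-- The left ideal of `U(g_A)` generated by `N⁺ ⊗ A` and the `x - Ψ(x)`, `x ∈ 𝔥_A`. -/
def vermaIdeal (Ψ : Module.Dual ℂ (K.loopCartan n)) :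
    Submodule (UniversalEnvelopingAlgebra ℂ (loopAlg g n))
      (UniversalEnvelopingAlgebra ℂ (loopAlg g n)) :=
  Submodule.span _
    ({u | ∃ x : loopAlg g n, (x : Laurent n ⊗[ℂ] g) ∈ loops n K.npos.toSubmodule ∧
        u = UniversalEnvelopingAlgebra.ι ℂ x} ∪
      {u | ∃ x : K.loopCartan n, u = UniversalEnvelopingAlgebra.ι ℂ (K.inclCartan x) -
        algebraMap ℂ _ (Ψ x)})

/-- The induced module `M(Ψ) = U(g_A) ⊗_{U(N⁺ ⊗ A ⊕ 𝔥_A)} ℂ_Ψ`, as a quotient of `U(g_A)`. -/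
abbrev verma (Ψ : Module.Dual ℂ (K.loopCartan n)) :=
  UniversalEnvelopingAlgebra ℂ (loopAlg g n) ⧸ K.vermaIdeal Ψ

/-- The sum of all proper submodules of `M(Ψ)`, i.e. its unique maximal submodule. -/
def maxSub (Ψ : Module.Dual ℂ (K.loopCartan n)) :
    Submodule (UniversalEnvelopingAlgebra ℂ (loopAlg g n)) (K.verma Ψ) :=
  sSup {N | N ≠ ⊤}

/-- `V(Ψ)`, the irreducible quotient of `M(Ψ)`. -/
abbrev simpleMod (Ψ : Module.Dual ℂ (K.loopCartan n)) := K.verma Ψ ⧸ K.maxSub Ψ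

/-- The action of `g_A` on `V(Ψ)`. -/
def act {Ψ : Module.Dual ℂ (K.loopCartan n)} (x : loopAlg g n) (v : K.simpleMod Ψ) :
    K.simpleMod Ψ :=
  UniversalEnvelopingAlgebra.ι ℂ x • v

/-! ### Characters -/

/-- The weight space `V(Ψ)_μ = {v | x v = μ(x) v for all x ∈ 𝔥}`, `μ ∈ 𝔥^*`. -/
def weightSpace (Ψ : Module.Dual ℂ (K.loopCartan n)) (μ : Module.Dual ℂ K.cartan) :
    Submodule ℂ (K.simpleMod Ψ) where
  carrier := {v | ∀ x : K.cartan, K.act (const n (x : g)) v = μ x • v}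
  zero_mem' := fun x => by simp [act]
  add_mem' := fun {v w} hv hw x => by
    rw [smul_add, ← hv x, ← hw x]; exact smul_add _ _ _
  smul_mem' := fun c v hv x => by
    rw [smul_comm, ← hv x]
    exact smul_comm _ _ _

/-- `V(Ψ)` has a character: it is the sum of its weight spaces, and these are
finite-dimensional. -/
def HasCharacter (Ψ : Module.Dual ℂ (K.loopCartan n)) : Prop :=
  (⨆ μ, K.weightSpace Ψ μ) = ⊤ ∧ ∀ μ, FiniteDimensional ℂ (K.weightSpace Ψ μ)

/-- The character `ch V(Ψ) = ∑_μ dim V(Ψ)_μ e^μ`, as the function `μ ↦ dim V(Ψ)_μ` on `𝔥^*`. -/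
def char (Ψ : Module.Dual ℂ (K.loopCartan n)) (μ : Module.Dual ℂ K.cartan) : ℕ :=
  Module.finrank ℂ (K.weightSpace Ψ μ)

/-! ### Exp-polynomial functionals -/

/-- The algebra `A_ψ`: the image of the homomorphism `U(𝔥' ⊗ A) → A` which extends
`x ⊗ t^m ↦ ψ(x ⊗ t^m) t^m`. -/
def imageAlg (ψ : Module.Dual ℂ (K.loopCartan n)) : Subalgebra ℂ (Laurent n) :=
  Algebra.adjoin ℂ {p | ∃ (x : K.cartan') (m : Fin n → ℤ), p = ψ (K.cartanMono x m) • mono m}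

end KacMoody

end

/-- The subalgebra `ℂ[t₁^{±r₁}, …, tₙ^{±rₙ}]` of `A`. -/
def subLaurent {n : ℕ} (r : Fin n → ℕ) : Subalgebra ℂ (Laurent n) :=
  Algebra.adjoin ℂ {p | ∃ m : Fin n → ℤ, (∀ i, (r i : ℤ) ∣ m i) ∧ p = mono m}

/-- `f` is an exp-polynomial map with exponents in `B ⊆ (ℂ^*)ⁿ`: a finite sum
`f(m) = ∑_{λ ∈ B} p_λ(m) λ₁^{m₁} ⋯ λₙ^{mₙ}` with polynomials `p_λ`. -/
def IsExpPolyOn {n : ℕ} (B : Set (Fin n → ℂˣ)) (f : (Fin n → ℤ) → ℂ) : Prop :=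
  ∃ p : (Fin n → ℂˣ) →₀ MvPolynomial (Fin n) ℂ, (p.support : Set (Fin n → ℂˣ)) ⊆ B ∧
    ∀ m, f m = p.sum fun a q => MvPolynomial.eval (fun i => (m i : ℂ)) q * (expo a m : ℂ)

/-- The tuple `ξ^k = (ξ₁^{k₁}, …, ξₙ^{kₙ})`, where `k ∈ ℤ/r₁ ⊕ ⋯ ⊕ ℤ/rₙ`. -/
def rootTuple {n : ℕ} {r : Fin n → ℕ} (ξ : Fin n → ℂˣ) (k : (i : Fin n) → Fin (r i)) :
    Fin n → ℂˣ :=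
  fun i => ξ i ^ (k i : ℕ)

/-- `B` contains exactly one element of each orbit `{ξ^k · a | k}` of
`ℤ/r₁ ⊕ ⋯ ⊕ ℤ/rₙ` on `(ℂ^*)ⁿ`. -/
def IsTransversal {n : ℕ} (r : Fin n → ℕ) (ξ : Fin n → ℂˣ) (B : Set (Fin n → ℂˣ)) : Prop :=
  ∀ a : Fin n → ℂˣ, ∃! b, b ∈ B ∧ ∃ k : (i : Fin n) → Fin (r i), a = rootTuple ξ k * b

/-- `ψ = ∑_k ξ^k Φ`, where every `Φ_x`, `x ∈ 𝔥'`, is an exp-polynomial map with exponents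
in `B`. -/
def IsDecomposition {ι g : Type*} [Fintype ι] [DecidableEq ι] {C : Matrix ι ι ℤ}
    [LieRing g] [LieAlgebra ℂ g] (K : KacMoody C g) {n : ℕ} (r : Fin n → ℕ) (ξ : Fin n → ℂˣ)
    (B : Set (Fin n → ℂˣ)) (ψ Φ : Module.Dual ℂ (K.loopCartan n)) : Prop :=
  (∀ x : K.cartan', IsExpPolyOn B fun m => Φ (K.cartanMono x m)) ∧
    ψ = ∑ k : (i : Fin n) → Fin (r i), K.twistFun (rootTuple ξ k) Φ

/-- The terms of the `R`-th power of the formal sum `∑_μ χ(μ) e^μ` that contribute to `e^μ`: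
the tuples `(ν₁, …, ν_R)` with sum `μ` and nonzero coefficient `χ(ν₁) ⋯ χ(ν_R)`. -/
def powTerms {W : Type*} [AddCommMonoid W] (χ : W → ℕ) (R : ℕ) (μ : W) : Set (Fin R → W) :=
  {ν | ∑ i, ν i = μ ∧ ∏ i, χ (ν i) ≠ 0}

/-- The coefficient of `e^μ` in the `R`-th power of the formal sum `∑_μ χ(μ) e^μ`; it is
meaningful when `powTerms χ R μ` is finite. -/
def formalPow {W : Type*} [AddCommMonoid W] (χ : W → ℕ) (R : ℕ) (μ : W) : ℕ :=
  ∑ᶠ ν ∈ powTerms χ R μ, ∏ i, χ (ν i)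

end LoopKM

end

/-!
The proof rests on the isomorphism `V(Ψ₁ + Ψ₂) ≅ V(Ψ₁) ⊗ V(Ψ₂)`, which holds whenever the two
functionals vanish on comaximal ideals of `A`. If `Jᵢ` is the largest ideal with `Ψᵢ(𝔥' ⊗ Jᵢ) = 0`,
then `𝔤' ⊗ Jᵢ` acts by zero on `V(Ψᵢ)`, so for `J₁ + J₂ = A` the two tensor factors can be acted on
independently; hence the tensor product is irreducible, and it is generated by the tensor product
of the two highest weight vectors. The module `V(Ψ)` is characterized as the irreducible highest
weight module, once `M(Ψ) ≠ 0` is known; for this the induced action of `𝔤_A` on `U(N⁻ ⊗ A)` is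
written down explicitly, which avoids the Poincaré-Birkhoff-Witt theorem.

If `Ψ` is exp-polynomial with exponents in `B`, then the ideal `J` contains a product of powers of
the maximal ideals of points of `B`. So `A / J` is finite-dimensional, which makes the weight spaces
of `V(Ψ)` finite-dimensional, and disjoint exponent sets give comaximal ideals. The exponents of the
functionals `ξ^k Φ` lie in the disjoint translates `k · B`, so `V(ψ)` is the tensor product of the
`V(ξ^k Φ)`. Twisting by `σ_k` preserves the character, and therefore `ch V(ψ)` is the `R`-th power
of `ch V(Φ)`. To find `Φ`, move every exponent of `ψ` to its representative in `B` and divide by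
`R`; summing over `k` gives back `ψ` because `ψ(h ⊗ t^m) = 0` unless `rᵢ ∣ mᵢ` for all `i`.
-/

noncomputable section

attribute [local instance 100] LieRing.ofAssociativeRing

namespace LoopKM

/-! ### Lie subalgebras and enveloping algebras -/

section Lie

variable {R L : Type*} [CommRing R] [LieRing L] [LieAlgebra R L]

section Transporter

variable {M : Type*} [AddCommGroup M] [Module R M] [LieRingModule L M] [LieModule R L M]

theorem lie_mem_of_mem_iSup {J : Sort*} {U : J → Submodule R M} {W : Submodule R M}
    {x : L} (h : ∀ j, ∀ w ∈ U j, ⁅x, w⁆ ∈ W) {w : M} (hw : w ∈ ⨆ j, U j) :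
    ⁅x, w⁆ ∈ W :=
  (iSup_le h : ⨆ j, U j ≤ W.comap (LieModule.toEnd R L M x)) hw

theorem lie_mem_of_mem_span {s : Set M} {W : Submodule R M} {x : L} (h : ∀ w ∈ s, ⁅x, w⁆ ∈ W)
    {w : M} (hw : w ∈ Submodule.span R s) : ⁅x, w⁆ ∈ W :=
  (Submodule.span_le.mpr h : Submodule.span R s ≤ W.comap (LieModule.toEnd R L M x)) hw

/-- For subspaces `W' ≤ W` of a Lie module, the subalgebra of all `x` with `⁅x, W⁆ ⊆ W'`. For
`W' = W` it is the stabilizer of `W`, for `W' = ⊥` the annihilator. -/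
def lieTransporter {W' W : Submodule R M} (hW : W' ≤ W) : LieSubalgebra R L where
  carrier := {x | ∀ w ∈ W, ⁅x, w⁆ ∈ W'}
  add_mem' hx hy w hw := by rw [add_lie]; exact add_mem (hx w hw) (hy w hw)
  zero_mem' w _ := by rw [zero_lie]; exact zero_mem _
  smul_mem' c x hx w hw := by rw [smul_lie]; exact W'.smul_mem c (hx w hw)
  lie_mem' hx hy w hw := by
    rw [lie_lie]; exact sub_mem (hx _ (hW (hy w hw))) (hy _ (hW (hx w hw)))

end Transporter

theorem lieSpan_le_of_lie_mem {s : Set L} {W : Submodule R L} (h1 : s ⊆ W)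
    (h2 : ∀ x ∈ s, ∀ w ∈ W, ⁅x, w⁆ ∈ W) : (LieSubalgebra.lieSpan R L s).toSubmodule ≤ W := by
  intro x hx
  induction hx using LieSubalgebra.lieSpan_induction with
  | mem y hy => exact h1 hy
  | zero => exact zero_mem _
  | add y z _ _ hy hz => exact add_mem hy hz
  | smul a y _ hy => exact W.smul_mem a hy
  | lie y z hy _ _ hz => exact LieSubalgebra.lieSpan_le (K := lieTransporter le_rfl).mpr h2 hy z hz

theorem lie_mem_lieSpan_of_forall_mem {s : Set L} {x : L}
    (h : ∀ y ∈ s, ⁅x, y⁆ ∈ LieSubalgebra.lieSpan R L s) {y : L}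
    (hy : y ∈ LieSubalgebra.lieSpan R L s) : ⁅x, y⁆ ∈ LieSubalgebra.lieSpan R L s := by
  induction hy using LieSubalgebra.lieSpan_induction with
  | mem y hy => exact h y hy
  | zero => rw [lie_zero]; exact zero_mem _
  | add y z _ _ hy hz => rw [lie_add]; exact add_mem hy hz
  | smul a y _ hy => rw [lie_smul]; exact LieSubalgebra.smul_mem _ a hy
  | lie y z hy hz hxy hxz =>
    rw [leibniz_lie]
    exact add_mem (LieSubalgebra.lie_mem _ hxy hz) (LieSubalgebra.lie_mem _ hy hxz)

theorem lie_mem_sup_of_mem_lieSpan {s : Set L} {x : L} {W : Submodule R L}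
    (hW : ∀ w ∈ W, ∀ y ∈ LieSubalgebra.lieSpan R L s, ⁅w, y⁆ ∈ LieSubalgebra.lieSpan R L s)
    (h : ∀ y ∈ s, ⁅x, y⁆ ∈ (LieSubalgebra.lieSpan R L s).toSubmodule ⊔ W) {y : L}
    (hy : y ∈ LieSubalgebra.lieSpan R L s) :
    ⁅x, y⁆ ∈ (LieSubalgebra.lieSpan R L s).toSubmodule ⊔ W := by
  have sup_lie : ∀ z ∈ (LieSubalgebra.lieSpan R L s).toSubmodule ⊔ W,
      ∀ y ∈ LieSubalgebra.lieSpan R L s, ⁅z, y⁆ ∈ LieSubalgebra.lieSpan R L s := by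
    intro z hz y hy
    obtain ⟨a, ha, b, hb, rfl⟩ := Submodule.mem_sup.mp hz
    rw [add_lie]
    exact add_mem (LieSubalgebra.lie_mem _ ha hy) (hW b hb y hy)
  induction hy using LieSubalgebra.lieSpan_induction with
  | mem y hy => exact h y hy
  | zero => rw [lie_zero]; exact zero_mem _
  | add y z _ _ hy hz => rw [lie_add]; exact add_mem hy hz
  | smul a y _ hy => rw [lie_smul]; exact Submodule.smul_mem _ a hy
  | lie y z hy hz hxy hxz =>
    rw [leibniz_lie, ← lie_skew y]
    exact Submodule.mem_sup_left (add_mem (sup_lie _ hxy _ hz) (neg_mem (sup_lie _ hxz _ hy)))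

theorem enveloping_induction {P : UniversalEnvelopingAlgebra R L → Prop}
    (add : ∀ u v, P u → P v → P (u + v)) (smul : ∀ (c : R) u, P u → P (c • u)) (one : P 1)
    (mul : ∀ (x : L) u, P u → P (UniversalEnvelopingAlgebra.ι R x * u))
    (u : UniversalEnvelopingAlgebra R L) : P u := by
  let S : Submodule R (UniversalEnvelopingAlgebra R L) :=
    { carrier := {u | P u}
      add_mem' := fun {u v} => add u v
      zero_mem' := by simpa using smul 0 1 one
      smul_mem' := smul }
  let T : Subalgebra R (UniversalEnvelopingAlgebra R L) :=
    { carrier := {u | ∀ s ∈ S, u * s ∈ S}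
      mul_mem' := fun {a b} ha hb s hs => by rw [mul_assoc]; exact ha _ (hb _ hs)
      add_mem' := fun {a b} ha hb s hs => by rw [add_mul]; exact S.add_mem (ha _ hs) (hb _ hs)
      algebraMap_mem' := fun c s hs => by rw [← Algebra.smul_def]; exact S.smul_mem c hs }
  let f : L →ₗ⁅R⁆ T :=
    { toFun := fun x => ⟨UniversalEnvelopingAlgebra.ι R x, mul x⟩
      map_add' := fun x y => Subtype.ext (by simp)
      map_smul' := fun c x => Subtype.ext (by simp)
      map_lie' := fun {x y} => Subtype.ext (by
        simp [LieRing.of_associative_ring_bracket, LieHom.map_lie]) }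
  have lift_eq_id : T.val.comp (UniversalEnvelopingAlgebra.lift R f) = AlgHom.id R _ := by
    refine UniversalEnvelopingAlgebra.hom_ext R (LieHom.ext fun x => ?_)
    change (UniversalEnvelopingAlgebra.lift R f (UniversalEnvelopingAlgebra.ι R x)).1 = _
    rw [UniversalEnvelopingAlgebra.lift_ι_apply]
    rfl
  have mem_T : u ∈ T := by
    rw [← show (UniversalEnvelopingAlgebra.lift R f u).1 = u from DFunLike.congr_fun lift_eq_id u]
    exact (UniversalEnvelopingAlgebra.lift R f u).2
  exact (mul_one u ▸ mem_T 1 one : u ∈ S)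

section EnvelopingModule

variable (R L) (M : Type*) [AddCommGroup M] [Module R M]
  [Module (UniversalEnvelopingAlgebra R L) M] [IsScalarTower R (UniversalEnvelopingAlgebra R L) M]

/-- A module over the enveloping algebra `U(L)`, regarded as a representation of `L`. -/
abbrev envLieRingModule : LieRingModule L M :=
  letI : LieRingModule (UniversalEnvelopingAlgebra R L) M := LieRingModule.ofAssociativeModule
  LieRingModule.compLieHom M (UniversalEnvelopingAlgebra.ι R)

theorem envLieModule : letI := envLieRingModule R L M; LieModule R L M :=
  letI : LieRingModule (UniversalEnvelopingAlgebra R L) M := LieRingModule.ofAssociativeModule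
  haveI : LieModule R (UniversalEnvelopingAlgebra R L) M := LieModule.ofAssociativeModule
  LieModule.compLieHom M (UniversalEnvelopingAlgebra.ι R)

variable {R L M} in
theorem env_smul_mem {W : Submodule R M}
    (h : ∀ x : L, ∀ w ∈ W, UniversalEnvelopingAlgebra.ι R x • w ∈ W)
    (u : UniversalEnvelopingAlgebra R L) {w : M} (hw : w ∈ W) : u • w ∈ W := by
  revert w
  refine enveloping_induction (P := fun u => ∀ {w}, w ∈ W → u • w ∈ W) ?_ ?_ ?_ ?_ u
  · intro u v hu hv w hw
    rw [add_smul]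
    exact add_mem (hu hw) (hv hw)
  · intro c u hu w hw
    rw [smul_assoc]
    exact W.smul_mem c (hu hw)
  · intro w hw
    rwa [one_smul]
  · intro x u hu w hw
    rw [mul_smul]
    exact h x _ (hu hw)

end EnvelopingModule

end Lie

/-! ### Induced modules -/

section Induced

variable {R L : Type*} [CommRing R] [LieRing L] [LieAlgebra R L] {a b : LieSubalgebra R L}
  (hab : IsCompl a.toSubmodule b.toSubmodule) (χ : L →ₗ[R] R)

local instance : LieRingModule a (UniversalEnvelopingAlgebra R a) := envLieRingModule R _ _

local instance : LieModule R a (UniversalEnvelopingAlgebra R a) := envLieModule R _ _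

/-- For `L = a ⊕ b`, the map `L → U(a)` which is the inclusion on `a` and the functional `χ`
on `b`. -/
def inducedGen : L →ₗ[R] UniversalEnvelopingAlgebra R a :=
  (UniversalEnvelopingAlgebra.ι R : a →ₗ⁅R⁆ UniversalEnvelopingAlgebra R a).toLinearMap ∘ₗ
      Submodule.projectionOnto _ _ hab +
    Algebra.linearMap R _ ∘ₗ χ ∘ₗ b.toSubmodule.subtype ∘ₗ Submodule.projectionOnto _ _ hab.symm

theorem inducedGen_left (y : a) : inducedGen hab χ y = UniversalEnvelopingAlgebra.ι R y := by
  simp only [inducedGen, LinearMap.add_apply, LinearMap.comp_apply, LieHom.coe_toLinearMap,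
    show a.projectionOnto b.toSubmodule hab y = y from Submodule.projectionOnto_apply_left hab y,
    show b.projectionOnto a.toSubmodule hab.symm y = 0 from
      Submodule.projectionOnto_apply_right hab.symm y, map_zero, add_zero]

theorem inducedGen_right (x : b) : inducedGen hab χ x = algebraMap R _ (χ x) := by
  simp only [inducedGen, LinearMap.add_apply, LinearMap.comp_apply,
    show a.projectionOnto b.toSubmodule hab x = 0 from Submodule.projectionOnto_apply_right hab x,
    show b.projectionOnto a.toSubmodule hab.symm x = x from
      Submodule.projectionOnto_apply_left hab.symm x, map_zero, zero_add,
    Algebra.linearMap_apply, Submodule.subtype_apply]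

/-- For `L = a ⊕ b` and a character `χ` of `b`, the action of `L` on the module induced from
`χ`, which is identified with `U(a)`. As `x y w = y x w + [x, y] w` for `y ∈ a`, the map
`x ↦ x w` in `Hom(L, U(a))` depends on `w` through the action of `U(a)` on this space. -/
def inducedEnd : L →ₗ[R] Module.End R (UniversalEnvelopingAlgebra R a) :=
  (LinearMap.applyₗ (inducedGen hab χ) ∘ₗ
    (UniversalEnvelopingAlgebra.lift R
      (LieModule.toEnd R a (L →ₗ[R] UniversalEnvelopingAlgebra R a))).toLinearMap).flip

theorem inducedEnd_one (x : L) : inducedEnd hab χ x 1 = inducedGen hab χ x := by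
  simp [inducedEnd]

theorem inducedEnd_one_of_mem {x : L} (hx : x ∈ b) :
    inducedEnd hab χ x 1 = algebraMap R _ (χ x) := by
  rw [inducedEnd_one, inducedGen_right hab χ ⟨x, hx⟩]

theorem inducedEnd_ι_mul (x : L) (y : a) (w : UniversalEnvelopingAlgebra R a) :
    inducedEnd hab χ x (UniversalEnvelopingAlgebra.ι R y * w) =
      UniversalEnvelopingAlgebra.ι R y * inducedEnd hab χ x w +
        inducedEnd hab χ ⁅x, (y : L)⁆ w := by
  rw [← lie_skew x, map_neg, LinearMap.neg_apply, ← sub_eq_add_neg]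
  simp only [inducedEnd, LinearMap.flip_apply, LinearMap.comp_apply, AlgHom.toLinearMap_apply,
    map_mul, UniversalEnvelopingAlgebra.lift_ι_apply]
  rfl

theorem inducedEnd_of_mem (y : a) (w : UniversalEnvelopingAlgebra R a) :
    inducedEnd hab χ y w = UniversalEnvelopingAlgebra.ι R y * w := by
  revert y
  refine enveloping_induction (P := fun w => ∀ y : a,
    inducedEnd hab χ y w = UniversalEnvelopingAlgebra.ι R y * w) ?_ ?_ ?_ ?_ w
  · intro w w' h h' y
    rw [map_add, h, h', mul_add]
  · intro c w h y
    rw [map_smul, h, mul_smul_comm]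
  · intro y
    rw [inducedEnd_one, inducedGen_left, mul_one]
  · intro z w h y
    rw [inducedEnd_ι_mul, h, ← LieSubalgebra.coe_bracket, h, LieHom.map_lie,
      LieRing.of_associative_ring_bracket, sub_mul, mul_assoc, mul_assoc]
    abel

theorem inducedEnd_lie_of_mem (w : UniversalEnvelopingAlgebra R a)
    (h : ∀ x ∈ b, ∀ z ∈ b, inducedEnd hab χ ⁅x, z⁆ w =
      inducedEnd hab χ x (inducedEnd hab χ z w) - inducedEnd hab χ z (inducedEnd hab χ x w))
    (x z : L) : inducedEnd hab χ ⁅x, z⁆ w =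
      inducedEnd hab χ x (inducedEnd hab χ z w) - inducedEnd hab χ z (inducedEnd hab χ x w) := by
  have lie_right : ∀ x, ∀ z ∈ a, inducedEnd hab χ ⁅x, z⁆ w =
      inducedEnd hab χ x (inducedEnd hab χ z w) - inducedEnd hab χ z (inducedEnd hab χ x w) := by
    intro x z hz
    lift z to a using hz
    rw [inducedEnd_of_mem, inducedEnd_of_mem, inducedEnd_ι_mul]
    abel
  have lie_left : ∀ x ∈ a, ∀ z, inducedEnd hab χ ⁅x, z⁆ w =
      inducedEnd hab χ x (inducedEnd hab χ z w) - inducedEnd hab χ z (inducedEnd hab χ x w) := by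
    intro x hx z
    rw [← lie_skew, map_neg, LinearMap.neg_apply, lie_right z x hx]
    abel
  obtain ⟨x₁, hx₁, x₂, hx₂, rfl⟩ := Submodule.mem_sup.mp
    (hab.sup_eq_top ▸ Submodule.mem_top : x ∈ a.toSubmodule ⊔ b.toSubmodule)
  obtain ⟨z₁, hz₁, z₂, hz₂, rfl⟩ := Submodule.mem_sup.mp
    (hab.sup_eq_top ▸ Submodule.mem_top : z ∈ a.toSubmodule ⊔ b.toSubmodule)
  simp only [lie_add, add_lie, map_add, LinearMap.add_apply, lie_left x₁ hx₁, lie_right x₂ z₁ hz₁,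
    h x₂ hx₂ z₂ hz₂]
  abel

theorem inducedEnd_lie (hχ : ∀ x ∈ b, ∀ z ∈ b, χ ⁅x, z⁆ = 0) (w : UniversalEnvelopingAlgebra R a) :
    ∀ x z : L, inducedEnd hab χ ⁅x, z⁆ w =
      inducedEnd hab χ x (inducedEnd hab χ z w) - inducedEnd hab χ z (inducedEnd hab χ x w) := by
  refine enveloping_induction (P := fun w => ∀ x z : L, inducedEnd hab χ ⁅x, z⁆ w =
    inducedEnd hab χ x (inducedEnd hab χ z w) - inducedEnd hab χ z (inducedEnd hab χ x w))
    ?_ ?_ ?_ ?_ w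
  · intro w w' h h' x z
    simp only [map_add, h, h']
    abel
  · intro c w h x z
    simp only [map_smul, h, smul_sub]
  · refine inducedEnd_lie_of_mem hab χ 1 fun x hx z hz => ?_
    simp only [inducedEnd_one_of_mem hab χ (b.lie_mem hx hz), hχ x hx z hz,
      inducedEnd_one_of_mem hab χ hx, inducedEnd_one_of_mem hab χ hz,
      Algebra.algebraMap_eq_smul_one, map_smul, zero_smul, smul_smul, mul_comm (χ x), sub_self]
  · intro y w h x z
    rw [inducedEnd_ι_mul, inducedEnd_ι_mul, inducedEnd_ι_mul, map_add, map_add, inducedEnd_ι_mul,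
      inducedEnd_ι_mul, lie_lie, map_sub, LinearMap.sub_apply, h x ⁅z, (y : L)⁆,
      h z ⁅x, (y : L)⁆, h x z, mul_sub]
    abel

/-- The representation of `L = a ⊕ b` induced from the character `χ` of `b`, on the space
`U(a)`. -/
def inducedRep (hχ : ∀ x ∈ b, ∀ z ∈ b, χ ⁅x, z⁆ = 0) :
    L →ₗ⁅R⁆ Module.End R (UniversalEnvelopingAlgebra R a) :=
  { inducedEnd hab χ with
    map_lie' := fun {x z} => LinearMap.ext fun w => inducedEnd_lie hab χ hχ w x z }

theorem inducedRep_one (hχ : ∀ x ∈ b, ∀ z ∈ b, χ ⁅x, z⁆ = 0) {x : L} (hx : x ∈ b) :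
    inducedRep hab χ hχ x 1 = algebraMap R _ (χ x) :=
  inducedEnd_one_of_mem hab χ hx

end Induced

/-! ### The triangular decomposition of a Kac-Moody algebra -/

section Grading

variable {k L : Type*} [Field k] [LieRing L] [LieAlgebra k L]

/-- The sum of the eigenspaces of `ad d` with eigenvalues in `S`. -/
def adPart (d : L) (S : Set k) : Submodule k L :=
  ⨆ c ∈ S, (LieModule.toEnd k L L d).eigenspace c

theorem mem_adPart {d x : L} {S : Set k} {c : k} (hc : c ∈ S) (h : ⁅d, x⁆ = c • x) :
    x ∈ adPart d S :=
  Submodule.mem_iSup_of_mem c (Submodule.mem_iSup_of_mem hc (Module.End.mem_eigenspace_iff.mpr h))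

theorem adPart_mono (d : L) {S T : Set k} (h : S ⊆ T) : adPart d S ≤ adPart d T :=
  biSup_mono fun _ hc => h hc

theorem adPart_disjoint (d : L) {S T : Set k} (h : Disjoint S T) :
    Disjoint (adPart d S) (adPart d T) :=
  (Module.End.eigenspaces_iSupIndep (LieModule.toEnd k L L d)).disjoint_biSup_biSup h

theorem lie_mem_adPart {d x y : L} {S : Set k} (hS : ∀ a ∈ S, ∀ b ∈ S, a + b ∈ S)
    (hx : x ∈ adPart d S) (hy : y ∈ adPart d S) : ⁅x, y⁆ ∈ adPart d S := by
  rw [adPart, iSup_subtype'] at hx hy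
  induction hx using Submodule.iSup_induction' with
  | zero => rw [zero_lie]; exact zero_mem _
  | add x x' _ _ h h' => rw [add_lie]; exact add_mem h h'
  | mem a x hx =>
    induction hy using Submodule.iSup_induction' with
    | zero => rw [lie_zero]; exact zero_mem _
    | add y y' _ _ h h' => rw [lie_add]; exact add_mem h h'
    | mem b y hy =>
      rw [Module.End.mem_eigenspace_iff, LieModule.toEnd_apply_apply] at hx hy
      refine mem_adPart (hS a a.2 b b.2) ?_
      rw [leibniz_lie, hx, hy, smul_lie, lie_smul, add_smul]

theorem lieSpan_le_adPart {d : L} {S : Set k} (hS : ∀ a ∈ S, ∀ b ∈ S, a + b ∈ S) {s : Set L}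
    (h : s ⊆ adPart d S) : (LieSubalgebra.lieSpan k L s).toSubmodule ≤ adPart d S :=
  (LieSubalgebra.lieSpan_le
    (K := { adPart d S with lie_mem' := fun hx hy => lie_mem_adPart hS hx hy })).mpr h

end Grading

namespace KacMoody

variable {ι g : Type*} [Fintype ι] [DecidableEq ι] {C : Matrix ι ι ℤ} [LieRing g] [LieAlgebra ℂ g]
  (K : KacMoody C g)

/-- The same Lie algebra with the roles of the `e i` and the `f i` interchanged. It is used to
transfer facts about `N⁺` to `N⁻`. -/
def opposite : KacMoody C g where
  cartan := K.cartan
  root := -K.root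
  coroot := -K.coroot
  e := K.f
  f := K.e
  finite_cartan := K.finite_cartan
  finrank_cartan := K.finrank_cartan
  root_indep := K.root_indep.neg
  coroot_indep := K.coroot_indep.neg
  root_coroot i j := by simp [K.root_coroot]
  lie_cartan := K.lie_cartan
  lie_e_f i j := by
    rw [← lie_skew, K.lie_e_f]
    by_cases h : i = j <;> simp [h, eq_comm]
  lie_cartan_e x i := by simp [K.lie_cartan_f]
  lie_cartan_f x i := by simp [K.lie_cartan_e]
  generate := by rw [Set.union_right_comm, K.generate]
  no_ideal := K.no_ideal

/-- `N⁻`, the subalgebra generated by the `f i`. -/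
def nneg : LieSubalgebra ℂ g := LieSubalgebra.lieSpan ℂ g (Set.range K.f)

theorem exists_grading : ∃ d : K.cartan, ∀ i, K.root i d = 1 := by
  have := K.finite_cartan
  let b := Module.Basis.span K.root_indep
  obtain ⟨l, hl⟩ := LinearMap.exists_extend (b.constr ℂ (fun _ : ι => (1 : ℂ)))
  refine ⟨(Module.evalEquiv ℂ K.cartan).symm l, fun i => ?_⟩
  rw [Module.apply_evalEquiv_symm_apply,
    ← show (b i : Module.Dual ℂ K.cartan) = K.root i from
      congrArg Subtype.val (Module.Basis.span_apply K.root_indep i)]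
  exact (LinearMap.congr_fun hl (b i)).trans (b.constr_basis ℂ _ i)

theorem e_mem_npos (i : ι) : K.e i ∈ K.npos := LieSubalgebra.subset_lieSpan ⟨i, rfl⟩

theorem f_mem_nneg (i : ι) : K.f i ∈ K.nneg := LieSubalgebra.subset_lieSpan ⟨i, rfl⟩

theorem lie_mem_derived (x y : g) : ⁅x, y⁆ ∈ derived g :=
  LieSubmodule.lie_mem_lie (by simp) (by simp)

theorem e_mem_derived (i : ι) : K.e i ∈ derived g := by
  obtain ⟨d, hd⟩ := K.exists_grading
  rw [← one_smul ℂ (K.e i), ← hd i, ← K.lie_cartan_e d i]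
  exact lie_mem_derived _ _

theorem f_mem_derived (i : ι) : K.f i ∈ derived g := K.opposite.e_mem_derived i

theorem coroot_mem_derived (i : ι) : (K.coroot i : g) ∈ derived g := by
  have lie_e_f := K.lie_e_f i i
  rw [if_pos rfl] at lie_e_f
  exact lie_e_f ▸ lie_mem_derived _ _

theorem npos_le_derived : K.npos.toSubmodule ≤ (derived g).toSubmodule :=
  (LieSubalgebra.lieSpan_le (K := (derived g).toLieSubalgebra ℂ g)).mpr
    (Set.range_subset_iff.mpr K.e_mem_derived)

theorem nneg_le_derived : K.nneg.toSubmodule ≤ (derived g).toSubmodule :=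
  K.opposite.npos_le_derived

theorem lie_cartan_npos {x y : g} (hx : x ∈ K.cartan) (hy : y ∈ K.npos) : ⁅x, y⁆ ∈ K.npos := by
  refine lie_mem_lieSpan_of_forall_mem (Set.forall_mem_range.mpr fun i => ?_) hy
  rw [K.lie_cartan_e ⟨x, hx⟩ i]
  exact LieSubalgebra.smul_mem _ _ (K.e_mem_npos i)

theorem lie_cartan_nneg {x y : g} (hx : x ∈ K.cartan) (hy : y ∈ K.nneg) : ⁅x, y⁆ ∈ K.nneg :=
  K.opposite.lie_cartan_npos hx hy

theorem lie_cartan_sup_npos {x y : g} (hx : x ∈ K.cartan ⊔ K.npos.toSubmodule)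
    (hy : y ∈ K.cartan ⊔ K.npos.toSubmodule) : ⁅x, y⁆ ∈ K.npos := by
  obtain ⟨h, hh, b, hb, rfl⟩ := Submodule.mem_sup.mp hx
  obtain ⟨h', hh', b', hb', rfl⟩ := Submodule.mem_sup.mp hy
  rw [lie_add, add_lie, add_lie, K.lie_cartan ⟨h, hh⟩ ⟨h', hh'⟩, zero_add, ← lie_skew b h']
  exact add_mem (neg_mem (K.lie_cartan_npos hh' hb))
    (add_mem (K.lie_cartan_npos hh hb') (K.npos.lie_mem hb hb'))

/-- The Borel subalgebra `𝔥 ⊕ N⁺`. -/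
def borel : LieSubalgebra ℂ g where
  toSubmodule := K.cartan ⊔ K.npos.toSubmodule
  lie_mem' hx hy := Submodule.mem_sup_right (K.lie_cartan_sup_npos hx hy)

theorem lie_e_nneg (i : ι) {y : g} (hy : y ∈ K.nneg) :
    ⁅K.e i, y⁆ ∈ K.nneg.toSubmodule ⊔ K.cartan := by
  refine lie_mem_sup_of_mem_lieSpan (fun w hw y hy => K.lie_cartan_nneg hw hy)
    (Set.forall_mem_range.mpr fun j => ?_) hy
  rw [K.lie_e_f]
  split_ifs
  exacts [Submodule.mem_sup_right (K.coroot i).2, zero_mem _]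

theorem lie_e_mem_triangular (i : ι) {w : g}
    (hw : w ∈ K.nneg.toSubmodule ⊔ K.cartan ⊔ K.npos.toSubmodule) :
    ⁅K.e i, w⁆ ∈ K.nneg.toSubmodule ⊔ K.cartan ⊔ K.npos.toSubmodule := by
  obtain ⟨w', hw', c, hc, rfl⟩ := Submodule.mem_sup.mp hw
  obtain ⟨a, ha, h, hh, rfl⟩ := Submodule.mem_sup.mp hw'
  rw [lie_add, lie_add, ← lie_skew _ h, K.lie_cartan_e ⟨h, hh⟩]
  exact add_mem (add_mem (Submodule.mem_sup_left (K.lie_e_nneg i ha))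
    (Submodule.mem_sup_right (neg_mem (Submodule.smul_mem _ _ (K.e_mem_npos i)))))
    (Submodule.mem_sup_right (LieSubalgebra.lie_mem _ (K.e_mem_npos i) hc))

theorem lie_cartan_mem_triangular {x w : g} (hx : x ∈ K.cartan)
    (hw : w ∈ K.nneg.toSubmodule ⊔ K.cartan ⊔ K.npos.toSubmodule) :
    ⁅x, w⁆ ∈ K.nneg.toSubmodule ⊔ K.cartan ⊔ K.npos.toSubmodule := by
  obtain ⟨w', hw', c, hc, rfl⟩ := Submodule.mem_sup.mp hw
  obtain ⟨a, ha, h, hh, rfl⟩ := Submodule.mem_sup.mp hw'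
  rw [lie_add, lie_add, K.lie_cartan ⟨x, hx⟩ ⟨h, hh⟩, add_zero]
  exact Submodule.add_mem_sup (Submodule.mem_sup_left (K.lie_cartan_nneg hx ha))
    (K.lie_cartan_npos hx hc)

theorem triangular : K.nneg.toSubmodule ⊔ K.cartan ⊔ K.npos.toSubmodule = ⊤ := by
  have opposite_eq : K.opposite.nneg.toSubmodule ⊔ K.opposite.cartan ⊔ K.opposite.npos.toSubmodule =
      K.nneg.toSubmodule ⊔ K.cartan ⊔ K.npos.toSubmodule := by
    change K.npos.toSubmodule ⊔ K.cartan ⊔ K.nneg.toSubmodule = _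
    rw [sup_comm, sup_comm K.npos.toSubmodule, sup_assoc]
  rw [eq_top_iff, ← LieSubalgebra.top_toSubmodule, ← K.generate]
  refine lieSpan_le_of_lie_mem ?_ ?_
  · rintro x ((hx | ⟨i, rfl⟩) | ⟨i, rfl⟩)
    exacts [Submodule.mem_sup_left (Submodule.mem_sup_right hx),
      Submodule.mem_sup_right (K.e_mem_npos i),
      Submodule.mem_sup_left (Submodule.mem_sup_left (K.f_mem_nneg i))]
  · rintro x ((hx | ⟨i, rfl⟩) | ⟨i, rfl⟩) w hw
    exacts [K.lie_cartan_mem_triangular hx hw, K.lie_e_mem_triangular i hw,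
      opposite_eq ▸ K.opposite.lie_e_mem_triangular i (opposite_eq ▸ hw)]

theorem npos_le_adPart {d : K.cartan} {c : ℂ} (hd : ∀ i, K.root i d = c) {S : Set ℂ}
    (hS : ∀ a ∈ S, ∀ b ∈ S, a + b ∈ S) (hc : c ∈ S) :
    K.npos.toSubmodule ≤ adPart (d : g) S := by
  refine lieSpan_le_adPart hS (Set.range_subset_iff.mpr fun i => mem_adPart hc ?_)
  rw [K.lie_cartan_e, hd]

theorem cartan_le_adPart (d : K.cartan) : K.cartan ≤ adPart (d : g) {(0 : ℂ)} := fun x hx =>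
  mem_adPart (Set.mem_singleton 0) (by rw [K.lie_cartan d ⟨x, hx⟩, zero_smul])

theorem disjoint_cartan_npos : Disjoint K.cartan K.npos.toSubmodule := by
  obtain ⟨d, hd⟩ := K.exists_grading
  have npos_le := K.npos_le_adPart hd (S := {c | 0 < c.re})
    (fun a ha b hb => show 0 < a.re + b.re from add_pos ha hb) (by simp)
  exact (adPart_disjoint (d : g) (by simp)).mono (K.cartan_le_adPart d) npos_le

theorem disjoint_nneg_borel : Disjoint K.nneg.toSubmodule K.borel.toSubmodule := by
  obtain ⟨d, hd⟩ := K.exists_grading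
  have npos_le := K.npos_le_adPart hd (S := {c | 0 ≤ c.re})
    (fun a ha b hb => show 0 ≤ a.re + b.re from add_nonneg ha hb) (by simp)
  have cartan_le := (K.cartan_le_adPart d).trans
    (adPart_mono (d : g) (T := {c | 0 ≤ c.re}) (by simp))
  have borel_le : K.borel.toSubmodule ≤ adPart (d : g) {c | 0 ≤ c.re} := sup_le cartan_le npos_le
  have nneg_le := K.opposite.npos_le_adPart (d := d) (c := -1)
    (fun i => show -K.root i d = -1 by rw [hd]) (S := {c | c.re < 0})
    (fun a ha b hb => show a.re + b.re < 0 from add_neg ha hb) (by simp)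
  refine (adPart_disjoint (d : g) ?_).mono nneg_le borel_le
  exact Set.disjoint_left.mpr fun c (h : c.re < 0) (h' : 0 ≤ c.re) => not_lt.mpr h' h

theorem isCompl_nneg_borel : IsCompl K.nneg.toSubmodule K.borel.toSubmodule :=
  ⟨K.disjoint_nneg_borel, codisjoint_iff.mpr ((sup_assoc _ _ _).symm.trans K.triangular)⟩

theorem isCompl_cartan : IsCompl K.cartan (K.nneg.toSubmodule ⊔ K.npos.toSubmodule) := by
  refine ⟨?_, codisjoint_iff.mpr ?_⟩
  · rw [sup_comm]
    exact K.disjoint_cartan_npos.disjoint_sup_right_of_disjoint_sup_left K.disjoint_nneg_borel.symm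
  · rw [← sup_assoc, sup_comm K.cartan, K.triangular]

/-- The projection of `g = N⁻ ⊕ 𝔥 ⊕ N⁺` to `𝔥`. -/
def projCartan : g →ₗ[ℂ] g := Submodule.projection _ _ K.isCompl_cartan

/-- The projection of `g = N⁻ ⊕ 𝔥 ⊕ N⁺` to `N⁻`. -/
def projNeg : g →ₗ[ℂ] g := Submodule.projection _ _ K.isCompl_nneg_borel

theorem projCartan_mem (x : g) : K.projCartan x ∈ K.cartan := Submodule.projection_apply_mem _ x

theorem projCartan_cartan {x : g} (hx : x ∈ K.cartan) : K.projCartan x = x :=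
  Submodule.projection_apply_of_mem_left _ hx

theorem projCartan_npos {x : g} (hx : x ∈ K.npos) : K.projCartan x = 0 :=
  (Submodule.projection_apply_eq_zero_iff _).mpr (Submodule.mem_sup_right hx)

theorem projCartan_nneg {x : g} (hx : x ∈ K.nneg) : K.projCartan x = 0 :=
  (Submodule.projection_apply_eq_zero_iff _).mpr (Submodule.mem_sup_left hx)

theorem projNeg_mem (x : g) : K.projNeg x ∈ K.nneg := Submodule.projection_apply_mem _ x

theorem projNeg_nneg {x : g} (hx : x ∈ K.nneg) : K.projNeg x = x :=
  Submodule.projection_apply_of_mem_left _ hx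

theorem projNeg_borel {x : g} (hx : x ∈ K.borel) : K.projNeg x = 0 :=
  (Submodule.projection_apply_eq_zero_iff _).mpr hx

theorem sub_projNeg_mem (x : g) : x - K.projNeg x ∈ K.borel := by
  refine (Submodule.projection_apply_eq_zero_iff K.isCompl_nneg_borel).mp ?_
  exact (map_sub K.projNeg x _).trans (sub_eq_zero.mpr (K.projNeg_nneg (K.projNeg_mem x)).symm)

theorem exists_triangular (x : g) :
    ∃ a ∈ K.nneg, ∃ h ∈ K.cartan, ∃ b ∈ K.npos, x = a + (h + b) := by
  have hx : x ∈ K.nneg.toSubmodule ⊔ K.borel.toSubmodule :=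
    K.isCompl_nneg_borel.sup_eq_top ▸ Submodule.mem_top
  obtain ⟨a, ha, w, hw, rfl⟩ := Submodule.mem_sup.mp hx
  obtain ⟨h, hh, b, hb, rfl⟩ := Submodule.mem_sup.mp hw
  exact ⟨a, ha, h, hh, b, hb, rfl⟩

theorem exists_triangular_derived {x : g} (hx : x ∈ derived g) :
    ∃ a ∈ K.nneg, ∃ h ∈ K.cartan', ∃ b ∈ K.npos, x = a + (h + b) := by
  obtain ⟨a, ha, h, hh, b, hb, rfl⟩ := K.exists_triangular x
  refine ⟨a, ha, h, ⟨hh, ?_⟩, b, hb, rfl⟩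
  rw [show h = a + (h + b) - a - b by abel]
  exact sub_mem (sub_mem hx (K.nneg_le_derived ha)) (K.npos_le_derived hb)

theorem projCartan_derived {x : g} (hx : x ∈ derived g) : K.projCartan x ∈ K.cartan' := by
  obtain ⟨a, ha, h, hh, b, hb, rfl⟩ := K.exists_triangular_derived hx
  rw [map_add, map_add, K.projCartan_nneg ha, K.projCartan_npos hb, K.projCartan_cartan hh.1,
    zero_add, add_zero]
  exact hh

end KacMoody

/-! ### Loop algebras -/

section Loops

variable {g : Type*} [LieRing g] [LieAlgebra ℂ g] {n : ℕ}

theorem lie_mem_loops_of_lie_mem {W₁ W₂ W₃ : Submodule ℂ g}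
    (h : ∀ x ∈ W₁, ∀ y ∈ W₂, ⁅x, y⁆ ∈ W₃) {x y : Laurent n ⊗[ℂ] g} (hx : x ∈ loops n W₁)
    (hy : y ∈ loops n W₂) : ⁅x, y⁆ ∈ loops n W₃ := by
  obtain ⟨x, rfl⟩ := hx
  obtain ⟨y, rfl⟩ := hy
  change LieModule.toEnd ℂ (Laurent n ⊗[ℂ] g) (Laurent n ⊗[ℂ] g) _ _ ∈ _
  induction x with
  | zero => rw [map_zero, map_zero]; exact zero_mem _
  | add x x' hx hx' => rw [map_add, map_add]; exact add_mem hx hx'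
  | tmul p x =>
    induction y with
    | zero => rw [map_zero, map_zero]; exact zero_mem _
    | add y y' hy hy' => rw [map_add, map_add]; exact add_mem hy hy'
    | tmul q y =>
      rw [LieModule.toEnd_apply_apply, LinearMap.lTensor_tmul, LinearMap.lTensor_tmul,
        LieAlgebra.ExtendScalars.bracket_tmul]
      exact tmul_mem_loops _ (h x x.2 y y.2)

theorem lTensor_eq_of_mem_loops {W : Submodule ℂ g} {S T : g →ₗ[ℂ] g} (h : ∀ x ∈ W, S x = T x)
    {x : Laurent n ⊗[ℂ] g} (hx : x ∈ loops n W) :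
    LinearMap.lTensor (Laurent n) S x = LinearMap.lTensor (Laurent n) T x :=
  (loops_le fun p y hy => by simp [LinearMap.mem_eqLocus, h y hy] :
    loops n W ≤ LinearMap.eqLocus (LinearMap.lTensor _ S) (LinearMap.lTensor _ T)) hx

theorem lTensor_mem_loops {W W' : Submodule ℂ g} {T : g →ₗ[ℂ] g} (h : ∀ x ∈ W, T x ∈ W')
    {x : Laurent n ⊗[ℂ] g} (hx : x ∈ loops n W) :
    LinearMap.lTensor (Laurent n) T x ∈ loops n W' :=
  (loops_le fun p y hy => tmul_mem_loops p (h y hy) :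
    loops n W ≤ (loops n W').comap (LinearMap.lTensor (Laurent n) T)) hx

theorem consts_le_loops (W : Submodule ℂ g) : consts n W ≤ loops n W := by
  rintro _ ⟨x, hx, rfl⟩
  exact tmul_mem_loops 1 hx

theorem loopAlg_le_loops_top : (loopAlg g n).toSubmodule ≤ loops n ⊤ :=
  sup_le (loops_mono le_top) (consts_le_loops ⊤)

theorem tmul_mem_of_mem_lieSpan {s : Set g} {T : LieSubalgebra ℂ (Laurent n ⊗[ℂ] g)}
    (h : ∀ x ∈ s, ∀ p : Laurent n, p ⊗ₜ[ℂ] x ∈ T) {x : g} (hx : x ∈ LieSubalgebra.lieSpan ℂ g s)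
    (p : Laurent n) : p ⊗ₜ[ℂ] x ∈ T := by
  induction hx using LieSubalgebra.lieSpan_induction generalizing p with
  | mem y hy => exact h y hy p
  | zero => rw [TensorProduct.tmul_zero]; exact zero_mem _
  | add y z _ _ h1 h2 => rw [TensorProduct.tmul_add]; exact add_mem (h1 p) (h2 p)
  | smul a y _ h1 => rw [TensorProduct.tmul_smul]; exact LieSubalgebra.smul_mem _ a (h1 p)
  | lie y z _ _ h1 h2 =>
    have := T.lie_mem (h1 p) (h2 1)
    rwa [LieAlgebra.ExtendScalars.bracket_tmul, mul_one] at this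

variable (n) in
/-- For a subalgebra `S ⊆ g`, the subalgebra `g_A ∩ (S ⊗ A)`. -/
def loopSub (S : LieSubalgebra ℂ g) : LieSubalgebra ℂ (loopAlg g n) where
  toSubmodule := (loops n S.toSubmodule).comap (loopAlg g n).toSubmodule.subtype
  lie_mem' := lie_mem_loops_of_lie_mem (W₁ := S.toSubmodule) (W₂ := S.toSubmodule)
    fun _ h _ h' => S.lie_mem h h'

/-- The element `p ⊗ x` of `g_A`, for `x ∈ g'`. -/
def loopElt (p : Laurent n) (x : derived g) : loopAlg g n :=
  ⟨p ⊗ₜ (x : g), Submodule.mem_sup_left (tmul_mem_loops p x.2)⟩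

end Loops

namespace KacMoody

variable {ι g : Type*} [Fintype ι] [DecidableEq ι] {C : Matrix ι ι ℤ} [LieRing g] [LieAlgebra ℂ g]
  (K : KacMoody C g) {n : ℕ}

/-- The element `p ⊗ x` of `𝔥_A`, for `x ∈ 𝔥'`. -/
def cartanElt (p : Laurent n) (x : K.cartan') : K.loopCartan n :=
  ⟨p ⊗ₜ (x : g), Submodule.mem_sup_left (tmul_mem_loops p x.2)⟩

/-- The element `1 ⊗ x` of `𝔥_A`, for `x ∈ 𝔥`. -/
def cartanConst (n : ℕ) (x : K.cartan) : K.loopCartan n :=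
  ⟨1 ⊗ₜ (x : g), Submodule.mem_sup_right (one_tmul_mem_consts x.2)⟩

/-- The element `p ⊗ e i` of `g_A`. -/
def E (i : ι) (p : Laurent n) : loopAlg g n := loopElt p ⟨K.e i, K.e_mem_derived i⟩

/-- The element `p ⊗ f i` of `g_A`. -/
def F (i : ι) (p : Laurent n) : loopAlg g n := loopElt p ⟨K.f i, K.f_mem_derived i⟩

/-- The coroots as elements of `𝔥'`. -/
def coroot' (i : ι) : K.cartan' := ⟨K.coroot i, (K.coroot i).2, K.coroot_mem_derived i⟩

theorem F_add (i : ι) (p q : Laurent n) : K.F i (p + q) = K.F i p + K.F i q :=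
  Subtype.ext (TensorProduct.add_tmul p q (K.f i))

theorem F_smul (i : ι) (c : ℂ) (p : Laurent n) : K.F i (c • p) = c • K.F i p :=
  Subtype.ext (TensorProduct.smul_tmul' c p (K.f i)).symm

theorem inclCartan_add (x y : K.loopCartan n) :
    K.inclCartan (x + y) = K.inclCartan x + K.inclCartan y := rfl

theorem inclCartan_const (x : K.cartan) :
    K.inclCartan (K.cartanConst n x) = const n (x : g) := rfl

theorem lie_E_F (i j : ι) (p q : Laurent n) :
    ⁅K.E i p, K.F j q⁆ =
      if i = j then K.inclCartan (K.cartanElt (p * q) (K.coroot' i)) else 0 := by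
  apply Subtype.ext
  change ⁅p ⊗ₜ[ℂ] K.e i, q ⊗ₜ[ℂ] K.f j⁆ = _
  rw [LieAlgebra.ExtendScalars.bracket_tmul, K.lie_e_f]
  split_ifs
  · rfl
  · exact TensorProduct.tmul_zero _ _

theorem loopCartan_induction {P : K.loopCartan n → Prop}
    (elt : ∀ p x, P (K.cartanElt p x)) (const : ∀ x, P (K.cartanConst n x))
    (add : ∀ x y, P x → P y → P (x + y)) (x : K.loopCartan n) : P x := by
  obtain ⟨x, hx⟩ := x
  obtain ⟨y, hy, _, ⟨z, hz, rfl⟩, rfl⟩ := Submodule.mem_sup.mp hx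
  refine add ⟨y, Submodule.mem_sup_left hy⟩ ⟨1 ⊗ₜ z, _⟩ ?_ (const ⟨z, hz⟩)
  obtain ⟨w, rfl⟩ := hy
  clear hx
  induction w with
  | zero => convert elt 0 0; simp [cartanElt]
  | tmul p x => exact elt p x
  | add a b ha hb =>
    convert add _ _ ha hb
    exact Subtype.ext (map_add _ _ _)

theorem lie_tmul_f (x : K.cartan) (i : ι) (p q : Laurent n) :
    ⁅p ⊗ₜ[ℂ] (x : g), q ⊗ₜ[ℂ] K.f i⁆ = (((-K.root i x) • p) * q) ⊗ₜ[ℂ] K.f i := by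
  rw [LieAlgebra.ExtendScalars.bracket_tmul, K.lie_cartan_f x, smul_mul_assoc,
    TensorProduct.smul_tmul, neg_smul]

theorem exists_lie_inclCartan_F (x : K.loopCartan n) (i : ι) :
    ∃ s : Laurent n, ∀ q : Laurent n, ⁅K.inclCartan x, K.F i q⁆ = K.F i (s * q) := by
  induction x using K.loopCartan_induction with
  | elt p x => exact ⟨_, fun q => Subtype.ext (K.lie_tmul_f ⟨x, x.2.1⟩ i p q)⟩
  | const x => exact ⟨_, fun q => Subtype.ext (K.lie_tmul_f x i 1 q)⟩
  | add x y hx hy =>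
    obtain ⟨s, hs⟩ := hx
    obtain ⟨t, ht⟩ := hy
    exact ⟨s + t, fun q => by rw [inclCartan_add, add_lie, hs, ht, add_mul, F_add]⟩

theorem exists_lie_inclCartan_E (x : K.loopCartan n) (i : ι) :
    ∃ s : Laurent n, ∀ q : Laurent n, ⁅K.inclCartan x, K.E i q⁆ = K.E i (s * q) :=
  K.opposite.exists_lie_inclCartan_F x i

theorem lie_const_F (x : K.cartan) (i : ι) (p : Laurent n) :
    ⁅const n (x : g), K.F i p⁆ = -(K.root i x • K.F i p) := by
  rw [← neg_smul, ← F_smul]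
  refine Subtype.ext ((K.lie_tmul_f x i 1 p).trans ?_)
  rw [smul_mul_assoc, one_mul]
  rfl

theorem eq_top_of_generators_mem (S : LieSubalgebra ℂ (loopAlg g n)) (hE : ∀ i p, K.E i p ∈ S)
    (hF : ∀ i p, K.F i p ∈ S) (hH : ∀ x, K.inclCartan x ∈ S) : S = ⊤ := by
  set T := S.map (loopAlg g n).incl
  have mem_T : ∀ x ∈ S, (x : Laurent n ⊗[ℂ] g) ∈ T := fun x hx => ⟨x, hx, rfl⟩
  have npos_mem : ∀ x ∈ K.npos, ∀ p : Laurent n, p ⊗ₜ[ℂ] x ∈ T := fun x =>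
    tmul_mem_of_mem_lieSpan (Set.forall_mem_range.mpr fun i p => mem_T _ (hE i p))
  have nneg_mem : ∀ x ∈ K.nneg, ∀ p : Laurent n, p ⊗ₜ[ℂ] x ∈ T := fun x =>
    tmul_mem_of_mem_lieSpan (Set.forall_mem_range.mpr fun i p => mem_T _ (hF i p))
  have loopAlg_le : loops n (derived g).toSubmodule ⊔ consts n ⊤ ≤ T.toSubmodule := by
    refine sup_le (loops_le fun p y hy => ?_) ?_
    · obtain ⟨a, ha, h, hh, b, hb, rfl⟩ := K.exists_triangular_derived hy
      rw [TensorProduct.tmul_add, TensorProduct.tmul_add]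
      exact add_mem (nneg_mem a ha p)
        (add_mem (mem_T _ (hH (K.cartanElt p ⟨h, hh⟩))) (npos_mem b hb p))
    · rintro _ ⟨y, -, rfl⟩
      obtain ⟨a, ha, h, hh, b, hb, rfl⟩ := K.exists_triangular y
      rw [map_add, map_add]
      exact add_mem (nneg_mem a ha 1)
        (add_mem (mem_T _ (hH (K.cartanConst n ⟨h, hh⟩))) (npos_mem b hb 1))
  refine eq_top_iff.mpr fun x _ => ?_
  obtain ⟨y, hy, hyx⟩ := loopAlg_le x.2
  exact Subtype.ext hyx ▸ hy

theorem lie_mem_of_generators {V : Type*} [AddCommGroup V] [Module ℂ V]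
    [LieRingModule (loopAlg g n) V] [LieModule ℂ (loopAlg g n) V] {W : Submodule ℂ V}
    (hE : ∀ i p, ∀ w ∈ W, ⁅K.E (n := n) i p, w⁆ ∈ W)
    (hF : ∀ i p, ∀ w ∈ W, ⁅K.F (n := n) i p, w⁆ ∈ W)
    (hH : ∀ x : K.loopCartan n, ∀ w ∈ W, ⁅K.inclCartan x, w⁆ ∈ W) (x : loopAlg g n) {w : V}
    (hw : w ∈ W) : ⁅x, w⁆ ∈ W :=
  (K.eq_top_of_generators_mem (lieTransporter le_rfl) hE hF hH ▸ LieSubalgebra.mem_top x :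
    x ∈ lieTransporter le_rfl) w hw

/-! ### The module `M(Ψ)` is nonzero -/

variable (n) in
theorem isCompl_loopSub :
    IsCompl (loopSub n K.nneg).toSubmodule (loopSub n K.borel).toSubmodule := by
  refine ⟨Submodule.disjoint_def.mpr fun x hx hx' => Subtype.ext ?_,
    codisjoint_iff.mpr (eq_top_iff.mpr fun x _ => ?_)⟩
  · have eq_self := lTensor_eq_of_mem_loops (S := K.projNeg) (T := LinearMap.id)
      (fun y hy => K.projNeg_nneg hy) hx
    have eq_zero := lTensor_eq_of_mem_loops (S := K.projNeg) (T := 0)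
      (fun y hy => K.projNeg_borel hy) hx'
    rw [LinearMap.lTensor_id] at eq_self
    rw [LinearMap.lTensor_zero] at eq_zero
    exact eq_self.symm.trans eq_zero
  · have nneg_mem := lTensor_mem_loops (fun y _ => K.projNeg_mem y) (loopAlg_le_loops_top x.2)
    have borel_mem := lTensor_mem_loops (T := LinearMap.id - K.projNeg)
      (fun y _ => K.sub_projNeg_mem y) (loopAlg_le_loops_top x.2)
    rw [LinearMap.lTensor_sub, LinearMap.lTensor_id] at borel_mem
    exact Submodule.mem_sup.mpr ⟨⟨_, Submodule.mem_sup_left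
      (loops_mono K.nneg_le_derived nneg_mem)⟩, nneg_mem, x - _, borel_mem, add_sub_cancel _ _⟩

/-- The projection of `g_A = N⁻ ⊗ A ⊕ 𝔥_A ⊕ N⁺ ⊗ A` to `𝔥_A`. -/
def projLoopCartan : loopAlg g n →ₗ[ℂ] K.loopCartan n :=
  (LinearMap.lTensor (Laurent n) K.projCartan).restrict (p := (loopAlg g n).toSubmodule)
    fun x hx => by
    obtain ⟨y, hy, _, ⟨z, -, rfl⟩, rfl⟩ := Submodule.mem_sup.mp hx
    rw [map_add]
    exact Submodule.add_mem_sup (lTensor_mem_loops (fun w hw => K.projCartan_derived hw) hy)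
      (one_tmul_mem_consts (K.projCartan_mem z))

theorem projLoopCartan_npos {x : loopAlg g n}
    (hx : (x : Laurent n ⊗[ℂ] g) ∈ loops n K.npos.toSubmodule) : K.projLoopCartan x = 0 := by
  have eq_zero := lTensor_eq_of_mem_loops (S := K.projCartan) (T := 0)
    (fun y hy => K.projCartan_npos hy) hx
  rw [LinearMap.lTensor_zero] at eq_zero
  exact Subtype.ext eq_zero

theorem loopCartan_le_loops : K.loopCartan n ≤ loops n K.cartan :=
  sup_le (loops_mono inf_le_left) (consts_le_loops _)

theorem projLoopCartan_inclCartan (x : K.loopCartan n) :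
    K.projLoopCartan (K.inclCartan x) = x := by
  have eq_self := lTensor_eq_of_mem_loops (S := K.projCartan) (T := LinearMap.id)
    (fun y hy => K.projCartan_cartan hy) (K.loopCartan_le_loops x.2)
  rw [LinearMap.lTensor_id] at eq_self
  exact Subtype.ext eq_self

/-- The action of `g_A` on the module induced from the character `Ψ` of `𝔥_A ⊕ N⁺ ⊗ A`,
realized on `U(N⁻ ⊗ A)`. -/
def vermaRep (Ψ : Module.Dual ℂ (K.loopCartan n)) :
    loopAlg g n →ₗ⁅ℂ⁆ Module.End ℂ (UniversalEnvelopingAlgebra ℂ (loopSub n K.nneg)) :=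
  inducedRep (K.isCompl_loopSub n) (Ψ ∘ₗ K.projLoopCartan) fun x hx y hy => by
    rw [LinearMap.comp_apply, K.projLoopCartan_npos
      (lie_mem_loops_of_lie_mem (fun _ hx _ hy => K.lie_cartan_sup_npos hx hy) hx hy), map_zero]

theorem vermaRep_one (Ψ : Module.Dual ℂ (K.loopCartan n)) {x : loopAlg g n}
    (hx : x ∈ loopSub n K.borel) :
    K.vermaRep Ψ x 1 = algebraMap ℂ _ (Ψ (K.projLoopCartan x)) :=
  inducedRep_one _ _ _ hx

theorem lift_vermaRep_one_of_mem {Ψ : Module.Dual ℂ (K.loopCartan n)}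
    {u : UniversalEnvelopingAlgebra ℂ (loopAlg g n)} (hu : u ∈ K.vermaIdeal Ψ) :
    UniversalEnvelopingAlgebra.lift ℂ (K.vermaRep Ψ) u 1 = 0 := by
  let act := UniversalEnvelopingAlgebra.lift ℂ (K.vermaRep Ψ)
  change act u 1 = 0
  have act_ι (x : loopAlg g n) : act (UniversalEnvelopingAlgebra.ι ℂ x) = K.vermaRep Ψ x :=
    UniversalEnvelopingAlgebra.lift_ι_apply ℂ _ x
  induction hu using Submodule.span_induction with
  | zero => rw [map_zero, LinearMap.zero_apply]
  | add u v _ _ hu hv => rw [map_add, LinearMap.add_apply, hu, hv, add_zero]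
  | smul c u _ hu => rw [smul_eq_mul, map_mul, Module.End.mul_apply, hu, map_zero]
  | mem u hu =>
    obtain ⟨x, hx, rfl⟩ | ⟨x, rfl⟩ := hu
    · rw [act_ι, K.vermaRep_one Ψ (loops_mono le_sup_right hx), K.projLoopCartan_npos hx,
        map_zero, map_zero]
    · rw [map_sub, LinearMap.sub_apply, act_ι, act.commutes,
        K.vermaRep_one Ψ (loops_mono le_sup_left (K.loopCartan_le_loops x.2)),
        K.projLoopCartan_inclCartan, Module.algebraMap_end_apply,
        Algebra.algebraMap_eq_smul_one, sub_self]

theorem one_notMem_vermaIdeal (Ψ : Module.Dual ℂ (K.loopCartan n)) :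
    (1 : UniversalEnvelopingAlgebra ℂ (loopAlg g n)) ∉ K.vermaIdeal Ψ := by
  intro h
  have one_eq_zero := K.lift_vermaRep_one_of_mem h
  rw [map_one (UniversalEnvelopingAlgebra.lift ℂ (K.vermaRep Ψ)),
    Module.End.one_apply] at one_eq_zero
  simpa using congrArg (UniversalEnvelopingAlgebra.lift ℂ
    (0 : loopSub n K.nneg →ₗ⁅ℂ⁆ ℂ)) one_eq_zero

end KacMoody

/-! ### Highest weight modules -/

/-- The vectors annihilated by some `q(f)` with `q(c) ≠ 0`; they contain the eigenvectors of `f`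
for all eigenvalues other than `c`. -/
def torsionAwayFrom {R M : Type*} [CommRing R] [IsDomain R] [AddCommGroup M] [Module R M]
    (f : Module.End R M) (c : R) : Submodule R M where
  carrier := {w | ∃ q : Polynomial R, Polynomial.aeval f q w = 0 ∧ q.eval c ≠ 0}
  zero_mem' := ⟨1, by rw [map_zero], by rw [Polynomial.eval_one]; exact one_ne_zero⟩
  add_mem' := by
    rintro w w' ⟨q, hq, hqc⟩ ⟨q', hq', hqc'⟩
    refine ⟨q * q', ?_, by rw [Polynomial.eval_mul]; exact mul_ne_zero hqc hqc'⟩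
    rw [map_add]
    nth_rw 1 [mul_comm q q']
    rw [map_mul, map_mul, Module.End.mul_apply, Module.End.mul_apply, hq, hq', map_zero,
      map_zero, add_zero]
  smul_mem' := by
    rintro a w ⟨q, hq, hqc⟩
    exact ⟨q, by rw [map_smul, hq, smul_zero], hqc⟩

theorem mem_torsionAwayFrom_of_apply_eq_smul {R M : Type*} [CommRing R] [IsDomain R]
    [AddCommGroup M] [Module R M] {f : Module.End R M} {a c : R} (h : a ≠ c) {w : M}
    (hw : f w = a • w) : w ∈ torsionAwayFrom f c := by
  refine ⟨Polynomial.X - Polynomial.C a, ?_, ?_⟩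
  · rw [map_sub, Polynomial.aeval_X, Polynomial.aeval_C, LinearMap.sub_apply, hw,
      Module.algebraMap_end_apply, sub_self]
  · rw [Polynomial.eval_sub, Polynomial.eval_X, Polynomial.eval_C]
    exact sub_ne_zero.mpr h.symm

namespace KacMoody

variable {ι g : Type*} [Fintype ι] [DecidableEq ι] {C : Matrix ι ι ℤ} [LieRing g] [LieAlgebra ℂ g]
  (K : KacMoody C g) (n : ℕ) {V : Type*} [AddCommGroup V] [Module ℂ V]
  [LieRingModule (loopAlg g n) V]

variable (V) in
/-- The sum of the images of the operators `p ⊗ f i`. -/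
def lowerPart : Submodule ℂ V :=
  Submodule.span ℂ {w | ∃ (i : ι) (p : Laurent n) (u : V), w = ⁅K.F i p, u⁆}

/-- The vector `(p₁ ⊗ f i₁) ⋯ (pₖ ⊗ f iₖ) s`, for the list `[(i₁, p₁), …, (iₖ, pₖ)]`. -/
def word {n : ℕ} {V : Type*} [AddCommGroup V] [LieRingModule (loopAlg g n) V]
    (l : List (ι × Laurent n)) (s : V) : V :=
  l.foldr (fun a w => ⁅K.F a.1 a.2, w⁆) s

/-- The filtration of `U(N⁻ ⊗ A) S` by the length of words in the `p ⊗ f i`. The bound on the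
length is strict, so that the filtration starts with `0`. -/
def wordFiltration (S : Submodule ℂ V) (k : ℕ) : Submodule ℂ V :=
  Submodule.span ℂ {w | ∃ l : List (ι × Laurent n), l.length < k ∧ ∃ s ∈ S, w = K.word l s}

variable [LieModule ℂ (loopAlg g n) V]

variable (V) in
/-- The subspace of singular vectors, those annihilated by `N⁺ ⊗ A`. -/
def singular : Submodule ℂ V := ⨅ a : ι × Laurent n, (LieModule.toEnd ℂ _ V (K.E a.1 a.2)).ker

variable {n}

theorem mem_singular {w : V} : w ∈ K.singular n V ↔ ∀ i p, ⁅K.E (n := n) i p, w⁆ = 0 := by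
  simp only [singular, Submodule.mem_iInf, LinearMap.mem_ker, LieModule.toEnd_apply_apply,
    Prod.forall]

theorem lie_H_mem_singular (x : K.loopCartan n) {w : V} (hw : w ∈ K.singular n V) :
    ⁅K.inclCartan x, w⁆ ∈ K.singular n V := by
  rw [mem_singular] at hw ⊢
  intro i p
  obtain ⟨t, ht⟩ := K.exists_lie_inclCartan_E x i
  rw [leibniz_lie, ← lie_skew, ht, hw, lie_zero, neg_lie, hw, neg_zero, add_zero]

omit [LieModule ℂ (loopAlg g n) V] in
theorem lie_F_mem_lowerPart (i : ι) (p : Laurent n) (u : V) : ⁅K.F i p, u⁆ ∈ K.lowerPart n V :=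
  Submodule.subset_span ⟨i, p, u, rfl⟩

theorem lie_H_mem_lowerPart (x : K.loopCartan n) {w : V} (hw : w ∈ K.lowerPart n V) :
    ⁅K.inclCartan x, w⁆ ∈ K.lowerPart n V := by
  refine lie_mem_of_mem_span ?_ hw
  rintro _ ⟨i, p, u, rfl⟩
  obtain ⟨t, ht⟩ := K.exists_lie_inclCartan_F x i
  rw [leibniz_lie, ht]
  exact add_mem (K.lie_F_mem_lowerPart _ _ _) (K.lie_F_mem_lowerPart _ _ _)

section

omit [LieModule ℂ (loopAlg g n) V]

omit [Module ℂ V] in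
theorem word_cons (a : ι × Laurent n) (l : List (ι × Laurent n)) (s : V) :
    K.word (a :: l) s = ⁅K.F a.1 a.2, K.word l s⁆ := rfl

theorem word_mem_wordFiltration {S : Submodule ℂ V} {s : V} (hs : s ∈ S)
    {l : List (ι × Laurent n)} {k : ℕ} (hl : l.length < k) :
    K.word l s ∈ K.wordFiltration n S k :=
  Submodule.subset_span ⟨l, hl, s, hs, rfl⟩

theorem wordFiltration_mono (S : Submodule ℂ V) : Monotone (K.wordFiltration n S) := by
  intro a b hab
  refine Submodule.span_mono ?_
  rintro _ ⟨l, hl, s, hs, rfl⟩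
  exact ⟨l, hl.trans_le hab, s, hs, rfl⟩

theorem wordFiltration_zero (S : Submodule ℂ V) : K.wordFiltration n S 0 = ⊥ := by
  refine le_bot_iff.mp (Submodule.span_le.mpr ?_)
  rintro _ ⟨l, hl, -⟩
  exact absurd hl l.length.not_lt_zero

theorem wordFiltration_le (S : Submodule ℂ V) (k : ℕ) :
    K.wordFiltration n S k ≤ S ⊔ K.lowerPart n V := by
  refine Submodule.span_le.mpr ?_
  rintro _ ⟨l, -, s, hs, rfl⟩
  cases l with
  | nil => exact Submodule.mem_sup_left hs
  | cons a l => exact Submodule.mem_sup_right (K.lie_F_mem_lowerPart _ _ _)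

end

theorem word_smul (l : List (ι × Laurent n)) (c : ℂ) (s : V) :
    K.word l (c • s) = c • K.word l s := by
  induction l with
  | nil => rfl
  | cons a l ih => rw [word_cons, word_cons, ih, lie_smul]

theorem lie_F_mem_wordFiltration (i : ι) (p : Laurent n) {S : Submodule ℂ V} {k : ℕ} {w : V}
    (hw : w ∈ K.wordFiltration n S k) : ⁅K.F i p, w⁆ ∈ K.wordFiltration n S (k + 1) := by
  refine lie_mem_of_mem_span ?_ hw
  rintro _ ⟨l, hl, s, hs, rfl⟩
  exact K.word_mem_wordFiltration (l := (i, p) :: l) hs (Nat.succ_lt_succ hl)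

section WordModule

variable {S : Submodule ℂ V} (hH : ∀ x : K.loopCartan n, ∀ s ∈ S, ⁅K.inclCartan x, s⁆ ∈ S)

include hH

theorem lie_H_mem_wordFiltration (x : K.loopCartan n) {k : ℕ} {w : V}
    (hw : w ∈ K.wordFiltration n S k) : ⁅K.inclCartan x, w⁆ ∈ K.wordFiltration n S k := by
  refine lie_mem_of_mem_span ?_ hw
  rintro _ ⟨l, hl, s, hs, rfl⟩
  clear hw
  induction l generalizing k with
  | nil => exact K.word_mem_wordFiltration (l := []) (hH x s hs) hl
  | cons a l ih =>
    obtain ⟨k, rfl⟩ := Nat.exists_eq_add_one_of_ne_zero (Nat.ne_zero_of_lt hl)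
    obtain ⟨t, ht⟩ := K.exists_lie_inclCartan_F x a.1
    rw [word_cons, leibniz_lie, ht]
    exact add_mem (K.word_mem_wordFiltration (l := (a.1, t * a.2) :: l) hs hl)
      (K.lie_F_mem_wordFiltration _ _ (ih (Nat.lt_of_succ_lt_succ hl)))

variable (hE : S ≤ K.singular n V)

include hE

theorem lie_E_mem_wordFiltration (i : ι) (p : Laurent n) {k : ℕ} {w : V}
    (hw : w ∈ K.wordFiltration n S (k + 1)) : ⁅K.E i p, w⁆ ∈ K.wordFiltration n S k := by
  refine lie_mem_of_mem_span ?_ hw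
  rintro _ ⟨l, hl, s, hs, rfl⟩
  clear hw
  induction l generalizing k with
  | nil =>
    change ⁅K.E i p, s⁆ ∈ _
    rw [K.mem_singular.mp (hE hs)]
    exact zero_mem _
  | cons a l ih =>
    obtain ⟨k, rfl⟩ := Nat.exists_eq_add_one_of_ne_zero
      (Nat.ne_zero_of_lt (Nat.lt_of_succ_lt_succ hl))
    have hl : l.length < k + 1 := Nat.lt_of_succ_lt_succ hl
    rw [word_cons, leibniz_lie, K.lie_E_F]
    refine add_mem ?_ (K.lie_F_mem_wordFiltration _ _ (ih hl))
    split_ifs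
    · exact K.lie_H_mem_wordFiltration hH _ (K.word_mem_wordFiltration hs hl)
    · rw [zero_lie]
      exact zero_mem _

/-- The submodule `U(N⁻ ⊗ A) S` generated by an `𝔥_A`-stable space `S` of singular vectors. -/
def wordModule : LieSubmodule ℂ (loopAlg g n) V where
  toSubmodule := ⨆ k, K.wordFiltration n S k
  lie_mem {x _} hw := K.lie_mem_of_generators
    (fun i p _ => lie_mem_of_mem_iSup fun k _ hw => Submodule.mem_iSup_of_mem k
      (K.lie_E_mem_wordFiltration hH hE i p (K.wordFiltration_mono S k.le_succ hw)))
    (fun i p _ => lie_mem_of_mem_iSup fun k _ hw => Submodule.mem_iSup_of_mem (k + 1)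
      (K.lie_F_mem_wordFiltration i p hw))
    (fun x _ => lie_mem_of_mem_iSup fun k _ hw => Submodule.mem_iSup_of_mem k
      (K.lie_H_mem_wordFiltration hH x hw)) x hw

theorem mem_wordModule {s : V} (hs : s ∈ S) : s ∈ K.wordModule hH hE :=
  Submodule.mem_iSup_of_mem 1 (K.word_mem_wordFiltration (l := []) hs zero_lt_one)

end WordModule

/-- The module `V` is generated by its highest weight vector `v` of weight `Ψ`. -/
structure IsHighestWeight {V : Type*} [AddCommGroup V] [Module ℂ V]
    [LieRingModule (loopAlg g n) V] (Ψ : Module.Dual ℂ (K.loopCartan n)) (v : V) : Prop where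
  lie_E : ∀ i p, ⁅K.E (n := n) i p, v⁆ = 0
  lie_H : ∀ x, ⁅K.inclCartan x, v⁆ = Ψ x • v
  gen : ∀ N : LieSubmodule ℂ (loopAlg g n) V, v ∈ N → N = ⊤

namespace IsHighestWeight

variable {K} {Ψ : Module.Dual ℂ (K.loopCartan n)} {v : V} (hv : K.IsHighestWeight Ψ v)

include hv

omit [LieModule ℂ (loopAlg g n) V] in
theorem ne_zero [Nontrivial V] : v ≠ 0 := by
  rintro rfl
  exact bot_ne_top (hv.gen ⊥ (zero_mem _))

theorem span_le_singular : Submodule.span ℂ {v} ≤ K.singular n V :=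
  (Submodule.span_singleton_le_iff_mem _ _).mpr (K.mem_singular.mpr hv.lie_E)

theorem lie_H_mem_span (x : K.loopCartan n) (s : V) (hs : s ∈ Submodule.span ℂ {v}) :
    ⁅K.inclCartan x, s⁆ ∈ Submodule.span ℂ {v} := by
  refine lie_mem_of_mem_span ?_ hs
  rintro _ rfl
  rw [hv.lie_H]
  exact Submodule.smul_mem _ _ (Submodule.mem_span_singleton_self _)

theorem exists_mem_wordFiltration (w : V) :
    ∃ k, w ∈ K.wordFiltration n (Submodule.span ℂ {v}) k := by
  have h := hv.gen _ (K.mem_wordModule hv.lie_H_mem_span hv.span_le_singular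
    (Submodule.mem_span_singleton_self v)) ▸ LieSubmodule.mem_top w
  exact (Submodule.mem_iSup_of_directed _ (K.wordFiltration_mono _).directed_le).mp h

theorem mem_of_word_mem {W : Submodule ℂ V} (h : ∀ l : List (ι × Laurent n), K.word l v ∈ W)
    (w : V) : w ∈ W := by
  obtain ⟨k, hw⟩ := hv.exists_mem_wordFiltration w
  refine Submodule.span_le.mpr ?_ hw
  rintro _ ⟨l, -, s, hs, rfl⟩
  obtain ⟨c, rfl⟩ := Submodule.mem_span_singleton.mp hs
  rw [word_smul]
  exact W.smul_mem c (h l)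

theorem exists_eq_smul_add (w : V) : ∃ c : ℂ, ∃ u ∈ K.lowerPart n V, w = c • v + u := by
  obtain ⟨k, hw⟩ := hv.exists_mem_wordFiltration w
  obtain ⟨s, hs, u, hu, rfl⟩ := Submodule.mem_sup.mp (K.wordFiltration_le _ k hw)
  obtain ⟨c, rfl⟩ := Submodule.mem_span_singleton.mp hs
  exact ⟨c, u, hu, rfl⟩

theorem lie_const_word (x : K.cartan) (l : List (ι × Laurent n)) :
    ⁅const n (x : g), K.word l v⁆ =
      (Ψ (K.cartanConst n x) - (l.map fun a => K.root a.1 x).sum) • K.word l v := by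
  induction l with
  | nil =>
    rw [← K.inclCartan_const]
    simpa [word] using hv.lie_H (K.cartanConst n x)
  | cons a l ih =>
    rw [word_cons, leibniz_lie, ih, K.lie_const_F, neg_lie, smul_lie, lie_smul, List.map_cons,
      List.sum_cons]
    module

theorem lowerPart_le_torsionAwayFrom {d : K.cartan} (hd : ∀ i, K.root i d = 1) :
    K.lowerPart n V ≤ torsionAwayFrom (LieModule.toEnd ℂ (loopAlg g n) V (const n (d : g)))
      (Ψ (K.cartanConst n d)) := by
  refine Submodule.span_le.mpr ?_
  rintro _ ⟨i, p, u, rfl⟩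
  refine hv.mem_of_word_mem (W := (torsionAwayFrom _ _).comap
    (LieModule.toEnd ℂ (loopAlg g n) V (K.F i p))) (fun l => ?_) u
  refine mem_torsionAwayFrom_of_apply_eq_smul ?_ (hv.lie_const_word d ((i, p) :: l))
  simp only [hd, List.map_const', List.sum_replicate, List.length_cons, nsmul_eq_mul, mul_one,
    ne_eq, sub_eq_self]
  exact Nat.cast_ne_zero.mpr l.length.succ_ne_zero

theorem aeval_toEnd (d : K.cartan) (q : Polynomial ℂ) :
    Polynomial.aeval (LieModule.toEnd ℂ (loopAlg g n) V (const n (d : g))) q v =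
      q.eval (Ψ (K.cartanConst n d)) • v :=
  Module.End.aeval_apply_of_mem_apply_eq_smul (hv.lie_H (K.cartanConst n d))

theorem notMem_lowerPart [Nontrivial V] : v ∉ K.lowerPart n V := by
  intro h
  obtain ⟨d, hd⟩ := K.exists_grading
  obtain ⟨q, hq, hqc⟩ := hv.lowerPart_le_torsionAwayFrom hd h
  rw [hv.aeval_toEnd] at hq
  exact smul_ne_zero hqc hv.ne_zero hq

theorem le_lowerPart {N : LieSubmodule ℂ (loopAlg g n) V} (hN : N ≠ ⊤) :
    N.toSubmodule ≤ K.lowerPart n V := by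
  intro w hw
  obtain ⟨d, hd⟩ := K.exists_grading
  obtain ⟨c, u, hu, rfl⟩ := hv.exists_eq_smul_add w
  obtain ⟨q, hq, hqc⟩ := hv.lowerPart_le_torsionAwayFrom hd hu
  obtain rfl | hc := eq_or_ne c 0
  · rwa [zero_smul, zero_add]
  have smul_mem : (c * q.eval (Ψ (K.cartanConst n d))) • v ∈ N := by
    have h := Polynomial.aeval_apply_smul_mem_of_le_comap hw q
      (LieModule.toEnd ℂ (loopAlg g n) V (const n (d : g))) (fun _ => N.lie_mem)
    rwa [map_add, hq, add_zero, map_smul, hv.aeval_toEnd, smul_smul] at h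
  exact absurd (hv.gen N ((N.toSubmodule.smul_mem_iff (mul_ne_zero hc hqc)).mp smul_mem)) hN

theorem singular_le_span [LieModule.IsIrreducible ℂ (loopAlg g n) V] :
    K.singular n V ≤ Submodule.span ℂ {v} := by
  have := LieModule.nontrivial_of_isIrreducible ℂ (loopAlg g n) V
  intro w hw
  obtain ⟨c, u, hu, rfl⟩ := hv.exists_eq_smul_add w
  set S := K.lowerPart n V ⊓ K.singular n V
  set N := K.wordModule (S := S)
    (fun x s hs => ⟨K.lie_H_mem_lowerPart x hs.1, K.lie_H_mem_singular x hs.2⟩) inf_le_right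
  have N_le : N.toSubmodule ≤ K.lowerPart n V :=
    iSup_le fun k => (K.wordFiltration_le S k).trans (sup_le inf_le_left le_rfl)
  have N_ne_top : N ≠ ⊤ := fun h => hv.notMem_lowerPart (N_le (h ▸ LieSubmodule.mem_top v))
  have u_singular : u ∈ K.singular n V := by
    have h := sub_mem hw ((K.singular n V).smul_mem c (K.mem_singular.mpr hv.lie_E))
    rwa [add_sub_cancel_left] at h
  have u_mem : u ∈ N := K.mem_wordModule _ _ ⟨hu, u_singular⟩
  rw [(IsSimpleOrder.eq_bot_or_eq_top N).resolve_right N_ne_top, LieSubmodule.mem_bot] at u_mem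
  rw [u_mem, add_zero]
  exact Submodule.smul_mem _ c (Submodule.mem_span_singleton_self v)

theorem eq_zero_of_mem_wordFiltration (hs : K.singular n V ≤ Submodule.span ℂ {v})
    {N : LieSubmodule ℂ (loopAlg g n) V} (hN : N ≠ ⊤) {k : ℕ} {w : V}
    (hw : w ∈ K.wordFiltration n (Submodule.span ℂ {v}) k) (hwN : w ∈ N) : w = 0 := by
  induction k generalizing w with
  | zero => rwa [wordFiltration_zero] at hw
  | succ k ih =>
    have hw : w ∈ K.singular n V := K.mem_singular.mpr fun i p =>
      ih (K.lie_E_mem_wordFiltration hv.lie_H_mem_span hv.span_le_singular i p hw) (N.lie_mem hwN)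
    obtain ⟨c, rfl⟩ := Submodule.mem_span_singleton.mp (hs hw)
    obtain rfl | hc := eq_or_ne c 0
    · exact zero_smul ℂ v
    · exact absurd (hv.gen N ((N.toSubmodule.smul_mem_iff hc).mp hwN)) hN

theorem isIrreducible [Nontrivial V] (hs : K.singular n V ≤ Submodule.span ℂ {v}) :
    LieModule.IsIrreducible ℂ (loopAlg g n) V := by
  refine .mk fun N hN => by_contra fun hN' => hN ((LieSubmodule.eq_bot_iff N).mpr fun w hw => ?_)
  obtain ⟨k, hk⟩ := hv.exists_mem_wordFiltration w
  exact hv.eq_zero_of_mem_wordFiltration hs hN' hk hw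

end IsHighestWeight

end KacMoody

/-! ### Vanishing on an ideal of `A` -/

section KernelIdeal

variable {R A M : Type*} [CommRing R] [CommRing A] [Algebra R A] [AddCommGroup M] [Module R M]

/-- The largest ideal of the algebra `A` contained in the kernel of the linear map `φ`. -/
def kernelIdeal (φ : A →ₗ[R] M) : Ideal A where
  carrier := {a | ∀ b, φ (b * a) = 0}
  add_mem' h h' b := by rw [mul_add, map_add, h, h', add_zero]
  zero_mem' b := by rw [mul_zero, map_zero]
  smul_mem' c a h b := by rw [smul_eq_mul, ← mul_assoc, h]

theorem apply_eq_zero_of_mem_kernelIdeal {φ : A →ₗ[R] M} {a : A} (ha : a ∈ kernelIdeal φ) :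
    φ a = 0 := by
  simpa only [one_mul] using ha 1

theorem le_kernelIdeal {φ : A →ₗ[R] M} {I : Ideal A} (h : ∀ a ∈ I, φ a = 0) : I ≤ kernelIdeal φ :=
  fun _ ha b => h _ (I.mul_mem_left b ha)

end KernelIdeal

section LoopElt

variable {g : Type*} [LieRing g] [LieAlgebra ℂ g] {n : ℕ}

theorem loopElt_add_left (p q : Laurent n) (x : derived g) :
    loopElt (p + q) x = loopElt p x + loopElt q x :=
  Subtype.ext (TensorProduct.add_tmul p q (x : g))

theorem loopElt_add_right (p : Laurent n) (x y : derived g) :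
    loopElt p (x + y) = loopElt p x + loopElt p y :=
  Subtype.ext (TensorProduct.tmul_add p (x : g) y)

theorem lie_loopElt_loopElt (p q : Laurent n) (x y : derived g) :
    ⁅loopElt p x, loopElt q y⁆ = loopElt (p * q) ⁅x, y⁆ :=
  Subtype.ext (LieAlgebra.ExtendScalars.bracket_tmul ℂ (Laurent n) g g p q (x : g) (y : g))

theorem lie_const_loopElt (p : Laurent n) (x : g) (y : derived g) :
    ⁅const n x, loopElt p y⁆ = loopElt p ⟨⁅x, (y : g)⁆, lie_mem_right ℂ g _ x y y.2⟩ :=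
  Subtype.ext ((LieAlgebra.ExtendScalars.bracket_tmul ℂ (Laurent n) g g 1 p x (y : g)).trans
    (congrArg (· ⊗ₜ[ℂ] ⁅x, (y : g)⁆) (one_mul p)))

theorem loopElt_mem_of_mem_lieSpan {s : Set g} {S : LieSubalgebra ℂ (loopAlg g n)}
    (hsd : s ⊆ derived g) (hs : ∀ (x : derived g), (x : g) ∈ s → ∀ p, loopElt p x ∈ S)
    {x : derived g} (hx : (x : g) ∈ LieSubalgebra.lieSpan ℂ g s) (p : Laurent n) :
    loopElt p x ∈ S := by
  obtain ⟨y, hy, h⟩ := tmul_mem_of_mem_lieSpan (T := S.map (loopAlg g n).incl)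
    (fun x hx p => ⟨loopElt p ⟨x, hsd hx⟩, hs _ hx p, rfl⟩) hx p
  rwa [← show y = loopElt p x from Subtype.ext h]

end LoopElt

namespace KacMoody

variable {ι g : Type*} [Fintype ι] [DecidableEq ι] {C : Matrix ι ι ℤ} [LieRing g] [LieAlgebra ℂ g]
  (K : KacMoody C g) {n : ℕ}

theorem inclCartan_cartanElt (p : Laurent n) (x : K.cartan') :
    K.inclCartan (K.cartanElt p x) = loopElt p ⟨(x : g), x.2.2⟩ := rfl

/-- The pairing `A × 𝔥' → ℂ`, `(p, x) ↦ Ψ(x ⊗ p)`, of a functional `Ψ` on `𝔥_A`. -/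
def cartanPairing (Ψ : Module.Dual ℂ (K.loopCartan n)) :
    Laurent n →ₗ[ℂ] K.cartan' →ₗ[ℂ] ℂ :=
  LinearMap.mk₂ ℂ (fun p x => Ψ (K.cartanElt p x))
    (fun p q x => by
      rw [← map_add]; exact congrArg Ψ (Subtype.ext (TensorProduct.add_tmul p q (x : g))))
    (fun c p x => by
      rw [← map_smul]; exact congrArg Ψ (Subtype.ext (TensorProduct.smul_tmul' c p (x : g)).symm))
    (fun p x y => by
      rw [← map_add]; exact congrArg Ψ (Subtype.ext (TensorProduct.tmul_add p (x : g) y)))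
    (fun c p x => by
      rw [← map_smul]; exact congrArg Ψ (Subtype.ext (TensorProduct.tmul_smul c p (x : g))))

/-- The largest ideal `I ⊆ A` with `Ψ(𝔥' ⊗ I) = 0`. -/
def killer (Ψ : Module.Dual ℂ (K.loopCartan n)) : Ideal (Laurent n) :=
  kernelIdeal (K.cartanPairing Ψ)

variable {K} in
theorem apply_cartanElt_of_mem_killer {Ψ : Module.Dual ℂ (K.loopCartan n)} {p : Laurent n}
    (hp : p ∈ K.killer Ψ) (x : K.cartan') : Ψ (K.cartanElt p x) = 0 :=
  LinearMap.congr_fun (apply_eq_zero_of_mem_kernelIdeal hp) x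

section

variable (V : Type*) [AddCommGroup V] [Module ℂ V]
  [LieRingModule (loopAlg g n) V]

/-- The subspace `(g' ⊗ I) V`, for an ideal `I` of `A`. -/
def loopImage (I : Ideal (Laurent n)) : Submodule ℂ V :=
  Submodule.span ℂ {u | ∃ p ∈ I, ∃ (x : derived g) (w : V), u = ⁅loopElt p x, w⁆}

variable {V}

theorem lie_loopElt_mem_loopImage {I : Ideal (Laurent n)} {p : Laurent n} (hp : p ∈ I)
    (x : derived g) (w : V) : ⁅loopElt p x, w⁆ ∈ loopImage (g := g) V I :=
  Submodule.subset_span ⟨p, hp, x, w, rfl⟩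

variable [LieModule ℂ (loopAlg g n) V]

theorem lie_loopElt_mem_loopImage_of_mem {I : Ideal (Laurent n)} (q : Laurent n) (y : derived g)
    {w : V} (hw : w ∈ loopImage (g := g) V I) : ⁅loopElt q y, w⁆ ∈ loopImage (g := g) V I := by
  refine lie_mem_of_mem_span ?_ hw
  rintro _ ⟨p, hp, x, u, rfl⟩
  rw [leibniz_lie, lie_loopElt_loopElt]
  exact add_mem (lie_loopElt_mem_loopImage (I.mul_mem_left _ hp) _ _)
    (lie_loopElt_mem_loopImage hp _ _)

theorem lie_const_mem_loopImage_of_mem {I : Ideal (Laurent n)} (y : g)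
    {w : V} (hw : w ∈ loopImage (g := g) V I) : ⁅const n y, w⁆ ∈ loopImage (g := g) V I := by
  refine lie_mem_of_mem_span ?_ hw
  rintro _ ⟨p, hp, x, u, rfl⟩
  rw [leibniz_lie, lie_const_loopElt]
  exact add_mem (lie_loopElt_mem_loopImage hp _ _) (lie_loopElt_mem_loopImage hp _ _)

theorem lie_H_mem_loopImage_of_mem {I : Ideal (Laurent n)} (h : K.loopCartan n)
    {w : V} (hw : w ∈ loopImage (g := g) V I) :
    ⁅K.inclCartan h, w⁆ ∈ loopImage (g := g) V I := by
  induction h using K.loopCartan_induction with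
  | elt q y => exact lie_loopElt_mem_loopImage_of_mem q ⟨(y : g), y.2.2⟩ hw
  | const y => exact lie_const_mem_loopImage_of_mem (y : g) hw
  | add y z hy hz => rw [inclCartan_add, add_lie]; exact add_mem hy hz

variable {K} {Ψ : Module.Dual ℂ (K.loopCartan n)} {v : V}

namespace IsHighestWeight

variable (hv : K.IsHighestWeight Ψ v)

include hv

theorem lie_eq_zero_of_mem_loops {x : loopAlg g n}
    (hx : (x : Laurent n ⊗[ℂ] g) ∈ loops n K.npos.toSubmodule) : ⁅x, v⁆ = 0 := by
  let S : LieSubalgebra ℂ (loopAlg g n) :=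
    lieTransporter (bot_le : (⊥ : Submodule ℂ V) ≤ Submodule.span ℂ {v})
  have mem_S {y : loopAlg g n} (hy : ⁅y, v⁆ = 0) : y ∈ S := fun w hw =>
    lie_mem_of_mem_span (by rintro _ rfl; exact hy) hw
  have loops_npos_le : loops n K.npos.toSubmodule ≤ (S.map (loopAlg g n).incl).toSubmodule :=
    loops_le fun p y hy => ⟨loopElt p ⟨y, K.npos_le_derived hy⟩,
      loopElt_mem_of_mem_lieSpan (s := Set.range K.e) (x := ⟨y, K.npos_le_derived hy⟩)
        (by rintro _ ⟨i, rfl⟩; exact K.e_mem_derived i)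
        (by rintro ⟨_, h⟩ ⟨i, rfl⟩ p; exact mem_S (hv.lie_E i p)) hy p, rfl⟩
  obtain ⟨y, hy, hyx⟩ := loops_npos_le hx
  obtain rfl : y = x := Subtype.ext hyx
  exact hy v (Submodule.mem_span_singleton_self v)

variable {p : Laurent n} (hp : p ∈ K.killer Ψ) (x : derived g)

include hp in
theorem loopElt_mem_lowerPart : ⁅loopElt p x, v⁆ ∈ K.lowerPart n V := by
  obtain ⟨x, hx⟩ := x
  obtain ⟨a, ha, h, hh, b, hb, rfl⟩ := K.exists_triangular_derived hx
  have act_h : ⁅K.inclCartan (K.cartanElt p ⟨h, hh⟩), v⁆ = 0 := by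
    rw [hv.lie_H, apply_cartanElt_of_mem_killer hp, zero_smul]
  have act_a : loopElt p ⟨a, K.nneg_le_derived ha⟩ ∈
      lieTransporter (le_top (a := K.lowerPart n V)) := by
    refine loopElt_mem_of_mem_lieSpan (s := Set.range K.f)
      (x := ⟨a, K.nneg_le_derived ha⟩) ?_ ?_ ha p
    · rintro _ ⟨i, rfl⟩
      exact K.f_mem_derived i
    · rintro ⟨_, _⟩ ⟨i, rfl⟩ p w -
      exact K.lie_F_mem_lowerPart i p w
  have act_b : ⁅loopElt p ⟨b, K.npos_le_derived hb⟩, v⁆ = 0 :=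
    hv.lie_eq_zero_of_mem_loops (tmul_mem_loops p hb)
  have split : loopElt p ⟨a + (h + b), hx⟩ = loopElt p ⟨a, K.nneg_le_derived ha⟩ +
      (K.inclCartan (K.cartanElt p ⟨h, hh⟩) + loopElt p ⟨b, K.npos_le_derived hb⟩) := by
    rw [inclCartan_cartanElt, ← loopElt_add_right, ← loopElt_add_right]
    rfl
  rw [split, add_lie, add_lie, act_h, act_b, add_zero, add_zero]
  exact act_a v Submodule.mem_top

include hp in
theorem lie_loopElt_word_mem_lowerPart (l : List (ι × Laurent n)) :
    ⁅loopElt p x, K.word l v⁆ ∈ K.lowerPart n V := by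
  induction l generalizing p x with
  | nil => exact hv.loopElt_mem_lowerPart hp x
  | cons a l ih =>
    rw [word_cons, leibniz_lie, F, lie_loopElt_loopElt]
    exact add_mem (ih ((K.killer Ψ).mul_mem_right _ hp) _) (K.lie_F_mem_lowerPart _ _ _)

theorem loopImage_le_lowerPart : loopImage (g := g) V (K.killer Ψ) ≤ K.lowerPart n V := by
  refine Submodule.span_le.mpr ?_
  rintro _ ⟨p, hp, x, w, rfl⟩
  exact hv.mem_of_word_mem (W := (K.lowerPart n V).comap
    (LieModule.toEnd ℂ (loopAlg g n) V (loopElt p x))) (hv.lie_loopElt_word_mem_lowerPart hp x) w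

include hp in
theorem lie_loopElt_eq_zero [LieModule.IsIrreducible ℂ (loopAlg g n) V] (w : V) :
    ⁅loopElt p x, w⁆ = 0 := by
  have := LieModule.nontrivial_of_isIrreducible ℂ (loopAlg g n) V
  let N : LieSubmodule ℂ (loopAlg g n) V :=
    { loopImage (g := g) V (K.killer Ψ) with
      lie_mem := fun {x _} => K.lie_mem_of_generators
        (fun _ q _ => lie_loopElt_mem_loopImage_of_mem q _)
        (fun _ q _ => lie_loopElt_mem_loopImage_of_mem q _)
        (fun h _ => K.lie_H_mem_loopImage_of_mem h) x }
  have N_ne_top : N ≠ ⊤ := fun h =>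
    hv.notMem_lowerPart (hv.loopImage_le_lowerPart (h ▸ LieSubmodule.mem_top v : v ∈ N))
  have N_eq_bot : N = ⊥ := (IsSimpleOrder.eq_bot_or_eq_top N).resolve_right N_ne_top
  exact (LieSubmodule.eq_bot_iff N).mp N_eq_bot _ (lie_loopElt_mem_loopImage hp x w)

end IsHighestWeight

end

end KacMoody

/-! ### Tensor products -/

theorem exists_tmul_of_forall_rTensor_eq_zero {R M N J : Type*} [CommRing R] [AddCommGroup M]
    [Module R M] [AddCommGroup N] [Module R N] [Module.Free R N] {T : J → Module.End R M} {m : M}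
    (hT : ⨅ j, (T j).ker ≤ Submodule.span R {m}) {t : M ⊗[R] N}
    (ht : ∀ j, (T j).rTensor N t = 0) : ∃ w, t = m ⊗ₜ w := by
  classical
  let b := Module.Free.chooseBasis R N
  let e := TensorProduct.equivFinsuppOfBasisRight (M := M) b
  have coeff_mem : ∀ k, e t k ∈ Submodule.span R {m} := by
    refine fun k => hT ((Submodule.mem_iInf _).mpr fun j => ?_)
    have comm : T j ∘ₗ (TensorProduct.rid R M).toLinearMap ∘ₗ (b.coord k).lTensor M =
        (TensorProduct.rid R M).toLinearMap ∘ₗ (b.coord k).lTensor M ∘ₗ (T j).rTensor N := by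
      ext
      simp
    rw [LinearMap.mem_ker, TensorProduct.equivFinsuppOfBasisRight_apply]
    refine (DFunLike.congr_fun comm t).trans ?_
    rw [LinearMap.comp_apply, LinearMap.comp_apply, ht j, map_zero, map_zero]
  choose c hc using fun k => Submodule.mem_span_singleton.mp (coeff_mem k)
  have t_eq : t = (e t).sum fun k x => x ⊗ₜ b k :=
    (e.symm_apply_apply t).symm.trans (TensorProduct.equivFinsuppOfBasisRight_symm_apply b _)
  refine ⟨(e t).sum fun k _ => c k • b k, t_eq.trans ?_⟩
  simp only [Finsupp.sum, TensorProduct.tmul_sum, ← TensorProduct.smul_tmul, hc]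

theorem eq_zero_of_tmul_eq_zero {k V W : Type*} [Field k] [AddCommGroup V] [Module k V]
    [AddCommGroup W] [Module k W] {v : V} (hv : v ≠ 0) {w : W} (h : v ⊗ₜ[k] w = 0) : w = 0 := by
  obtain ⟨f, hf⟩ : ∃ f : Module.Dual k V, f v ≠ 0 := by
    by_contra! hf
    exact hv ((Module.forall_dual_apply_eq_zero_iff k v).mp hf)
  have h := congrArg (TensorProduct.lid k W ∘ f.rTensor W) h
  simp only [Function.comp_apply, LinearMap.rTensor_tmul, TensorProduct.lid_tmul, map_zero] at h
  exact (smul_eq_zero.mp h).resolve_left hf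

namespace KacMoody.IsHighestWeight

section

variable {ι g : Type*} [Fintype ι] [DecidableEq ι] {C : Matrix ι ι ℤ} [LieRing g] [LieAlgebra ℂ g]
  {K : KacMoody C g} {n : ℕ} {Ψ₁ Ψ₂ : Module.Dual ℂ (K.loopCartan n)} {V₁ V₂ : Type*}
  [AddCommGroup V₁] [Module ℂ V₁] [LieRingModule (loopAlg g n) V₁] [LieModule ℂ (loopAlg g n) V₁]
  [AddCommGroup V₂] [Module ℂ V₂] [LieRingModule (loopAlg g n) V₂] [LieModule ℂ (loopAlg g n) V₂]
  {v₁ : V₁} {v₂ : V₂}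

theorem exists_lie_tmul_eq [LieModule.IsIrreducible ℂ (loopAlg g n) V₁]
    [LieModule.IsIrreducible ℂ (loopAlg g n) V₂]
    (hv₁ : K.IsHighestWeight Ψ₁ v₁) (hv₂ : K.IsHighestWeight Ψ₂ v₂)
    (hI : IsCoprime (K.killer Ψ₁) (K.killer Ψ₂)) :
    ∃ a₁ a₂ : Laurent n, ∀ p (x : derived g) (w₁ : V₁) (w₂ : V₂),
      ⁅loopElt (a₁ * p) x, w₁ ⊗ₜ[ℂ] w₂⁆ = ⁅loopElt p x, w₁⁆ ⊗ₜ w₂ ∧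
      ⁅loopElt (a₂ * p) x, w₁ ⊗ₜ[ℂ] w₂⁆ = w₁ ⊗ₜ ⁅loopElt p x, w₂⁆ := by
  obtain ⟨a₂, ha₂, a₁, ha₁, ha⟩ := Ideal.isCoprime_iff_exists.mp hI
  refine ⟨a₁, a₂, fun p x w₁ w₂ => ?_⟩
  have split : loopElt p x = loopElt (a₂ * p) x + loopElt (a₁ * p) x := by
    rw [← loopElt_add_left, ← add_mul, ha, one_mul]
  have zero₁ : ⁅loopElt (a₂ * p) x, w₁⁆ = 0 :=
    hv₁.lie_loopElt_eq_zero (Ideal.mul_mem_right _ _ ha₂) x w₁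
  have zero₂ : ⁅loopElt (a₁ * p) x, w₂⁆ = 0 :=
    hv₂.lie_loopElt_eq_zero (Ideal.mul_mem_right _ _ ha₁) x w₂
  rw [split, add_lie, add_lie, TensorProduct.LieModule.lie_tmul_right,
    TensorProduct.LieModule.lie_tmul_right, zero₁, zero₂]
  simp only [TensorProduct.tmul_zero, TensorProduct.zero_tmul, add_zero, zero_add, and_self]

theorem tmul [LieModule.IsIrreducible ℂ (loopAlg g n) V₁]
    [LieModule.IsIrreducible ℂ (loopAlg g n) V₂]
    (hv₁ : K.IsHighestWeight Ψ₁ v₁) (hv₂ : K.IsHighestWeight Ψ₂ v₂)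
    (hI : IsCoprime (K.killer Ψ₁) (K.killer Ψ₂)) :
    K.IsHighestWeight (Ψ₁ + Ψ₂) (v₁ ⊗ₜ[ℂ] v₂) where
  lie_E i p := by
    rw [TensorProduct.LieModule.lie_tmul_right, hv₁.lie_E, hv₂.lie_E, TensorProduct.zero_tmul,
      TensorProduct.tmul_zero, add_zero]
  lie_H x := by
    rw [TensorProduct.LieModule.lie_tmul_right, hv₁.lie_H, hv₂.lie_H, TensorProduct.tmul_smul,
      ← TensorProduct.smul_tmul', ← add_smul, LinearMap.add_apply]
  gen N hN := by
    obtain ⟨a₁, a₂, lie_tmul⟩ := hv₁.exists_lie_tmul_eq hv₂ hI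
    have left_mem : ∀ w₁ : V₁, w₁ ⊗ₜ v₂ ∈ N := by
      refine hv₁.mem_of_word_mem (W := N.toSubmodule.comap ((TensorProduct.mk ℂ V₁ V₂).flip v₂))
        fun l => ?_
      induction l with
      | nil => exact hN
      | cons a l ih =>
        have h := N.lie_mem (x := loopElt (a₁ * a.2) ⟨K.f a.1, K.f_mem_derived a.1⟩) ih
        rwa [LinearMap.flip_apply, TensorProduct.mk_apply, (lie_tmul _ _ _ _).1] at h
    have tmul_mem : ∀ (w₁ : V₁) (w₂ : V₂), w₁ ⊗ₜ w₂ ∈ N := by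
      intro w₁
      refine hv₂.mem_of_word_mem (W := N.toSubmodule.comap (TensorProduct.mk ℂ V₁ V₂ w₁))
        fun l => ?_
      induction l with
      | nil => exact left_mem w₁
      | cons a l ih =>
        have h := N.lie_mem (x := loopElt (a₂ * a.2) ⟨K.f a.1, K.f_mem_derived a.1⟩) ih
        rwa [TensorProduct.mk_apply, (lie_tmul _ _ _ _).2] at h
    rw [← LieSubmodule.toSubmodule_eq_top, eq_top_iff, ← TensorProduct.span_tmul_eq_top]
    refine Submodule.span_le.mpr ?_
    rintro _ ⟨w₁, w₂, rfl⟩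
    exact tmul_mem w₁ w₂

theorem singular_tmul_le_span [LieModule.IsIrreducible ℂ (loopAlg g n) V₁]
    [LieModule.IsIrreducible ℂ (loopAlg g n) V₂]
    (hv₁ : K.IsHighestWeight Ψ₁ v₁) (hv₂ : K.IsHighestWeight Ψ₂ v₂)
    (hI : IsCoprime (K.killer Ψ₁) (K.killer Ψ₂)) :
    K.singular n (V₁ ⊗[ℂ] V₂) ≤ Submodule.span ℂ {v₁ ⊗ₜ[ℂ] v₂} := by
  have := LieModule.nontrivial_of_isIrreducible ℂ (loopAlg g n) V₁
  obtain ⟨a₁, a₂, lie_tmul⟩ := hv₁.exists_lie_tmul_eq hv₂ hI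
  intro t ht
  have rTensor_eq : ∀ p (x : derived g) (t : V₁ ⊗[ℂ] V₂),
      (LieModule.toEnd ℂ (loopAlg g n) V₁ (loopElt p x)).rTensor V₂ t =
        ⁅loopElt (a₁ * p) x, t⁆ := by
    intro p x t
    induction t with
    | zero => rw [map_zero, lie_zero]
    | add s t hs ht => rw [map_add, hs, ht, lie_add]
    | tmul w₁ w₂ => rw [(lie_tmul _ _ _ _).1]; rfl
  obtain ⟨w, rfl⟩ := exists_tmul_of_forall_rTensor_eq_zero hv₁.singular_le_span
    (fun a => by rw [E, rTensor_eq]; exact K.mem_singular.mp ht a.1 _)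
  have w_singular : w ∈ K.singular n V₂ := by
    refine K.mem_singular.mpr fun i p =>
      eq_zero_of_tmul_eq_zero (k := ℂ) hv₁.ne_zero ?_
    rw [E, ← (lie_tmul _ _ _ _).2]
    exact K.mem_singular.mp ht i _
  obtain ⟨c, rfl⟩ := Submodule.mem_span_singleton.mp (hv₂.singular_le_span w_singular)
  exact Submodule.mem_span_singleton.mpr ⟨c, (TensorProduct.tmul_smul _ _ _).symm⟩

theorem isIrreducible_tensorProduct [LieModule.IsIrreducible ℂ (loopAlg g n) V₁]
    [LieModule.IsIrreducible ℂ (loopAlg g n) V₂]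
    (hv₁ : K.IsHighestWeight Ψ₁ v₁) (hv₂ : K.IsHighestWeight Ψ₂ v₂)
    (hI : IsCoprime (K.killer Ψ₁) (K.killer Ψ₂)) :
    LieModule.IsIrreducible ℂ (loopAlg g n) (V₁ ⊗[ℂ] V₂) := by
  have := LieModule.nontrivial_of_isIrreducible ℂ (loopAlg g n) V₁
  have := LieModule.nontrivial_of_isIrreducible ℂ (loopAlg g n) V₂
  have : Nontrivial (V₁ ⊗[ℂ] V₂) :=
    nontrivial_of_ne _ _ fun h => hv₂.ne_zero (eq_zero_of_tmul_eq_zero hv₁.ne_zero h)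
  exact (hv₁.tmul hv₂ hI).isIrreducible (hv₁.singular_tmul_le_span hv₂ hI)

end

end KacMoody.IsHighestWeight

/-! ### The irreducible module V(Ψ) -/

section EnvelopingModule

variable {R L M : Type*} [CommRing R] [LieRing L] [LieAlgebra R L] [AddCommGroup M] [Module R M]
  [LieRingModule L M]

/-- The Lie submodules of `M` are its submodules over the enveloping algebra `U(L)`, provided that
the two actions on `M` are compatible. -/
def lieSubmoduleOrderIso [Module (UniversalEnvelopingAlgebra R L) M]
    [IsScalarTower R (UniversalEnvelopingAlgebra R L) M]
    (h : ∀ (x : L) (m : M), UniversalEnvelopingAlgebra.ι R x • m = ⁅x, m⁆) :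
    LieSubmodule R L M ≃o Submodule (UniversalEnvelopingAlgebra R L) M where
  toFun N :=
    { N with
      smul_mem' := fun u _ hm => env_smul_mem (W := N.toSubmodule)
        (fun x m hm => by rw [h]; exact N.lie_mem hm) u hm }
  invFun N :=
    { N.restrictScalars R with
      lie_mem := fun {x m} hm => by rw [← h]; exact N.smul_mem _ hm }
  left_inv _ := rfl
  right_inv _ := rfl
  map_rel_iff' := Iff.rfl

variable (R L M) [LieModule R L M]

/-- A representation of `L`, regarded as a module over the enveloping algebra `U(L)`. -/
abbrev envModule : Module (UniversalEnvelopingAlgebra R L) M :=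
  Module.compHom M (UniversalEnvelopingAlgebra.lift R (LieModule.toEnd R L M)).toRingHom

theorem envModule_isScalarTower :
    letI := envModule R L M; IsScalarTower R (UniversalEnvelopingAlgebra R L) M :=
  letI := envModule R L M
  ⟨fun c u m => by
    change UniversalEnvelopingAlgebra.lift R (LieModule.toEnd R L M) (c • u) m = _
    rw [map_smul]
    rfl⟩

variable {R L M} in
theorem envModule_ι_smul (x : L) (m : M) :
    letI := envModule R L M; UniversalEnvelopingAlgebra.ι R x • m = ⁅x, m⁆ := by
  change UniversalEnvelopingAlgebra.lift R (LieModule.toEnd R L M)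
    (UniversalEnvelopingAlgebra.ι R x) m = _
  rw [UniversalEnvelopingAlgebra.lift_ι_apply, LieModule.toEnd_apply_apply]

end EnvelopingModule

namespace KacMoody

variable {ι g : Type*} [Fintype ι] [DecidableEq ι] {C : Matrix ι ι ℤ} [LieRing g] [LieAlgebra ℂ g]
  (K : KacMoody C g) {n : ℕ} (Ψ : Module.Dual ℂ (K.loopCartan n))

instance : LieRingModule (loopAlg g n) (K.verma Ψ) := envLieRingModule ℂ _ _

instance : LieModule ℂ (loopAlg g n) (K.verma Ψ) := envLieModule ℂ _ _

instance : LieRingModule (loopAlg g n) (K.simpleMod Ψ) := envLieRingModule ℂ _ _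

instance : LieModule ℂ (loopAlg g n) (K.simpleMod Ψ) := envLieModule ℂ _ _

theorem act_eq_lie (x : loopAlg g n) (v : K.simpleMod Ψ) : K.act x v = ⁅x, v⁆ := rfl

/-- The canonical highest weight vector of `M(Ψ)`. -/
def vermaGen : K.verma Ψ := (K.vermaIdeal Ψ).mkQ 1

theorem mkQ_vermaIdeal (u : UniversalEnvelopingAlgebra ℂ (loopAlg g n)) :
    (K.vermaIdeal Ψ).mkQ u = u • K.vermaGen Ψ := by
  rw [vermaGen, ← map_smul, smul_eq_mul, mul_one]

theorem smul_vermaGen_eq_zero {u : UniversalEnvelopingAlgebra ℂ (loopAlg g n)}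
    (hu : u ∈ K.vermaIdeal Ψ) : u • K.vermaGen Ψ = 0 := by
  rwa [← mkQ_vermaIdeal, Submodule.mkQ_apply, Submodule.Quotient.mk_eq_zero]

theorem verma_isHighestWeight : K.IsHighestWeight Ψ (K.vermaGen Ψ) where
  lie_E i p := K.smul_vermaGen_eq_zero Ψ
    (Submodule.subset_span (Or.inl ⟨_, tmul_mem_loops p (K.e_mem_npos i), rfl⟩))
  lie_H x := by
    have h := K.smul_vermaGen_eq_zero Ψ (Submodule.subset_span (Or.inr ⟨x, rfl⟩))
    rwa [sub_smul, algebraMap_smul, sub_eq_zero] at h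
  gen N hN := eq_top_iff.mpr fun w _ => by
    obtain ⟨u, rfl⟩ := Submodule.mkQ_surjective _ w
    rw [mkQ_vermaIdeal]
    exact env_smul_mem (W := N.toSubmodule) (fun x w hw => N.lie_mem (x := x) hw) u hN

instance : Nontrivial (K.verma Ψ) :=
  Submodule.Quotient.nontrivial_iff.mpr fun h =>
    K.one_notMem_vermaIdeal Ψ (h ▸ Submodule.mem_top)

theorem maxSub_le_lowerPart :
    (K.maxSub Ψ).restrictScalars ℂ ≤ K.lowerPart n (K.verma Ψ) := by
  intro w hw
  rw [Submodule.restrictScalars_mem, maxSub, sSup_eq_iSup'] at hw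
  refine Submodule.iSup_induction _ (motive := fun w => w ∈ K.lowerPart n (K.verma Ψ)) hw ?_
    (zero_mem _) (fun _ _ => add_mem)
  rintro ⟨N, hN⟩ w hw
  let Φ := lieSubmoduleOrderIso (R := ℂ) (L := loopAlg g n) (M := K.verma Ψ) fun _ _ => rfl
  exact (K.verma_isHighestWeight Ψ).le_lowerPart
    (N := Φ.symm N) (fun h => hN ((map_eq_top_iff Φ.symm).mp h)) hw

theorem isCoatom_maxSub : IsCoatom (K.maxSub Ψ) :=
  ⟨fun h => (K.verma_isHighestWeight Ψ).notMem_lowerPart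
      (K.maxSub_le_lowerPart Ψ (h ▸ Submodule.mem_top : K.vermaGen Ψ ∈ K.maxSub Ψ)),
    fun _ hN => by_contra fun h => hN.not_ge (le_sSup h)⟩

instance : LieModule.IsIrreducible ℂ (loopAlg g n) (K.simpleMod Ψ) :=
  have := (isSimpleModule_iff _ _).mp (isSimpleModule_iff_isCoatom.mpr (K.isCoatom_maxSub Ψ))
  (lieSubmoduleOrderIso (R := ℂ) (L := loopAlg g n) (M := K.simpleMod Ψ)
    fun _ _ => rfl).isSimpleOrder

/-- The canonical highest weight vector of `V(Ψ)`. -/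
def simpleGen : K.simpleMod Ψ := (K.maxSub Ψ).mkQ (K.vermaGen Ψ)

section

variable {V V' : Type*} [AddCommGroup V] [Module ℂ V] [LieRingModule (loopAlg g n) V]
  [AddCommGroup V'] [Module ℂ V'] [LieRingModule (loopAlg g n) V']

variable {K Ψ} in
theorem IsHighestWeight.map [LieModule ℂ (loopAlg g n) V'] {v : V} (hv : K.IsHighestWeight Ψ v)
    (f : V →ₗ⁅ℂ,loopAlg g n⁆ V') (hf : Function.Surjective f) : K.IsHighestWeight Ψ (f v) where
  lie_E i p := by rw [← LieModuleHom.map_lie, hv.lie_E, map_zero]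
  lie_H x := by rw [← LieModuleHom.map_lie, hv.lie_H, map_smul]
  gen N hN := eq_top_iff.mpr fun w _ => by
    obtain ⟨w, rfl⟩ := hf w
    exact LieSubmodule.mem_comap.mp (hv.gen (N.comap f) hN ▸ LieSubmodule.mem_top w)

end

theorem simple_isHighestWeight : K.IsHighestWeight Ψ (K.simpleGen Ψ) := by
  let π : K.verma Ψ →ₗ⁅ℂ,loopAlg g n⁆ K.simpleMod Ψ :=
    { toLinearMap := (K.maxSub Ψ).mkQ.restrictScalars ℂ
      map_lie' := fun {x w} => map_smul (K.maxSub Ψ).mkQ (UniversalEnvelopingAlgebra.ι ℂ x) w }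
  exact (K.verma_isHighestWeight Ψ).map π (Submodule.mkQ_surjective (K.maxSub Ψ))

namespace IsHighestWeight

variable {K Ψ} {V : Type*} [AddCommGroup V] [Module ℂ V] [LieRingModule (loopAlg g n) V]
  [LieModule ℂ (loopAlg g n) V] {v : V} (hv : K.IsHighestWeight Ψ v)

include hv

theorem exists_verma_hom [Module (UniversalEnvelopingAlgebra ℂ (loopAlg g n)) V]
    [IsScalarTower ℂ (UniversalEnvelopingAlgebra ℂ (loopAlg g n)) V]
    (h : ∀ (x : loopAlg g n) (w : V), UniversalEnvelopingAlgebra.ι ℂ x • w = ⁅x, w⁆) :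
    ∃ f : K.verma Ψ →ₗ[UniversalEnvelopingAlgebra ℂ (loopAlg g n)] V, f (K.vermaGen Ψ) = v := by
  refine ⟨(K.vermaIdeal Ψ).liftQ (LinearMap.toSpanSingleton _ V v) ?_, one_smul _ v⟩
  refine Submodule.span_le.mpr ?_
  rintro _ (⟨x, hx, rfl⟩ | ⟨x, rfl⟩) <;>
    rw [SetLike.mem_coe, LinearMap.mem_ker, LinearMap.toSpanSingleton_apply]
  · rw [h, hv.lie_eq_zero_of_mem_loops hx]
  · rw [sub_smul, h, hv.lie_H, algebraMap_smul, sub_self]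

theorem exists_equiv [LieModule.IsIrreducible ℂ (loopAlg g n) V] :
    ∃ E : K.simpleMod Ψ ≃ₗ[ℂ] V, ∀ x w, E (K.act x w) = ⁅x, E w⁆ := by
  let := envModule ℂ (loopAlg g n) V
  have := envModule_isScalarTower ℂ (loopAlg g n) V
  have ι_smul := envModule_ι_smul (R := ℂ) (L := loopAlg g n) (M := V)
  obtain ⟨f, hf⟩ := hv.exists_verma_hom ι_smul
  let Φ := lieSubmoduleOrderIso ι_smul
  have f_surjective : Function.Surjective f := by
    have h : Φ.symm (LinearMap.range f) = ⊤ := hv.gen _ ⟨_, hf⟩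
    exact LinearMap.range_eq_top.mp ((map_eq_top_iff Φ.symm).mp h)
  have : IsSimpleModule (UniversalEnvelopingAlgebra ℂ (loopAlg g n)) V :=
    (isSimpleModule_iff _ _).mpr Φ.symm.isSimpleOrder
  have ker_eq : K.maxSub Ψ = LinearMap.ker f := by
    have isCoatom_ker := LinearMap.isCoatom_ker_of_surjective f_surjective
    exact ((isCoatom_ker.le_iff.mp (le_sSup isCoatom_ker.ne_top)).resolve_left
      (K.isCoatom_maxSub Ψ).ne_top)
  let E := (Submodule.quotEquivOfEq _ _ ker_eq).trans
    (LinearMap.quotKerEquivOfSurjective f f_surjective)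
  exact ⟨E.restrictScalars ℂ, fun x w => (map_smul E _ w).trans (ι_smul x (E w))⟩

end IsHighestWeight

section Twisted

/-- The `g_A`-module `V` with the action composed with the automorphism `twist a`. -/
def Twisted (_ : Fin n → ℂˣ) (V : Type*) := V

variable (a : Fin n → ℂˣ) (V : Type*) [AddCommGroup V] [Module ℂ V]
  [LieRingModule (loopAlg g n) V]

instance : AddCommGroup (Twisted a V) := inferInstanceAs (AddCommGroup V)

instance : Module ℂ (Twisted a V) := inferInstanceAs (Module ℂ V)

instance : LieRingModule (loopAlg g n) (Twisted a V) :=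
  LieRingModule.compLieHom V (twist (g := g) a : loopAlg g n →ₗ⁅ℂ⁆ loopAlg g n)

instance [LieModule ℂ (loopAlg g n) V] : LieModule ℂ (loopAlg g n) (Twisted a V) :=
  LieModule.compLieHom V (twist (g := g) a : loopAlg g n →ₗ⁅ℂ⁆ loopAlg g n)

/-- The identity map `V → Twisted a V`. -/
def toTwisted : V ≃ₗ[ℂ] Twisted a V := LinearEquiv.refl ℂ V

theorem lie_toTwisted (x : loopAlg g n) (w : V) :
    ⁅x, toTwisted a V w⁆ = toTwisted a V ⁅twist a x, w⁆ := rfl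

/-- As `twist a` is bijective, `V` and `Twisted a V` have the same submodules. -/
def twistedOrderIso :
    LieSubmodule ℂ (loopAlg g n) V ≃o LieSubmodule ℂ (loopAlg g n) (Twisted a V) where
  toFun N :=
    { N.toSubmodule.map (toTwisted a V : V →ₗ[ℂ] Twisted a V) with
      lie_mem := by
        rintro x _ ⟨w, hw, rfl⟩
        exact ⟨⁅twist a x, w⁆, N.lie_mem hw, rfl⟩ }
  invFun N :=
    { N.toSubmodule.comap (toTwisted a V : V →ₗ[ℂ] Twisted a V) with
      lie_mem := fun {x w} hw => by
        change toTwisted a V ⁅x, w⁆ ∈ N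
        rw [← (twist a).apply_symm_apply x, ← lie_toTwisted]
        exact N.lie_mem hw }
  left_inv N := LieSubmodule.toSubmodule_injective (Submodule.comap_map_eq_of_injective
    (toTwisted a V).injective N.toSubmodule)
  right_inv N := LieSubmodule.toSubmodule_injective (Submodule.map_comap_eq_of_surjective
    (toTwisted a V).surjective N.toSubmodule)
  map_rel_iff' := Submodule.map_le_map_iff_of_injective (toTwisted a V).injective _ _

instance [LieModule.IsIrreducible ℂ (loopAlg g n) V] :
    LieModule.IsIrreducible ℂ (loopAlg g n) (Twisted a V) :=
  (twistedOrderIso a V).symm.isSimpleOrder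

variable {K Ψ V} in
theorem IsHighestWeight.twisted {v : V} (hv : K.IsHighestWeight Ψ v) :
    K.IsHighestWeight (K.twistFun a Ψ) (toTwisted a V v) where
  lie_E i p := by
    rw [lie_toTwisted, show twist a (K.E i p) = K.E i (scale a p) from rfl, hv.lie_E, map_zero]
  lie_H x :=
    (congrArg (toTwisted a V) (hv.lie_H ⟨_, scale_mem_sup a _ _ x.2⟩)).trans (map_smul _ _ _)
  gen N hN := (map_eq_top_iff (twistedOrderIso a V).symm).mp (hv.gen _ hN)

theorem exists_twist_equiv :
    ∃ E : K.simpleMod (K.twistFun a Ψ) ≃ₗ[ℂ] K.simpleMod Ψ,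
      ∀ x w, E (K.act x w) = K.act (twist a x) (E w) := by
  obtain ⟨E, hE⟩ := ((K.simple_isHighestWeight Ψ).twisted a).exists_equiv
  refine ⟨E.trans (toTwisted a _).symm, fun x w => ?_⟩
  rw [LinearEquiv.trans_apply, LinearEquiv.trans_apply, LinearEquiv.symm_apply_eq, hE,
    act_eq_lie, ← lie_toTwisted, LinearEquiv.apply_symm_apply]

theorem twist_const (x : g) : twist a (const n x) = const n x :=
  Subtype.ext (congrArg (· ⊗ₜ[ℂ] x) (map_one (scale a)))

end Twisted

end KacMoody

/-! ### Exp-polynomial functionals -/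

theorem derivation_mem_pow {R A : Type*} [CommRing R] [CommRing A] [Algebra R A]
    (D : Derivation R A A) (I : Ideal A) {N : ℕ} {x : A} (hx : x ∈ I ^ (N + 1)) : D x ∈ I ^ N := by
  induction N generalizing x with
  | zero => rw [pow_zero, Ideal.one_eq_top]; exact Submodule.mem_top
  | succ N ih =>
    rw [pow_succ] at hx
    induction hx using Submodule.mul_induction_on' with
    | mem_mul_mem x hx y hy =>
      rw [D.leibniz, smul_eq_mul, smul_eq_mul, mul_comm y, pow_succ]
      exact add_mem (Ideal.mul_mem_right _ _ hx) (Ideal.mul_mem_mul (ih hx) hy)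
    | add x _ y _ hx hy => rw [map_add]; exact add_mem hx hy

section

variable {n : ℕ}

theorem mono_mul_mono (m m' : Fin n → ℤ) : mono m * mono m' = mono (m + m') := by
  rw [mono, mono, AddMonoidAlgebra.single_mul_single, mul_one, mono]

theorem laurent_hom_ext {M : Type*} [AddCommGroup M] [Module ℂ M] {f f' : Laurent n →ₗ[ℂ] M}
    (h : ∀ m, f (mono m) = f' (mono m)) : f = f' :=
  AddMonoidAlgebra.lhom_ext' fun m => LinearMap.ext_ring (h m)

/-- The evaluation `A → ℂ` at a point of `(ℂ^*)ⁿ`. -/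
def evalPoint (a : Fin n → ℂˣ) : Laurent n →ₐ[ℂ] ℂ :=
  AddMonoidAlgebra.lift ℂ ℂ (Fin n → ℤ)
    { toFun := fun m => (expo a m.toAdd : ℂ)
      map_one' := by simp [expo]
      map_mul' := fun x y => by simp [expo, zpow_add, Finset.prod_mul_distrib] }

theorem evalPoint_mono (a : Fin n → ℂˣ) (m : Fin n → ℤ) : evalPoint a (mono m) = expo a m := by
  simp [evalPoint, mono]

/-- The maximal ideal of a point of `(ℂ^*)ⁿ`. -/
def pointIdeal (a : Fin n → ℂˣ) : Ideal (Laurent n) := RingHom.ker (evalPoint a)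

instance (a : Fin n → ℂˣ) : (pointIdeal a).IsMaximal :=
  RingHom.ker_isMaximal_of_surjective (evalPoint a)
    (fun c => ⟨algebraMap ℂ _ c, (evalPoint a).commutes c⟩)

theorem expo_single (a : Fin n → ℂˣ) (i : Fin n) : expo a (Pi.single i 1) = a i := by
  rw [expo, Finset.prod_eq_single_of_mem i (Finset.mem_univ i)
    fun j _ hj => by rw [Pi.single_eq_of_ne hj, zpow_zero], Pi.single_eq_same, zpow_one]

theorem pointIdeal_injective : Function.Injective (pointIdeal (n := n)) := by
  intro a b h
  funext i
  have mem_iff (c : Fin n → ℂˣ) :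
      mono (Pi.single i 1) - algebraMap ℂ (Laurent n) (a i) ∈ pointIdeal c ↔ c i = a i := by
    rw [pointIdeal, RingHom.mem_ker, map_sub, evalPoint_mono, expo_single, AlgHom.commutes,
      sub_eq_zero, Units.ext_iff, Algebra.algebraMap_self_apply]
  exact ((mem_iff b).mp (h ▸ (mem_iff a).mpr rfl)).symm

/-- The derivation `t_i ∂/∂t_i` of `A`. -/
def eulerOp (i : Fin n) : Derivation ℂ (Laurent n) (Laurent n) :=
  let D : Laurent n →ₗ[ℂ] Laurent n :=
    (Finsupp.linearCombination ℂ fun m : Fin n → ℤ => (m i : ℂ) • mono m) ∘ₗ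
      (AddMonoidAlgebra.coeffLinearEquiv ℂ).toLinearMap
  have D_mono (m : Fin n → ℤ) : D (mono m) = (m i : ℂ) • mono m := by simp [D, mono]
  have leibniz : (LinearMap.mul ℂ (Laurent n)).compr₂ D =
      (LinearMap.mul ℂ (Laurent n)).compl₂ D + (LinearMap.mul ℂ (Laurent n)) ∘ₗ D := by
    refine laurent_hom_ext fun m => laurent_hom_ext fun m' => ?_
    simp only [LinearMap.compr₂_apply, LinearMap.compl₂_apply, LinearMap.add_apply,
      LinearMap.comp_apply, LinearMap.mul_apply', D_mono, mono_mul_mono, smul_mul_assoc,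
      mul_smul_comm, ← add_smul, Pi.add_apply, Int.cast_add, add_comm]
  Derivation.mk' D fun x y => (LinearMap.congr_fun₂ leibniz x y).trans
    (congrArg (x * D y + ·) (mul_comm (D x) y))

theorem eulerOp_mono (i : Fin n) (m : Fin n → ℤ) : eulerOp i (mono m) = (m i : ℂ) • mono m := by
  simp [eulerOp, mono]

theorem exists_functional_pow_eq_zero (a : Fin n → ℂˣ) (p : MvPolynomial (Fin n) ℂ) :
    ∃ φ : Laurent n →ₗ[ℂ] ℂ,
      (∀ m, φ (mono m) = MvPolynomial.eval (fun i => (m i : ℂ)) p * (expo a m : ℂ)) ∧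
      ∃ N, ∀ x ∈ pointIdeal a ^ N, φ x = 0 := by
  induction p using MvPolynomial.induction_on with
  | C c =>
    refine ⟨c • (evalPoint a).toLinearMap, fun m => ?_, 1, fun x hx => ?_⟩
    · rw [MvPolynomial.eval_C, ← evalPoint_mono, LinearMap.smul_apply, smul_eq_mul,
        AlgHom.toLinearMap_apply]
    · rw [pow_one, pointIdeal, RingHom.mem_ker] at hx
      rw [LinearMap.smul_apply, AlgHom.toLinearMap_apply, hx, smul_zero]
  | add p q hp hq =>
    obtain ⟨φ, hφ, N, hN⟩ := hp
    obtain ⟨φ', hφ', N', hN'⟩ := hq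
    refine ⟨φ + φ', fun m => ?_, max N N', fun x hx => ?_⟩
    · rw [LinearMap.add_apply, hφ, hφ', map_add, add_mul]
    · rw [LinearMap.add_apply, hN x (Ideal.pow_le_pow_right (le_max_left _ _) hx),
        hN' x (Ideal.pow_le_pow_right (le_max_right _ _) hx), add_zero]
  | mul_X p i hp =>
    obtain ⟨φ, hφ, N, hN⟩ := hp
    refine ⟨φ ∘ₗ (eulerOp i).toLinearMap, fun m => ?_, N + 1,
      fun x hx => hN _ (derivation_mem_pow (eulerOp i) _ hx)⟩
    rw [LinearMap.comp_apply, Derivation.coeFn_coe, eulerOp_mono, map_smul, hφ, map_mul,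
      MvPolynomial.eval_X, smul_eq_mul]
    ring

/-- The ideal `J` contains a product of maximal ideals of points of `B`; equivalently `A ⧸ J` is
finite-dimensional with support in `B`. -/
def SupportedOn (B : Set (Fin n → ℂˣ)) (J : Ideal (Laurent n)) : Prop :=
  ∃ s : Multiset (Fin n → ℂˣ), (∀ a ∈ s, a ∈ B) ∧ (s.map pointIdeal).prod ≤ J

namespace SupportedOn

variable {B : Set (Fin n → ℂˣ)} {J J' : Ideal (Laurent n)}

protected theorem top : SupportedOn B ⊤ := ⟨0, by simp, le_top⟩

protected theorem mono (h : SupportedOn B J) (hJ : J ≤ J') : SupportedOn B J' :=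
  let ⟨s, hs, hsJ⟩ := h
  ⟨s, hs, hsJ.trans hJ⟩

protected theorem inf (h : SupportedOn B J) (h' : SupportedOn B J') : SupportedOn B (J ⊓ J') := by
  obtain ⟨s, hs, h⟩ := h
  obtain ⟨s', hs', h'⟩ := h'
  refine ⟨s + s', fun a ha => (Multiset.mem_add.mp ha).elim (hs a) (hs' a), ?_⟩
  rw [Multiset.map_add, Multiset.prod_add]
  exact Ideal.mul_le_inf.trans (inf_le_inf h h')

theorem finset_inf {κ : Type*} {s : Finset κ} {I : κ → Ideal (Laurent n)}
    (h : ∀ k ∈ s, SupportedOn B (I k)) : SupportedOn B (s.inf I) :=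
  Finset.inf_induction SupportedOn.top (fun _ h _ h' => h.inf h') h

theorem pointIdeal_pow {a : Fin n → ℂˣ} (ha : a ∈ B) (N : ℕ) : SupportedOn B (pointIdeal a ^ N) :=
  ⟨Multiset.replicate N a, fun _ hb => Multiset.eq_of_mem_replicate hb ▸ ha, by
    rw [Multiset.map_replicate, Multiset.prod_replicate]⟩

theorem exists_eq_pointIdeal (h : SupportedOn B J) {P : Ideal (Laurent n)} (hP : P.IsPrime)
    (hJ : J ≤ P) : ∃ a ∈ B, P = pointIdeal a := by
  obtain ⟨s, hs, h⟩ := h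
  obtain ⟨a, ha, hle⟩ := (hP.multiset_prod_map_le pointIdeal).mp (h.trans hJ)
  exact ⟨a, hs a ha, (Ideal.IsMaximal.eq_of_le inferInstance hP.ne_top hle).symm⟩

theorem isCoprime {B' : Set (Fin n → ℂˣ)} (hB : Disjoint B B') (h : SupportedOn B J)
    (h' : SupportedOn B' J') : IsCoprime J J' := by
  rw [Ideal.isCoprime_iff_sup_eq]
  by_contra hne
  obtain ⟨P, hP, hle⟩ := Ideal.exists_le_maximal _ hne
  obtain ⟨a, ha, rfl⟩ := h.exists_eq_pointIdeal hP.isPrime (le_sup_left.trans hle)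
  obtain ⟨b, hb, hab⟩ := h'.exists_eq_pointIdeal hP.isPrime (le_sup_right.trans hle)
  exact hB.notMem_of_mem_left ha (pointIdeal_injective hab ▸ hb)

theorem finite_quotient (h : SupportedOn B J) : Module.Finite ℂ (Laurent n ⧸ J) := by
  rw [Module.finite_iff_krullDimLE_zero, Ring.krullDimLE_zero_iff]
  intro P hP
  have le_comap : J ≤ P.comap (Ideal.Quotient.mk J) := fun x hx => by
    rw [Ideal.mem_comap, Ideal.Quotient.eq_zero_iff_mem.mpr hx]
    exact zero_mem _
  obtain ⟨a, -, ha⟩ := h.exists_eq_pointIdeal (hP.comap _) le_comap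
  have comap_isMaximal : (P.comap (Ideal.Quotient.mk J)).IsMaximal := ha ▸ inferInstance
  have map_comap := Ideal.map_comap_of_surjective _ Ideal.Quotient.mk_surjective P
  rw [← map_comap]
  exact (Ideal.map_eq_top_or_isMaximal_of_surjective _ Ideal.Quotient.mk_surjective
    comap_isMaximal).resolve_left (map_comap.symm ▸ hP.ne_top)

end SupportedOn

variable {B : Set (Fin n → ℂˣ)}

theorem IsExpPolyOn.supportedOn {φ : Laurent n →ₗ[ℂ] ℂ}
    (h : IsExpPolyOn B fun m => φ (mono m)) : SupportedOn B (kernelIdeal φ) := by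
  obtain ⟨p, hp, hφ⟩ := h
  choose φ' hφ' N hN using exists_functional_pow_eq_zero (n := n)
  have φ_eq : φ = ∑ a ∈ p.support, φ' a (p a) := laurent_hom_ext fun m => by
    simp only [hφ, LinearMap.sum_apply, hφ', Finsupp.sum]
  refine (SupportedOn.finset_inf (s := p.support) (I := fun a => pointIdeal a ^ N a (p a))
    fun a ha => SupportedOn.pointIdeal_pow (hp ha) _).mono (le_kernelIdeal fun x hx => ?_)
  rw [φ_eq, LinearMap.sum_apply]
  exact Finset.sum_eq_zero fun a ha => hN a (p a) x (Finset.inf_le (f := fun a =>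
    pointIdeal a ^ N a (p a)) ha hx)

theorem IsExpPolyOn.add {f f' : (Fin n → ℤ) → ℂ} (h : IsExpPolyOn B f) (h' : IsExpPolyOn B f') :
    IsExpPolyOn B (fun m => f m + f' m) := by
  classical
  obtain ⟨p, hp, hf⟩ := h
  obtain ⟨p', hp', hf'⟩ := h'
  refine ⟨p + p', ?_, fun m => ?_⟩
  · refine (Finset.coe_subset.mpr Finsupp.support_add).trans ?_
    rw [Finset.coe_union]
    exact Set.union_subset hp hp'
  · rw [Finsupp.sum_add_index' (by simp) (by intros; rw [map_add, add_mul]), ← hf, ← hf']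

theorem IsExpPolyOn.mono {B' : Set (Fin n → ℂˣ)} {f : (Fin n → ℤ) → ℂ}
    (h : IsExpPolyOn B f) (hB : B ⊆ B') : IsExpPolyOn B' f :=
  let ⟨p, hp, hf⟩ := h
  ⟨p, hp.trans hB, hf⟩

theorem expo_mul (a b : Fin n → ℂˣ) (m : Fin n → ℤ) : expo (a * b) m = expo a m * expo b m := by
  simp [expo, mul_zpow, Finset.prod_mul_distrib]

theorem IsExpPolyOn.twist {f : (Fin n → ℤ) → ℂ} (h : IsExpPolyOn B f)
    (a : Fin n → ℂˣ) : IsExpPolyOn ((a * ·) '' B) (fun m => (expo a m : ℂ) * f m) := by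
  classical
  obtain ⟨p, hp, hf⟩ := h
  refine ⟨p.mapDomain (a * ·), ?_, fun m => ?_⟩
  · refine (Finset.coe_subset.mpr Finsupp.mapDomain_support).trans ?_
    rw [Finset.coe_image]
    exact Set.image_mono hp
  · rw [Finsupp.sum_mapDomain_index (by simp) (by intros; rw [map_add, add_mul])]
    beta_reduce
    rw [hf, Finsupp.mul_sum]
    refine Finsupp.sum_congr fun b _ => ?_
    rw [expo_mul, Units.val_mul]
    ring

end

namespace KacMoody

variable {ι g : Type*} [Fintype ι] [DecidableEq ι] {C : Matrix ι ι ℤ} [LieRing g] [LieAlgebra ℂ g]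
  (K : KacMoody C g) {n : ℕ} {Ψ : Module.Dual ℂ (K.loopCartan n)}

theorem finiteDimensional_cartan' : FiniteDimensional ℂ K.cartan' :=
  have := K.finite_cartan
  Submodule.finiteDimensional_of_le inf_le_left

theorem killer_supportedOn {B : Set (Fin n → ℂˣ)}
    (h : ∀ x : K.cartan', IsExpPolyOn B fun m => Ψ (K.cartanMono x m)) :
    SupportedOn B (K.killer Ψ) := by
  have := K.finiteDimensional_cartan'
  let b := Module.finBasis ℂ K.cartan'
  let I j := kernelIdeal ((K.cartanPairing Ψ).flip (b j))
  refine (SupportedOn.finset_inf (s := Finset.univ) (I := I) fun j _ =>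
    IsExpPolyOn.supportedOn (h (b j))).mono (le_kernelIdeal fun p hp => b.ext fun j => ?_)
  exact apply_eq_zero_of_mem_kernelIdeal (Finset.inf_le (f := I) (Finset.mem_univ j) hp)

end KacMoody

/-! ### Characters of irreducible highest weight modules -/

section AddFiber

variable {J₁ J₂ D : Type*} [AddMonoid D] [Finset.HasAntidiagonal D] (d₁ : J₁ → D)
  (d₂ : J₂ → D) (δ : D)

/-- The fibre of `(i, j) ↦ d₁ i + d₂ j` over `δ`, split according to the values of `d₁` and
`d₂`. -/
def addFiberEquiv : {p : J₁ × J₂ // d₁ p.1 + d₂ p.2 = δ} ≃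
    Σ x : Finset.HasAntidiagonal.antidiagonal δ, {j // d₁ j = x.1.1} × {j // d₂ j = x.1.2} where
  toFun p := ⟨⟨(d₁ p.1.1, d₂ p.1.2), Finset.HasAntidiagonal.mem_antidiagonal.mpr p.2⟩,
    ⟨p.1.1, rfl⟩, ⟨p.1.2, rfl⟩⟩
  invFun x := ⟨(x.2.1.1, x.2.2.1), by
    rw [x.2.1.2, x.2.2.2]; exact Finset.HasAntidiagonal.mem_antidiagonal.mp x.1.2⟩
  right_inv := by
    rintro ⟨⟨⟨_, _⟩, _⟩, ⟨_, h₁⟩, ⟨_, h₂⟩⟩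
    dsimp only at h₁ h₂
    subst h₁ h₂
    rfl

variable [∀ δ, Finite {j // d₁ j = δ}] [∀ δ, Finite {j // d₂ j = δ}]

theorem finite_add_fiber : Finite {p : J₁ × J₂ // d₁ p.1 + d₂ p.2 = δ} :=
  .of_equiv _ (addFiberEquiv d₁ d₂ δ).symm

theorem natCard_add_fiber : Nat.card {p : J₁ × J₂ // d₁ p.1 + d₂ p.2 = δ} =
    ∑ x ∈ Finset.HasAntidiagonal.antidiagonal δ,
      Nat.card {j // d₁ j = x.1} * Nat.card {j // d₂ j = x.2} := by
  rw [Nat.card_congr (addFiberEquiv d₁ d₂ δ), Nat.card_sigma]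
  simp only [Nat.card_prod]
  exact Finset.sum_coe_sort (Finset.HasAntidiagonal.antidiagonal δ)
    fun x => Nat.card {j // d₁ j = x.1} * Nat.card {j // d₂ j = x.2}

end AddFiber

theorem exists_finset_sup_span_eq_top {R M : Type*} [Ring R] [AddCommGroup M] [Module R M]
    (N : Submodule R M) [Module.Finite R (M ⧸ N)] :
    ∃ G : Finset M, N ⊔ Submodule.span R G = ⊤ := by
  obtain ⟨S, hS⟩ := Module.Finite.fg_top (R := R) (M := M ⧸ N)
  classical
  obtain ⟨G, -, rfl⟩ := Finset.subset_set_image_iff.mp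
    (show (S : Set (M ⧸ N)) ⊆ N.mkQ '' Set.univ from fun x _ => by
      rw [Set.image_univ]; exact N.mkQ_surjective x)
  refine ⟨G, ?_⟩
  rwa [Finset.coe_image, ← Submodule.map_span, Submodule.map_mkQ_eq_top] at hS

theorem iInf_eigenspace_eq_span {R M X J : Type*} [CommRing R] [IsDomain R] [AddCommGroup M]
    [Module R M] {T : X → Module.End R M} (b : Module.Basis J R M) {wt : J → X → R}
    (hb : ∀ j x, T x (b j) = wt j x • b j) (μ : X → R) :
    ⨅ x, (T x).eigenspace (μ x) = Submodule.span R (b '' {j | wt j = μ}) := by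
  apply le_antisymm
  · intro v hv
    refine (Module.Basis.mem_span_image b).mpr fun j hj => funext fun x => ?_
    have hcoord : b.coord j ∘ₗ T x = wt j x • b.coord j := by
      classical
      refine b.ext fun k => ?_
      rw [LinearMap.comp_apply, hb, map_smul, LinearMap.smul_apply, b.coord_apply,
        b.repr_self, Finsupp.single_apply]
      split_ifs with h
      · rw [h]
      · rw [smul_zero, smul_zero]
    have hv' := LinearMap.congr_fun hcoord v
    rw [LinearMap.comp_apply, Module.End.mem_eigenspace_iff.mp ((Submodule.mem_iInf _).mp hv x),
      map_smul, LinearMap.smul_apply, smul_eq_mul, smul_eq_mul] at hv'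
    exact (mul_right_cancel₀ (Finsupp.mem_support_iff.mp hj) hv').symm
  · rw [Submodule.span_le]
    rintro _ ⟨j, rfl, rfl⟩
    exact (Submodule.mem_iInf _).mpr fun x => Module.End.mem_eigenspace_iff.mpr (hb j x)

namespace KacMoody

/-- The number of lowering operators of each type in a word. -/
def content {ι P : Type*} (l : List (ι × P)) : ι →₀ ℕ := (l.map fun a => Finsupp.single a.1 1).sum

theorem degree_content {ι P : Type*} (l : List (ι × P)) : (content l).degree = l.length := by
  rw [content, map_list_sum, List.map_map,
    show Finsupp.degree ∘ (fun a : ι × P => Finsupp.single a.1 1) = fun _ => 1 from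
      funext fun a => Finsupp.degree_single a.1 1]
  simp only [List.map_const', List.sum_replicate, smul_eq_mul, mul_one]

universe u

variable {ι : Type u} {g : Type*} [Fintype ι] [DecidableEq ι] {C : Matrix ι ι ℤ} [LieRing g]
  [LieAlgebra ℂ g] (K : KacMoody C g) {n : ℕ}

/-- The weight `∑ δ_i α_i`. -/
def rootSum : (ι →₀ ℕ) →ₗ[ℕ] Module.Dual ℂ K.cartan := Finsupp.linearCombination ℕ K.root

theorem rootSum_injective : Function.Injective K.rootSum :=
  K.root_indep.restrict_scalars (R := ℕ) fun a b h => by simpa using h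

section

variable (Ψ : Module.Dual ℂ (K.loopCartan n))

/-- The restriction of `Ψ` to `𝔥`. -/
def topWeight : Module.Dual ℂ K.cartan where
  toFun x := Ψ (K.cartanConst n x)
  map_add' x y := by
    rw [← map_add]
    exact congrArg Ψ (Subtype.ext (TensorProduct.tmul_add _ (x : g) y))
  map_smul' c x := by
    rw [← map_smul]
    exact congrArg Ψ (Subtype.ext (TensorProduct.tmul_smul c _ (x : g)))

theorem topWeight_add (Ψ₁ Ψ₂ : Module.Dual ℂ (K.loopCartan n)) :
    K.topWeight (Ψ₁ + Ψ₂) = K.topWeight Ψ₁ + K.topWeight Ψ₂ := rfl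

/-- The weight `Ψ|_𝔥 - ∑ δ_i α_i`; all weights of `V(Ψ)` have this form. -/
def weightAt (δ : ι →₀ ℕ) : Module.Dual ℂ K.cartan := K.topWeight Ψ - K.rootSum δ

theorem weightAt_injective : Function.Injective (K.weightAt Ψ) := fun _ _ h =>
  K.rootSum_injective (sub_right_injective h)

theorem weightAt_add (Ψ₁ Ψ₂ : Module.Dual ℂ (K.loopCartan n)) (δ₁ δ₂ : ι →₀ ℕ) :
    K.weightAt (Ψ₁ + Ψ₂) (δ₁ + δ₂) = K.weightAt Ψ₁ δ₁ + K.weightAt Ψ₂ δ₂ := by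
  rw [weightAt, weightAt, weightAt, map_add, topWeight_add]
  abel

/-- The character of `V(Ψ)`, as the power series `∑_δ dim V(Ψ)_{Ψ - ∑ δ_i α_i} X^δ` in
`X_i = e^{-α_i}`. -/
def charSeries : MvPowerSeries ι ℕ := fun δ => K.char Ψ (K.weightAt Ψ δ)

end

theorem rootSum_content {P : Type*} (l : List (ι × P)) (x : K.cartan) :
    K.rootSum (content l) x = (l.map fun a => K.root a.1 x).sum := by
  induction l with
  | nil => rw [content, List.map_nil, List.sum_nil, map_zero, LinearMap.zero_apply]; rfl
  | cons a l ih =>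
    rw [content] at ih ⊢
    rw [List.map_cons, List.sum_cons, map_add, LinearMap.add_apply, ih, List.map_cons,
      List.sum_cons, rootSum, Finsupp.linearCombination_single, one_smul]

variable {Ψ : Module.Dual ℂ (K.loopCartan n)} {J V V' : Type*} [AddCommGroup V] [Module ℂ V]
  [LieRingModule (loopAlg g n) V] [AddCommGroup V'] [Module ℂ V'] [LieRingModule (loopAlg g n) V']

variable (Ψ) in
/-- `b` is a basis of weight vectors, the weight of `b j` is `Ψ|_𝔥 - ∑ (deg j)_i α_i`, and each
weight occurs finitely often. -/
structure IsWeightBasis (b : Module.Basis J ℂ V) (deg : J → (ι →₀ ℕ)) : Prop where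
  finite : ∀ δ, Finite {j // deg j = δ}
  lie_const : ∀ j (x : K.cartan), ⁅const n (x : g), b j⁆ = K.weightAt Ψ (deg j) x • b j

section

variable {K} {v : V} [LieModule ℂ (loopAlg g n) V] [LieModule.IsIrreducible ℂ (loopAlg g n) V]

theorem IsHighestWeight.span_word_eq_top (hv : K.IsHighestWeight Ψ v) {G : Set (Laurent n)}
    (hG : (K.killer Ψ).restrictScalars ℂ ⊔ Submodule.span ℂ G = ⊤) :
    Submodule.span ℂ (Set.range fun l : List (ι × G) =>
      K.word (l.map fun a => (a.1, (a.2 : Laurent n))) v) = ⊤ := by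
  set W := Submodule.span ℂ (Set.range fun l : List (ι × G) =>
    K.word (l.map fun a => (a.1, (a.2 : Laurent n))) v)
  have lie_mem_of_mem_span (i : ι) {q : Laurent n} (hq : q ∈ Submodule.span ℂ G) {w : V}
      (hw : w ∈ W) : ⁅K.F i q, w⁆ ∈ W := by
    induction hq using Submodule.span_induction with
    | mem q hq =>
      refine lie_mem_of_mem_span ?_ hw
      rintro _ ⟨l, rfl⟩
      exact Submodule.subset_span ⟨(i, ⟨q, hq⟩) :: l, rfl⟩
    | zero =>
      rw [← zero_smul ℂ (0 : Laurent n), F_smul, zero_smul, zero_lie]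
      exact zero_mem _
    | add q q' _ _ h h' => rw [F_add, add_lie]; exact add_mem h h'
    | smul c q _ h => rw [F_smul, smul_lie]; exact W.smul_mem c h
  have lie_mem (i : ι) (p : Laurent n) {w : V} (hw : w ∈ W) : ⁅K.F i p, w⁆ ∈ W := by
    obtain ⟨q', hq', q, hq, rfl⟩ := Submodule.mem_sup.mp (hG.ge (Submodule.mem_top (x := p)))
    have hkill : ⁅K.F i q', w⁆ = 0 := hv.lie_loopElt_eq_zero hq' ⟨K.f i, K.f_mem_derived i⟩ w
    rw [F_add, add_lie, hkill, zero_add]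
    exact lie_mem_of_mem_span i hq hw
  refine eq_top_iff.mpr fun w _ => hv.mem_of_word_mem (fun l => ?_) w
  induction l with
  | nil => exact Submodule.subset_span ⟨[], rfl⟩
  | cons a l ih => exact lie_mem _ _ ih

theorem IsHighestWeight.exists_isWeightBasis [Module.Finite ℂ (Laurent n ⧸ K.killer Ψ)]
    (hv : K.IsHighestWeight Ψ v) :
    ∃ (J : Type u) (b : Module.Basis J ℂ V) (deg : J → (ι →₀ ℕ)), K.IsWeightBasis Ψ b deg := by
  have : Module.Finite ℂ (Laurent n ⧸ (K.killer Ψ).restrictScalars ℂ) :=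
    inferInstanceAs (Module.Finite ℂ (Laurent n ⧸ K.killer Ψ))
  obtain ⟨G, hG⟩ := exists_finset_sup_span_eq_top ((K.killer Ψ).restrictScalars ℂ)
  obtain ⟨J, l, hl, hspan, hli⟩ := exists_linearIndependent' ℂ fun l : List (ι × G) =>
    K.word (l.map fun a => (a.1, (a.2 : Laurent n))) v
  replace hspan := hspan.trans (hv.span_word_eq_top hG)
  refine ⟨J, Module.Basis.mk hli hspan.ge, fun j => content (l j), fun δ => ?_, fun j x => ?_⟩
  · refine Set.Finite.of_finite_image ((List.finite_length_eq (ι × G) δ.degree).subset ?_) hl.injOn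
    rintro _ ⟨j, rfl, rfl⟩
    exact (degree_content (l j)).symm
  · rw [Module.Basis.mk_apply]
    refine (hv.lie_const_word x _).trans ?_
    rw [weightAt, LinearMap.sub_apply, rootSum_content, List.map_map]
    rfl

end

namespace IsWeightBasis

variable {K} {deg : J → (ι →₀ ℕ)}

theorem map {b : Module.Basis J ℂ V} (hb : K.IsWeightBasis Ψ b deg) (E : V ≃ₗ[ℂ] V')
    (hE : ∀ (x : loopAlg g n) w, E ⁅x, w⁆ = ⁅x, E w⁆) : K.IsWeightBasis Ψ (b.map E) deg where
  finite := hb.finite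
  lie_const j x := by rw [Module.Basis.map_apply, ← hE, hb.lie_const, map_smul]

theorem tensorProduct [LieModule ℂ (loopAlg g n) V] [LieModule ℂ (loopAlg g n) V']
    {Ψ' : Module.Dual ℂ (K.loopCartan n)} {J' : Type*} {deg' : J' → (ι →₀ ℕ)}
    {b : Module.Basis J ℂ V} {b' : Module.Basis J' ℂ V'}
    (hb : K.IsWeightBasis Ψ b deg) (hb' : K.IsWeightBasis Ψ' b' deg') :
    K.IsWeightBasis (Ψ + Ψ') (b.tensorProduct b') fun p => deg p.1 + deg' p.2 where
  finite :=
    have := hb.finite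
    have := hb'.finite
    fun δ => finite_add_fiber deg deg' δ
  lie_const j x := by
    rw [Module.Basis.tensorProduct_apply', TensorProduct.LieModule.lie_tmul_right, hb.lie_const,
      hb'.lie_const, ← TensorProduct.smul_tmul', TensorProduct.tmul_smul, ← add_smul,
      weightAt_add, LinearMap.add_apply]

variable {b : Module.Basis J ℂ (K.simpleMod Ψ)} (hb : K.IsWeightBasis Ψ b deg)

include hb

theorem weightSpace_eq_span (μ : Module.Dual ℂ K.cartan) :
    K.weightSpace Ψ μ = Submodule.span ℂ (b '' {j | K.weightAt Ψ (deg j) = μ}) := by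
  have hμ := iInf_eigenspace_eq_span (X := K.cartan)
    (T := fun x => LieModule.toEnd ℂ (loopAlg g n) (K.simpleMod Ψ) (const n (x : g)))
    b (wt := fun j => K.weightAt Ψ (deg j)) hb.lie_const μ
  simp only [DFunLike.coe_fn_eq] at hμ
  rw [← hμ]
  ext w
  simp only [Submodule.mem_iInf, Module.End.mem_eigenspace_iff]
  rfl

theorem char_eq (μ : Module.Dual ℂ K.cartan) :
    K.char Ψ μ = Nat.card {j // K.weightAt Ψ (deg j) = μ} := by
  rw [char, hb.weightSpace_eq_span, Set.image_eq_range]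
  exact Module.finrank_eq_nat_card_basis
    (.span (b.linearIndependent.comp _ Subtype.val_injective))

theorem exists_eq_weightAt {μ : Module.Dual ℂ K.cartan} (hμ : K.char Ψ μ ≠ 0) :
    ∃ δ, μ = K.weightAt Ψ δ := by
  rw [hb.char_eq] at hμ
  obtain ⟨j, hj⟩ := (Nat.card_ne_zero.mp hμ).1
  exact ⟨_, hj.symm⟩

theorem hasCharacter : K.HasCharacter Ψ := by
  constructor
  · rw [eq_top_iff, ← b.span_eq, Submodule.span_le]
    rintro _ ⟨j, rfl⟩
    exact Submodule.mem_iSup_of_mem (K.weightAt Ψ (deg j)) (hb.lie_const j)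
  · intro μ
    rw [hb.weightSpace_eq_span]
    refine FiniteDimensional.span_of_finite ℂ (Set.Finite.image _ ?_)
    by_cases h : ∃ δ, K.weightAt Ψ δ = μ
    · obtain ⟨δ, rfl⟩ := h
      simp only [(K.weightAt_injective Ψ).eq_iff]
      exact hb.finite δ
    · exact Set.finite_empty.subset fun j hj => h ⟨_, hj⟩

theorem coeff_charSeries (δ : ι →₀ ℕ) :
    MvPowerSeries.coeff δ (K.charSeries Ψ) = Nat.card {j // deg j = δ} := by
  refine (hb.char_eq _).trans ?_
  simp only [(K.weightAt_injective Ψ).eq_iff]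

end IsWeightBasis

variable {K}

section

variable [Module.Finite ℂ (Laurent n ⧸ K.killer Ψ)]

theorem exists_isWeightBasis_simpleMod :
    ∃ (J : Type u) (b : Module.Basis J ℂ (K.simpleMod Ψ)) (deg : J → (ι →₀ ℕ)),
      K.IsWeightBasis Ψ b deg :=
  (K.simple_isHighestWeight Ψ).exists_isWeightBasis

theorem hasCharacter_of_finite : K.HasCharacter Ψ :=
  let ⟨_, _, _, hb⟩ := exists_isWeightBasis_simpleMod (Ψ := Ψ)
  hb.hasCharacter

theorem exists_eq_weightAt {μ : Module.Dual ℂ K.cartan} (hμ : K.char Ψ μ ≠ 0) :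
    ∃ δ, μ = K.weightAt Ψ δ :=
  let ⟨_, _, _, hb⟩ := exists_isWeightBasis_simpleMod (Ψ := Ψ)
  hb.exists_eq_weightAt hμ

end

theorem charSeries_add {Ψ₁ Ψ₂ : Module.Dual ℂ (K.loopCartan n)}
    [Module.Finite ℂ (Laurent n ⧸ K.killer Ψ₁)] [Module.Finite ℂ (Laurent n ⧸ K.killer Ψ₂)]
    (hI : IsCoprime (K.killer Ψ₁) (K.killer Ψ₂)) :
    K.charSeries (Ψ₁ + Ψ₂) = K.charSeries Ψ₁ * K.charSeries Ψ₂ := by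
  obtain ⟨J₁, b₁, d₁, hb₁⟩ := exists_isWeightBasis_simpleMod (Ψ := Ψ₁)
  obtain ⟨J₂, b₂, d₂, hb₂⟩ := exists_isWeightBasis_simpleMod (Ψ := Ψ₂)
  have hv₁ := K.simple_isHighestWeight Ψ₁
  have hv₂ := K.simple_isHighestWeight Ψ₂
  have := hv₁.isIrreducible_tensorProduct hv₂ hI
  obtain ⟨E, hE⟩ := (hv₁.tmul hv₂ hI).exists_equiv
  have hE' (x : loopAlg g n) (w : K.simpleMod Ψ₁ ⊗[ℂ] K.simpleMod Ψ₂) :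
      E.symm ⁅x, w⁆ = ⁅x, E.symm w⁆ := by
    rw [E.symm_apply_eq, ← act_eq_lie, hE, E.apply_symm_apply]
  have := hb₁.finite
  have := hb₂.finite
  ext δ
  rw [((hb₁.tensorProduct hb₂).map E.symm hE').coeff_charSeries, natCard_add_fiber,
    MvPowerSeries.coeff_mul]
  simp only [hb₁.coeff_charSeries, hb₂.coeff_charSeries]

section

variable (a : Fin n → ℂˣ)

theorem char_twistFun : K.char (K.twistFun a Ψ) = K.char Ψ := by
  obtain ⟨E, hE⟩ := K.exists_twist_equiv Ψ a
  funext μ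
  refine (E.ofSubmodules _ _ (Submodule.ext fun w => ?_)).finrank_eq
  rw [Submodule.mem_map_equiv]
  refine forall_congr' fun x : K.cartan => ?_
  rw [← E.injective.eq_iff, hE, map_smul, E.apply_symm_apply, twist_const]

theorem topWeight_twistFun : K.topWeight (K.twistFun a Ψ) = K.topWeight Ψ :=
  LinearMap.ext fun x => congrArg Ψ (Subtype.ext
    (show scaleLie g a (1 ⊗ₜ (x : g)) = 1 ⊗ₜ (x : g) from
      congrArg Subtype.val (twist_const a (x : g))))

theorem charSeries_twistFun : K.charSeries (K.twistFun a Ψ) = K.charSeries Ψ := by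
  funext δ
  rw [charSeries, charSeries, char_twistFun, weightAt, weightAt, topWeight_twistFun]

theorem twistFun_cartanMono (x : K.cartan') (m : Fin n → ℤ) :
    K.twistFun a Ψ (K.cartanMono x m) = (expo a m : ℂ) * Ψ (K.cartanMono x m) := by
  rw [← smul_eq_mul, ← map_smul]
  refine congrArg Ψ (Subtype.ext ?_)
  change scale a (mono m) ⊗ₜ[ℂ] (x : g) = (expo a m : ℂ) • (mono m ⊗ₜ[ℂ] (x : g))
  rw [scale_mono, TensorProduct.smul_tmul']

end

end KacMoody

/-! ### Powers of formal characters -/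

section FormalPow

variable {W ι : Type*} [AddCommGroup W] {χ : W → ℕ} {θ : (ι →₀ ℕ) →+ W} {μ₀ : W}
  (hχ : ∀ μ, χ μ ≠ 0 → ∃ δ, μ = μ₀ - θ δ)

theorem sum_sub_map_eq {R : ℕ} (s : Fin R →₀ (ι →₀ ℕ)) :
    ∑ i, (μ₀ - θ (s i)) = R • μ₀ - θ (∑ i, s i) := by
  rw [map_sum, Finset.sum_sub_distrib, Finset.sum_const, Finset.card_univ, Fintype.card_fin]

include hχ

theorem exists_of_mem_powTerms {R : ℕ} {μ : W} {ν : Fin R → W} (hν : ν ∈ powTerms χ R μ) :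
    ∃ s : Fin R →₀ (ι →₀ ℕ), (fun i => μ₀ - θ (s i)) = ν ∧ R • μ₀ - θ (∑ i, s i) = μ := by
  choose d hd using fun i => hχ (ν i) (Finset.prod_ne_zero_iff.mp hν.2 i (Finset.mem_univ i))
  refine ⟨Finsupp.equivFunOnFinite.symm d, funext fun i => (hd i).symm, ?_⟩
  rw [← hν.1, ← sum_sub_map_eq]
  exact Finset.sum_congr rfl fun i _ => (hd i).symm

theorem exists_of_formalPow_ne_zero {R : ℕ} {μ : W} (hμ : formalPow χ R μ ≠ 0) :
    ∃ δ, R • μ₀ - θ δ = μ := by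
  obtain ⟨ν, hν, -⟩ := exists_ne_zero_of_finsum_mem_ne_zero hμ
  obtain ⟨s, -, hs⟩ := exists_of_mem_powTerms hχ hν
  exact ⟨_, hs⟩

variable (hθ : Function.Injective θ) (R : ℕ)

include hθ

theorem powTerms_subset_image [DecidableEq ι] (δ : ι →₀ ℕ) : powTerms χ R (R • μ₀ - θ δ) ⊆
    (fun (s : Fin R →₀ (ι →₀ ℕ)) i => μ₀ - θ (s i)) ''
      ↑((Finset.univ : Finset (Fin R)).finsuppAntidiag δ) := by
  intro ν hν
  obtain ⟨s, rfl, hs⟩ := exists_of_mem_powTerms hχ hν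
  exact ⟨s, Finset.mem_finsuppAntidiag.mpr ⟨hθ (sub_right_injective hs), Finset.subset_univ _⟩, rfl⟩

theorem powTerms_finite (μ : W) : (powTerms χ R μ).Finite := by
  classical
  obtain h | ⟨ν, hν⟩ := (powTerms χ R μ).eq_empty_or_nonempty
  · exact h ▸ Set.finite_empty
  · obtain ⟨s, -, rfl⟩ := exists_of_mem_powTerms hχ hν
    exact ((Finset.finite_toSet _).image _).subset (powTerms_subset_image hχ hθ R _)

theorem formalPow_eq_coeff {P : MvPowerSeries ι ℕ}
    (hP : ∀ δ, MvPowerSeries.coeff δ P = χ (μ₀ - θ δ)) (δ : ι →₀ ℕ) :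
    formalPow χ R (R • μ₀ - θ δ) = MvPowerSeries.coeff δ (P ^ R) := by
  classical
  let F (s : Fin R →₀ (ι →₀ ℕ)) (i : Fin R) : W := μ₀ - θ (s i)
  have hF : Function.Injective F := fun s s' h =>
    Finsupp.ext fun i => hθ (sub_right_injective (congrFun h i))
  have terms_eq : powTerms χ R (R • μ₀ - θ δ) ∩ Function.support (fun ν => ∏ i, χ (ν i)) =
      F '' ↑((Finset.univ : Finset (Fin R)).finsuppAntidiag δ) ∩
        Function.support fun ν => ∏ i, χ (ν i) := by
    refine (Set.inter_subset_inter_left _ (powTerms_subset_image hχ hθ R δ)).antisymm ?_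
    rintro _ ⟨⟨s, hs, rfl⟩, hprod⟩
    refine ⟨⟨?_, hprod⟩, hprod⟩
    rw [sum_sub_map_eq, (Finset.mem_finsuppAntidiag.mp hs).1]
  rw [formalPow, finsum_mem_inter_support_eq _ _ _ terms_eq, finsum_mem_image hF.injOn,
    finsum_mem_coe_finset, ← Fin.prod_const, MvPowerSeries.coeff_prod]
  simp only [hP, F]

end FormalPow

/-! ### The character formula -/

section

variable {n : ℕ}

theorem IsExpPolyOn.sum {κ : Type*} {T : Finset κ} {B : κ → Set (Fin n → ℂˣ)}
    {f : κ → (Fin n → ℤ) → ℂ} (h : ∀ k ∈ T, IsExpPolyOn (B k) (f k)) :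
    IsExpPolyOn (⋃ k ∈ T, B k) fun m => ∑ k ∈ T, f k m := by
  induction T using Finset.cons_induction with
  | empty => exact ⟨0, by simp, fun m => Finset.sum_empty.trans Finsupp.sum_zero_index.symm⟩
  | cons k T hk ih =>
    simp only [Finset.sum_cons]
    rw [Finset.forall_mem_cons] at h
    exact (h.1.mono (Set.subset_biUnion_of_mem (u := B) (Finset.mem_cons_self k T))).add
      ((ih h.2).mono (Set.biUnion_subset_biUnion_left fun _ => Finset.mem_cons_of_mem))

variable {r : Fin n → ℕ} {ξ : Fin n → ℂˣ} (hξ : ∀ i, IsPrimitiveRoot (ξ i) (r i))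

include hξ

theorem rootTuple_injective : Function.Injective (rootTuple (r := r) ξ) := fun k k' h =>
  funext fun i => Fin.ext ((hξ i).pow_inj (k i).2 (k' i).2 (congrFun h i))

theorem rootTuple_add [∀ i, NeZero (r i)] (k k' : (i : Fin n) → Fin (r i)) :
    rootTuple ξ (k + k') = rootTuple ξ k * rootTuple ξ k' := by
  funext i
  rw [rootTuple, Pi.mul_apply, rootTuple, rootTuple, ← pow_add, Pi.add_apply, Fin.val_add]
  exact (pow_eq_pow_mod _ (hξ i).pow_eq_one).symm

theorem expo_rootTuple_of_dvd (k : (i : Fin n) → Fin (r i)) {m : Fin n → ℤ}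
    (hm : ∀ i, (r i : ℤ) ∣ m i) : expo (rootTuple ξ k) m = 1 :=
  Finset.prod_eq_one fun i _ => by
    obtain ⟨c, hc⟩ := hm i
    rw [rootTuple, hc, zpow_mul, zpow_natCast, pow_right_comm, (hξ i).pow_eq_one, one_pow, one_zpow]

theorem scale_eq_of_mem_subLaurent (k : (i : Fin n) → Fin (r i)) {p : Laurent n}
    (hp : p ∈ subLaurent r) : scale (rootTuple ξ k) p = p := by
  have : subLaurent r ≤ AlgHom.equalizer (scale (rootTuple ξ k)) (AlgHom.id ℂ (Laurent n)) := by
    refine Algebra.adjoin_le ?_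
    rintro _ ⟨m, hm, rfl⟩
    change scale (rootTuple ξ k) (mono m) = mono m
    rw [scale_mono, expo_rootTuple_of_dvd hξ k hm, Units.val_one, one_smul]
  exact this hp

theorem sum_expo_rootTuple_mul (m : Fin n → ℤ) (k' : (i : Fin n) → Fin (r i)) :
    (∑ k : (i : Fin n) → Fin (r i), (expo (rootTuple ξ k) m : ℂ)) * expo (rootTuple ξ k') m =
      ∑ k : (i : Fin n) → Fin (r i), (expo (rootTuple ξ k) m : ℂ) := by
  have (i : Fin n) : NeZero (r i) := ⟨(k' i).pos.ne'⟩
  rw [Finset.sum_mul]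
  refine Fintype.sum_equiv (Equiv.addRight k') _ _ fun k => ?_
  rw [Equiv.coe_addRight, rootTuple_add hξ, expo_mul, Units.val_mul]

end

namespace IsTransversal

variable {n : ℕ} {r : Fin n → ℕ} {ξ : Fin n → ℂˣ} {B : Set (Fin n → ℂˣ)}
  (hB : IsTransversal r ξ B)

/-- The representative in `B` of the orbit of `a`. -/
def rep (a : Fin n → ℂˣ) : Fin n → ℂˣ := (hB a).choose

theorem rep_mem (a : Fin n → ℂˣ) : hB.rep a ∈ B := (hB a).choose_spec.1.1

theorem exists_eq_rootTuple_mul_rep (a : Fin n → ℂˣ) :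
    ∃ k : (i : Fin n) → Fin (r i), a = rootTuple ξ k * hB.rep a := (hB a).choose_spec.1.2

include hB

theorem pos (i : Fin n) : 0 < r i :=
  let ⟨k, _⟩ := hB.exists_eq_rootTuple_mul_rep 1
  (k i).pos

theorem pairwise_disjoint (hξ : ∀ i, IsPrimitiveRoot (ξ i) (r i)) :
    Pairwise (Function.onFun Disjoint fun k : (i : Fin n) → Fin (r i) =>
      (rootTuple ξ k * ·) '' B) := by
  intro k k' hk
  refine Set.disjoint_left.mpr ?_
  rintro a ⟨b, hb, hab⟩ ⟨b', hb', hab'⟩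
  obtain rfl : b = b' := (hB a).unique ⟨hb, k, hab.symm⟩ ⟨hb', k', hab'.symm⟩
  exact hk (rootTuple_injective hξ (mul_right_cancel (hab.trans hab'.symm)))

end IsTransversal

section

variable {ι g : Type*} [Fintype ι] [DecidableEq ι] {C : Matrix ι ι ℤ} [LieRing g] [LieAlgebra ℂ g]
  {K : KacMoody C g} {n : ℕ}

namespace KacMoody

theorem finite_quotient_killer {Ψ : Module.Dual ℂ (K.loopCartan n)} {B : Set (Fin n → ℂˣ)}
    (h : ∀ x : K.cartan', IsExpPolyOn B fun m => Ψ (K.cartanMono x m)) :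
    Module.Finite ℂ (Laurent n ⧸ K.killer Ψ) :=
  (K.killer_supportedOn h).finite_quotient

theorem charSeries_sum {κ : Type*} {T : Finset κ} (hT : T.Nonempty)
    {Ψ : κ → Module.Dual ℂ (K.loopCartan n)} {B : κ → Set (Fin n → ℂˣ)}
    (hB : Pairwise (Function.onFun Disjoint B))
    (h : ∀ k, ∀ x : K.cartan', IsExpPolyOn (B k) fun m => Ψ k (K.cartanMono x m)) :
    K.charSeries (∑ k ∈ T, Ψ k) = ∏ k ∈ T, K.charSeries (Ψ k) := by
  induction hT using Finset.Nonempty.cons_induction with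
  | singleton k => rw [Finset.sum_singleton, Finset.prod_singleton]
  | cons k T hk _ ih =>
    have h' (x : K.cartan') :
        IsExpPolyOn (⋃ k ∈ T, B k) fun m => (∑ k ∈ T, Ψ k) (K.cartanMono x m) := by
      simp only [LinearMap.sum_apply]
      exact .sum fun k _ => h k x
    have := finite_quotient_killer (h k)
    have := finite_quotient_killer h'
    have hdisj : Disjoint (B k) (⋃ k ∈ T, B k) :=
      Set.disjoint_iUnion₂_right.mpr fun k' hk' => hB (ne_of_mem_of_not_mem hk' hk).symm
    rw [Finset.sum_cons, Finset.prod_cons, ← ih,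
      charSeries_add ((K.killer_supportedOn (h k)).isCoprime hdisj (K.killer_supportedOn h'))]

theorem topWeight_sum_twistFun {κ : Type*} (T : Finset κ) (a : κ → Fin n → ℂˣ)
    (Φ : Module.Dual ℂ (K.loopCartan n)) :
    K.topWeight (∑ k ∈ T, K.twistFun (a k) Φ) = T.card • K.topWeight Φ := by
  rw [← Finset.sum_const, ← Finset.sum_congr rfl fun k _ => topWeight_twistFun (Ψ := Φ) (a k)]
  ext x
  rw [LinearMap.sum_apply]
  exact LinearMap.sum_apply _ _ _

end KacMoody

theorem card_pi_fin {n : ℕ} (r : Fin n → ℕ) :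
    (Finset.univ : Finset ((i : Fin n) → Fin (r i))).card = ∏ i, r i := by
  simp only [Finset.card_univ, Fintype.card_pi, Fintype.card_fin]

namespace IsDecomposition

variable {r : Fin n → ℕ} {ξ : Fin n → ℂˣ} {B : Set (Fin n → ℂˣ)}
  {ψ Φ : Module.Dual ℂ (K.loopCartan n)} (h : IsDecomposition K r ξ B ψ Φ)

include h

theorem topWeight_eq : K.topWeight ψ = (∏ i, r i) • K.topWeight Φ := by
  rw [h.2, KacMoody.topWeight_sum_twistFun, card_pi_fin]

theorem isExpPolyOn_twistFun (k : (i : Fin n) → Fin (r i)) (x : K.cartan') :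
    IsExpPolyOn ((rootTuple ξ k * ·) '' B)
      fun m => K.twistFun (rootTuple ξ k) Φ (K.cartanMono x m) := by
  simp only [KacMoody.twistFun_cartanMono]
  exact (h.1 x).twist _

theorem finite_quotient_killer : Module.Finite ℂ (Laurent n ⧸ K.killer ψ) :=
  KacMoody.finite_quotient_killer
    (B := ⋃ k ∈ (Finset.univ : Finset ((i : Fin n) → Fin (r i))), (rootTuple ξ k * ·) '' B)
    fun x => by
      simp only [h.2, LinearMap.sum_apply]
      exact .sum fun k _ => h.isExpPolyOn_twistFun k x

theorem hasCharacter_left : K.HasCharacter ψ :=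
  have := h.finite_quotient_killer
  KacMoody.hasCharacter_of_finite

theorem hasCharacter_right : K.HasCharacter Φ :=
  have := KacMoody.finite_quotient_killer h.1
  KacMoody.hasCharacter_of_finite

theorem exists_eq_of_char_ne_zero (μ : Module.Dual ℂ K.cartan) (hμ : K.char Φ μ ≠ 0) :
    ∃ δ, μ = K.topWeight Φ - K.rootSum.toAddMonoidHom δ :=
  have := KacMoody.finite_quotient_killer h.1
  KacMoody.exists_eq_weightAt hμ

theorem powTerms_finite (R : ℕ) (μ : Module.Dual ℂ K.cartan) : (powTerms (K.char Φ) R μ).Finite :=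
  LoopKM.powTerms_finite h.exists_eq_of_char_ne_zero K.rootSum_injective R μ

variable (hξ : ∀ i, IsPrimitiveRoot (ξ i) (r i)) (hB : IsTransversal r ξ B)

include hξ hB

theorem charSeries_eq : K.charSeries ψ = K.charSeries Φ ^ ∏ i, r i := by
  have (i : Fin n) : Nonempty (Fin (r i)) := ⟨⟨0, hB.pos i⟩⟩
  rw [h.2, KacMoody.charSeries_sum Finset.univ_nonempty (hB.pairwise_disjoint hξ)
    h.isExpPolyOn_twistFun]
  simp only [KacMoody.charSeries_twistFun, Finset.prod_const, card_pi_fin]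

theorem char_eq_formalPow : K.char ψ = formalPow (K.char Φ) (∏ i, r i) := by
  have := h.finite_quotient_killer
  funext μ
  by_cases hμ : ∃ δ, μ = K.weightAt ψ δ
  · obtain ⟨δ, rfl⟩ := hμ
    calc K.char ψ (K.weightAt ψ δ)
        = MvPowerSeries.coeff δ (K.charSeries ψ) := rfl
      _ = MvPowerSeries.coeff δ (K.charSeries Φ ^ ∏ i, r i) := by rw [h.charSeries_eq hξ hB]
      _ = formalPow (K.char Φ) (∏ i, r i) ((∏ i, r i) • K.topWeight Φ - K.rootSum δ) :=
        (formalPow_eq_coeff h.exists_eq_of_char_ne_zero K.rootSum_injective _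
          (fun _ => rfl) δ).symm
      _ = formalPow (K.char Φ) (∏ i, r i) (K.weightAt ψ δ) := by
        rw [KacMoody.weightAt, h.topWeight_eq]
  · have hψ : K.char ψ μ = 0 := not_not.mp fun h0 => hμ (KacMoody.exists_eq_weightAt h0)
    refine hψ.trans (not_not.mp fun h0 => hμ ?_)
    obtain ⟨δ, hδ⟩ := exists_of_formalPow_ne_zero h.exists_eq_of_char_ne_zero (Ne.symm h0)
    exact ⟨δ, by rw [← hδ, KacMoody.weightAt, h.topWeight_eq]; rfl⟩

end IsDecomposition

end

/-! ### Existence of the decomposition -/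

section

variable {n : ℕ}

/-- The exp-polynomial function `m ↦ ∑_λ p_λ(m) λ^m` with coefficients `p`, as a linear
function of `p`. -/
def expPoly : ((Fin n → ℂˣ) →₀ MvPolynomial (Fin n) ℂ) →ₗ[ℂ] (Fin n → ℤ) → ℂ :=
  Finsupp.lsum ℂ fun a => LinearMap.pi fun m =>
    (expo a m : ℂ) • (MvPolynomial.aeval fun i => (m i : ℂ)).toLinearMap

theorem expPoly_apply (p : (Fin n → ℂˣ) →₀ MvPolynomial (Fin n) ℂ) (m : Fin n → ℤ) :
    expPoly p m = p.sum fun a q => MvPolynomial.eval (fun i => (m i : ℂ)) q * (expo a m : ℂ) := by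
  rw [expPoly, Finsupp.lsum_apply, Finsupp.sum, Finset.sum_apply]
  refine Finset.sum_congr rfl fun a _ => ?_
  rw [LinearMap.pi_apply, LinearMap.smul_apply, smul_eq_mul, mul_comm]
  rfl

theorem mono_ne_zero (m : Fin n → ℤ) : (mono m : Laurent n) ≠ 0 := fun h => by
  have heval := evalPoint_mono 1 m
  rw [h, map_zero] at heval
  exact (expo (1 : Fin n → ℂˣ) m).ne_zero heval.symm

theorem sum_expo_mul_expPoly_rep {r : Fin n → ℕ} {ξ : Fin n → ℂˣ}
    (hξ : ∀ i, IsPrimitiveRoot (ξ i) (r i)) {B : Set (Fin n → ℂˣ)} (hB : IsTransversal r ξ B)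
    (p : (Fin n → ℂˣ) →₀ MvPolynomial (Fin n) ℂ) (m : Fin n → ℤ) :
    (∑ k : (i : Fin n) → Fin (r i), (expo (rootTuple ξ k) m : ℂ)) *
        expPoly (p.mapDomain hB.rep) m =
      (∑ k : (i : Fin n) → Fin (r i), (expo (rootTuple ξ k) m : ℂ)) * expPoly p m := by
  rw [expPoly_apply, expPoly_apply,
    Finsupp.sum_mapDomain_index (by simp) (by intros; rw [map_add, add_mul]), Finsupp.mul_sum,
    Finsupp.mul_sum]
  refine Finsupp.sum_congr fun a _ => ?_
  obtain ⟨k, hk⟩ := hB.exists_eq_rootTuple_mul_rep a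
  have hexpo : expo a m = expo (rootTuple ξ k) m * expo (hB.rep a) m := by
    rw [← expo_mul, ← hk]
  rw [hexpo, Units.val_mul, mul_left_comm, mul_left_comm _ (MvPolynomial.eval _ _),
    ← mul_assoc _ (expo (rootTuple ξ k) m : ℂ), sum_expo_rootTuple_mul hξ]

end

namespace KacMoody

variable {ι g : Type*} [Fintype ι] [DecidableEq ι] {C : Matrix ι ι ℤ} [LieRing g] [LieAlgebra ℂ g]
  {K : KacMoody C g} {n : ℕ}

theorem exists_linear_expPoly_eq {ψ : Module.Dual ℂ (K.loopCartan n)}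
    (hψ : ∀ x : K.cartan', IsExpPolyOn Set.univ fun m => ψ (K.cartanMono x m)) :
    ∃ P : K.cartan' →ₗ[ℂ] (Fin n → ℂˣ) →₀ MvPolynomial (Fin n) ℂ,
      ∀ x m, expPoly (P x) m = ψ (K.cartanMono x m) := by
  let T : K.cartan' →ₗ[ℂ] (Fin n → ℤ) → ℂ := LinearMap.pi fun m => K.cartanPairing ψ (mono m)
  have hT (x : K.cartan') : T x ∈ LinearMap.range (expPoly (n := n)) := by
    obtain ⟨p, -, hp⟩ := hψ x
    exact ⟨p, funext fun m => (expPoly_apply p m).trans (hp m).symm⟩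
  obtain ⟨P, hP⟩ := Module.projective_lifting_property (expPoly (n := n)).rangeRestrict
    (T.codRestrict _ hT) (LinearMap.surjective_rangeRestrict _)
  exact ⟨P, fun x m => congrFun (congrArg Subtype.val (LinearMap.congr_fun hP x)) m⟩

section

variable {r : Fin n → ℕ} {ξ : Fin n → ℂˣ} (hξ : ∀ i, IsPrimitiveRoot (ξ i) (r i))
  {ψ : Module.Dual ℂ (K.loopCartan n)} (hA : K.imageAlg ψ ≤ subLaurent r)

include hξ hA

theorem expo_rootTuple_mul_apply (k : (i : Fin n) → Fin (r i)) (x : K.cartan') (m : Fin n → ℤ) :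
    (expo (rootTuple ξ k) m : ℂ) * ψ (K.cartanMono x m) = ψ (K.cartanMono x m) := by
  have hscale := scale_eq_of_mem_subLaurent hξ k (hA (Algebra.subset_adjoin ⟨x, m, rfl⟩))
  rw [map_smul, scale_mono, smul_smul] at hscale
  rw [mul_comm]
  exact smul_left_injective ℂ (mono_ne_zero m) hscale

theorem exists_linear_expPoly_sum_eq {B : Set (Fin n → ℂˣ)} (hB : IsTransversal r ξ B)
    (hψ : ∀ x : K.cartan', IsExpPolyOn Set.univ fun m => ψ (K.cartanMono x m)) :
    ∃ P : K.cartan' →ₗ[ℂ] (Fin n → ℂˣ) →₀ MvPolynomial (Fin n) ℂ,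
      (∀ x, ((P x).support : Set (Fin n → ℂˣ)) ⊆ B) ∧
      ∀ x m, (∑ k : (i : Fin n) → Fin (r i), (expo (rootTuple ξ k) m : ℂ)) * expPoly (P x) m =
        ψ (K.cartanMono x m) := by
  classical
  obtain ⟨P, hP⟩ := exists_linear_expPoly_eq hψ
  set R : ℂ := ((∏ i, r i : ℕ) : ℂ)
  have hR : R ≠ 0 := Nat.cast_ne_zero.mpr (Finset.prod_ne_zero_iff.mpr fun i _ => (hB.pos i).ne')
  refine ⟨R⁻¹ • Finsupp.lmapDomain _ ℂ hB.rep ∘ₗ P, fun x a ha => ?_, fun x m => ?_⟩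
  · obtain ⟨c, -, rfl⟩ := Finset.mem_image.mp
      (Finsupp.mapDomain_support (Finsupp.support_smul (Finset.mem_coe.mp ha)))
    exact hB.rep_mem c
  · change _ * expPoly (R⁻¹ • (P x).mapDomain hB.rep) m = _
    rw [map_smul, Pi.smul_apply, smul_eq_mul, mul_left_comm]
    calc R⁻¹ * ((∑ k : (i : Fin n) → Fin (r i), (expo (rootTuple ξ k) m : ℂ)) *
          expPoly ((P x).mapDomain hB.rep) m)
      _ = R⁻¹ * ∑ _k : (i : Fin n) → Fin (r i), ψ (K.cartanMono x m) := by
        rw [sum_expo_mul_expPoly_rep hξ, hP, Finset.sum_mul]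
        simp only [expo_rootTuple_mul_apply hξ hA]
      _ = ψ (K.cartanMono x m) := by
        rw [Finset.sum_const, card_pi_fin, nsmul_eq_mul, inv_mul_cancel_left₀ hR]

end

theorem exists_dual (φ : (Fin n → ℤ) → Module.Dual ℂ K.cartan') (ω : Module.Dual ℂ K.cartan)
    (hω : ∀ x : K.cartan', φ 0 x = ω ⟨x, x.2.1⟩) :
    ∃ Φ : Module.Dual ℂ (K.loopCartan n), (∀ x m, Φ (K.cartanMono x m) = φ m x) ∧
      ∀ x, Φ (K.cartanConst n x) = ω x := by
  obtain ⟨π, hπ⟩ := LinearMap.exists_leftInverse_of_injective K.cartan'.subtype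
    (LinearMap.ker_eq_bot.mpr K.cartan'.subtype_injective)
  replace hπ (x : K.cartan') : π x = x := LinearMap.congr_fun hπ x
  obtain ⟨τ, hτ⟩ := LinearMap.exists_extend ω
  replace hτ (x : K.cartan) : τ x = ω x := LinearMap.congr_fun hτ x
  let T : Laurent n →ₗ[ℂ] Module.Dual ℂ K.cartan' :=
    Finsupp.linearCombination ℂ φ ∘ₗ (AddMonoidAlgebra.coeffLinearEquiv ℂ).toLinearMap
  have hT (m : Fin n → ℤ) : T (mono m) = φ m := by simp [T, mono]
  let S : Laurent n →ₗ[ℂ] Module.Dual ℂ g := LinearMap.lcomp ℂ ℂ π ∘ₗ T +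
    (evalPoint 1).toLinearMap.smulRight (τ - τ ∘ₗ K.cartan'.subtype ∘ₗ π)
  have hS (p : Laurent n) (x : g) : S p x = T p (π x) + evalPoint 1 p * (τ x - τ (π x)) := rfl
  refine ⟨TensorProduct.lift S ∘ₗ (K.loopCartan n).subtype, fun x m => ?_, fun x => ?_⟩
  · refine (TensorProduct.lift.tmul (f' := S) _ _).trans ?_
    rw [hS, hπ, hT, sub_self, mul_zero, add_zero]
  · refine (TensorProduct.lift.tmul (f' := S) _ _).trans ?_
    rw [hS, show T 1 = φ 0 from hT 0, hω, ← hτ, ← hτ, map_one, one_mul, add_sub_cancel]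

theorem dual_ext {Φ Φ' : Module.Dual ℂ (K.loopCartan n)}
    (h : ∀ x m, Φ (K.cartanMono x m) = Φ' (K.cartanMono x m))
    (h' : ∀ x, Φ (K.cartanConst n x) = Φ' (K.cartanConst n x)) : Φ = Φ' := by
  ext z
  induction z using K.loopCartan_induction with
  | elt p x =>
    have hpairing : (K.cartanPairing Φ).flip x = (K.cartanPairing Φ').flip x :=
      laurent_hom_ext (h x)
    exact LinearMap.congr_fun hpairing p
  | const x => exact h' x
  | add x y hx hy => rw [map_add, map_add, hx, hy]

theorem exists_decomposition {r : Fin n → ℕ} {ξ : Fin n → ℂˣ}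
    (hξ : ∀ i, IsPrimitiveRoot (ξ i) (r i)) {B : Set (Fin n → ℂˣ)} (hB : IsTransversal r ξ B)
    {ψ : Module.Dual ℂ (K.loopCartan n)}
    (hψ : ∀ x : K.cartan', IsExpPolyOn Set.univ fun m => ψ (K.cartanMono x m))
    (hA : K.imageAlg ψ ≤ subLaurent r) : ∃ Φ, IsDecomposition K r ξ B ψ Φ := by
  obtain ⟨P, hPB, hP⟩ := exists_linear_expPoly_sum_eq hξ hA hB hψ
  set R : ℂ := ((∏ i, r i : ℕ) : ℂ)
  have hR : R ≠ 0 := Nat.cast_ne_zero.mpr (Finset.prod_ne_zero_iff.mpr fun i _ => (hB.pos i).ne')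
  have expPoly_zero (x : K.cartan') :
      expPoly (P x) 0 = R⁻¹ * ψ (K.cartanConst n ⟨x, x.2.1⟩) := by
    have hsum : ∑ k : (i : Fin n) → Fin (r i), (expo (rootTuple ξ k) 0 : ℂ) = R := by
      simp [expo, R]
    rw [eq_inv_mul_iff_mul_eq₀ hR, ← hsum, hP]
    rfl
  obtain ⟨Φ, hΦ, hΦ'⟩ := K.exists_dual (fun m => LinearMap.proj m ∘ₗ expPoly ∘ₗ P)
    (R⁻¹ • K.topWeight ψ) expPoly_zero
  replace hΦ (x : K.cartan') (m : Fin n → ℤ) : Φ (K.cartanMono x m) = expPoly (P x) m := hΦ x m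
  refine ⟨Φ, fun x => ⟨P x, hPB x, fun m => (hΦ x m).trans (expPoly_apply _ m)⟩,
    dual_ext (fun x m => ?_) (fun x => ?_)⟩
  · rw [LinearMap.sum_apply]
    simp only [twistFun_cartanMono]
    rw [← Finset.sum_mul, hΦ, hP]
  · have hsum := LinearMap.congr_fun
      (K.topWeight_sum_twistFun Finset.univ (rootTuple (r := r) ξ) Φ) x
    refine Eq.trans ?_ hsum.symm
    rw [card_pi_fin, LinearMap.smul_apply, show K.topWeight Φ x = R⁻¹ * ψ _ from hΦ' x,
      nsmul_eq_mul, mul_inv_cancel_left₀ hR]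

end KacMoody

end LoopKM

end

theorem proposition5p1_general {ι g : Type*} [Fintype ι] [DecidableEq ι] {C : Matrix ι ι ℤ}
    [LieRing g] [LieAlgebra ℂ g] {K : LoopKM.KacMoody C g} {n : ℕ} {r : Fin n → ℕ}
    {ξ : Fin n → ℂˣ} (hξ : ∀ i, IsPrimitiveRoot (ξ i) (r i))
    {B : Set (Fin n → ℂˣ)} (hB : LoopKM.IsTransversal r ξ B)
    {ψ : Module.Dual ℂ (K.loopCartan n)}
    (hψ : ∀ x : K.cartan', LoopKM.IsExpPolyOn Set.univ fun m => ψ (K.cartanMono x m))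
    (hA : K.imageAlg ψ ≤ LoopKM.subLaurent r) :
    (∃ Φ, LoopKM.IsDecomposition K r ξ B ψ Φ) ∧
    ∀ Φ, LoopKM.IsDecomposition K r ξ B ψ Φ →
      (K.HasCharacter ψ ∧ K.HasCharacter Φ ∧
        (∀ μ, (LoopKM.powTerms (K.char Φ) (∏ i, r i) μ).Finite) ∧
        K.char ψ = LoopKM.formalPow (K.char Φ) (∏ i, r i)) ∧
      ∀ k : (i : Fin n) → Fin (r i),
        (∀ x : g, LoopKM.twist (LoopKM.rootTuple ξ k) (LoopKM.const n x) = LoopKM.const n x) ∧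
        ∃ E : K.simpleMod (K.twistFun (LoopKM.rootTuple ξ k) Φ) ≃ₗ[ℂ] K.simpleMod Φ,
          ∀ (x : LoopKM.loopAlg g n) (v : K.simpleMod (K.twistFun (LoopKM.rootTuple ξ k) Φ)),
            E (K.act x v) = K.act (LoopKM.twist (LoopKM.rootTuple ξ k) x) (E v) := by
  refine ⟨LoopKM.KacMoody.exists_decomposition hξ hB hψ hA,
    fun Φ hΦ => ⟨?character, fun k => ?twist⟩⟩
  case character =>
    exact ⟨hΦ.hasCharacter_left, hΦ.hasCharacter_right, hΦ.powTerms_finite _,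
      hΦ.char_eq_formalPow hξ hB⟩
  case twist => exact ⟨LoopKM.KacMoody.twist_const _, K.exists_twist_equiv Φ _⟩

theorem proposition5p1 {ι g : Type*} [Fintype ι] [DecidableEq ι] {C : Matrix ι ι ℤ}
    (hC : LoopKM.IsGCM C) [LieRing g] [LieAlgebra ℂ g] (K : LoopKM.KacMoody C g)
    {n : ℕ} (r : Fin n → ℕ) (hr : ∀ i, 0 < r i)
    (ξ : Fin n → ℂˣ) (hξ : ∀ i, IsPrimitiveRoot (ξ i) (r i))
    (B : Set (Fin n → ℂˣ)) (hB : LoopKM.IsTransversal r ξ B)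
    (ψ : Module.Dual ℂ (K.loopCartan n))
    (hψ : ∀ x : K.cartan', LoopKM.IsExpPolyOn Set.univ fun m => ψ (K.cartanMono x m))
    (hA : K.imageAlg ψ = LoopKM.subLaurent r) :
    (∃ Φ, LoopKM.IsDecomposition K r ξ B ψ Φ) ∧
    ∀ Φ, LoopKM.IsDecomposition K r ξ B ψ Φ →
      (K.HasCharacter ψ ∧ K.HasCharacter Φ ∧
        (∀ μ, (LoopKM.powTerms (K.char Φ) (∏ i, r i) μ).Finite) ∧
        K.char ψ = LoopKM.formalPow (K.char Φ) (∏ i, r i)) ∧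
      ∀ k : (i : Fin n) → Fin (r i),
        (∀ x : g, LoopKM.twist (LoopKM.rootTuple ξ k) (LoopKM.const n x) = LoopKM.const n x) ∧
        ∃ E : K.simpleMod (K.twistFun (LoopKM.rootTuple ξ k) Φ) ≃ₗ[ℂ] K.simpleMod Φ,
          ∀ (x : LoopKM.loopAlg g n) (v : K.simpleMod (K.twistFun (LoopKM.rootTuple ξ k) Φ)),
            E (K.act x v) = K.act (LoopKM.twist (LoopKM.rootTuple ξ k) x) (E v) :=
  proposition5p1_general hξ hB hψ hA.le
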